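/- Let $X_1,X_2,\ldots$ be independent identically distributed positive integer-valued random variables with $p_i={\bf P}(X_1=i)$, $i\ge 1$. Let $R_k$ be the number of different elements among $X_1,\ldots,X_k$ and, for $0\le k\le n$, let $R'_k$ be the number of different elements among the last $k$ of $X_1,\ldots,X_n$, i.e. among $X_{n-k+1},\ldots,X_n$ ($R_0=R'_0=0$). For $t\in[0,1]$ put $$Z_n(t)=\frac{R_{[nt]}-{\bf E}R_{[nt]}}{\sqrt{{\bf E}R_n}},\qquad Z'_n(t)=\frac{R'_{[nt]}-{\bf E}R_{[nt]}}{\sqrt{{\bf E}R_n}}.$$ Let $A:[0,1]\to\mathbb{R}$ have bounded variation, with $A(1)=0$, with $A(t)=0$ for all $t\in[0,\delta]$ for some $\delta\in(0,1)$, and with $\int_0^1\log t\,dA(t)=1$; all integrals $\int_0^1\cdot\,dA$ are Lebesgue--Stieltjes integrals over the closed interval $[0,1]$, where $A(0-)=A(0)$ and $A(1+)=A(1)$. Put $$\widehat\theta=\frac12\left(\int_0^1\log^+R_{[nt]}\,dA(t)+\int_0^1\log^+R'_{[nt]}\,dA(t)\right),\qquad \log^+x=\max(\log x,0),\ \log^+0=0.$$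 Suppose that $p_i=c\,i^{-1/\theta}(1+o(i^{-1/2}))$ as $i\to\infty$, with $\theta\in(0,1)$ and $c>0$. Then, as $n\to\infty$, $$\sqrt{{\bf E}R_n}\,(\widehat\theta-\theta)-\frac12\int_0^1t^{-\theta}\,(Z_n(t)+Z'_n(t))\,dA(t)\to 0\quad\text{in probability}.$$ Consequently, $\widehat\theta$ is asymptotically normal at rate $({\bf E}R_n)^{-1/2}$: $\widehat\theta\to\theta$ in probability, and $\sqrt{{\bf E}R_n}\,(\widehat\theta-\theta)$ converges weakly to the centered normal distribution with variance $$\sigma^2=\frac12\int_0^1\!\int_0^1(st)^{-\theta}\,(K(s,t)+K'(s,t))\,dA(s)\,dA(t)>0,$$ where $K(s,t)=(s+t)^\theta-\max(s^\theta,t^\theta)$ and $K'(s,t)=((s+t)^\theta-1)\,{\bf 1}(s+t>1)$. -/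

import Mathlib

open MeasureTheory ProbabilityTheory Filter Asymptotics
open scoped Topology unitInterval

namespace UrnScheme

noncomputable section

variable {Ω : Type*}

/-- The number of different elements among the first `k` of the observations.
The `(j+1)`-st observation is `X j`, so these are `X 0, …, X (k-1)`. -/
def forwardCount (X : ℕ → Ω → ℕ) (k : ℕ) (ω : Ω) : ℕ :=
  ((Finset.range k).image fun j => X j ω).card

/-- The number of different elements among the last `k` of the first `n` observations
(`k ≤ n`), that is, among `X (n-k), …, X (n-1)`. -/
def backwardCount (X : ℕ → Ω → ℕ) (n k : ℕ) (ω : Ω) : ℕ :=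
  ((Finset.Ico (n - k) n).image fun j => X j ω).card

/-- The integer part of `n t`. -/
def timeIndex (n : ℕ) (t : I) : ℕ := ⌊(n : ℝ) * (t : ℝ)⌋₊

/-- The expectation of the number of different elements among the first `k` observations. -/
def meanCount [MeasurableSpace Ω] (μ : Measure Ω) (X : ℕ → Ω → ℕ) (k : ℕ) : ℝ :=
  ∫ ω, (forwardCount X k ω : ℝ) ∂μ

/-- The normalized forward process `Z_n`. -/
def forwardProcess [MeasurableSpace Ω] (μ : Measure Ω) (X : ℕ → Ω → ℕ) (n : ℕ) (t : I) (ω : Ω) :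
    ℝ :=
  ((forwardCount X (timeIndex n t) ω : ℝ) - meanCount μ X (timeIndex n t)) /
    √(meanCount μ X n)

/-- The normalized backward process `Z'_n`. -/
def backwardProcess [MeasurableSpace Ω] (μ : Measure Ω) (X : ℕ → Ω → ℕ) (n : ℕ) (t : I) (ω : Ω) :
    ℝ :=
  ((backwardCount X n (timeIndex n t) ω : ℝ) - meanCount μ X (timeIndex n t)) /
    √(meanCount μ X n)

/-- The Lebesgue-Stieltjes integral `∫_0^1 f dA` over the closed interval `[0,1]`, for `A` of
bounded variation on `[0,1]`; `dA` gives a point `x` the mass `A(x+) - A(x-)`, where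
`A(0-) = A(0)` and `A(1+) = A(1)`. -/
def stieltjesIntegral {A : I → ℝ} (hA : BoundedVariationOn A Set.univ) (f : I → ℝ) : ℝ :=
  hA.vectorMeasure.integral f (ContinuousLinearMap.lsmul ℝ ℝ)

/-- The estimator built from the forward process. -/
def forwardEstimator {A : I → ℝ} (hA : BoundedVariationOn A Set.univ) (X : ℕ → Ω → ℕ) (n : ℕ)
    (ω : Ω) : ℝ :=
  stieltjesIntegral hA fun t => Real.posLog (forwardCount X (timeIndex n t) ω)

/-- The estimator built from the backward process. -/
def backwardEstimator {A : I → ℝ} (hA : BoundedVariationOn A Set.univ) (X : ℕ → Ω → ℕ) (n : ℕ)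
    (ω : Ω) : ℝ :=
  stieltjesIntegral hA fun t => Real.posLog (backwardCount X n (timeIndex n t) ω)

/-- The symmetric estimator, the mean of the forward and the backward one. -/
def estimator {A : I → ℝ} (hA : BoundedVariationOn A Set.univ) (X : ℕ → Ω → ℕ) (n : ℕ)
    (ω : Ω) : ℝ :=
  (forwardEstimator hA X n ω + backwardEstimator hA X n ω) / 2

/-- The covariance function `K` of each of the two limiting processes. -/
def covK (θ : ℝ) (s t : I) : ℝ :=
  ((s : ℝ) + (t : ℝ)) ^ θ - max ((s : ℝ) ^ θ) ((t : ℝ) ^ θ)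

/-- The cross-covariance function `K'` of the two limiting processes. -/
def crossCovK (θ : ℝ) (s t : I) : ℝ :=
  if 1 < (s : ℝ) + (t : ℝ) then ((s : ℝ) + (t : ℝ)) ^ θ - 1 else 0

/-- The asymptotic variance of the symmetric estimator,
`(1/2) ∫∫ (s t)^(-θ) (K(s,t) + K'(s,t)) dA(s) dA(t)`. -/
def limitVariance {A : I → ℝ} (hA : BoundedVariationOn A Set.univ) (θ : ℝ) : ℝ :=
  1 / 2 * stieltjesIntegral hA fun t => stieltjesIntegral hA fun s =>
    ((s : ℝ) * (t : ℝ)) ^ (-θ) * (covK θ s t + crossCovK θ s t)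

end

end UrnScheme

/-!
The number of different values seen so far is a sum over the values `i` of indicators of their
appearance, and under the power law its expectation `M k` is `C k ^ θ + o(k ^ (θ / 2))`; here the
error `o(i ^ (-1 / 2))` in the frequencies is exactly what makes the bias negligible at the scale
`√(M n)` (`exists_abs_poissonMean_sub_le`, `exists_abs_meanFn_sub_le`). As `A` vanishes near `0`
and at `1`, the measure `dA` lives on `[δ, 1]` and has total mass zero. So integrating
`log M [nt] ≈ log C + θ log n + θ log t` against `dA` kills the constants and leaves `θ`.

*Linearization.* The variance of each count is at most its expectation. Hence
`log R - log M k = (R - M k) / M k` up to a remainder of mean `O(log (M k) / M k)`, which vanishes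
even after multiplication by `√(M n)`. Replacing `M n / M [nt]` by `t ^ (-θ)` costs nothing, since
the fluctuations are bounded in mean (`IsSample.tendsto_linearization`).

*Limit law of the linear part.* Let independent Poisson numbers of observations with mean one be
drawn in each of `n` steps, from the same sequence. Then the events "`i` does not appear in the
steps of a set `J`", for all `J` at once, are independent for different values `i`
(`IsSample.iIndepFun_of_missField`), and the counts in a window change by `O(√n)` times the average
slope `M k / k` in mean, by concavity of `M` (`IsSample.integral_abs_poissonization_le`), which is
`o(√(M n))`. So the linear part is, up to a negligible error, a sum over the values of independent,
centered, uniformly small variables (`IsSample.tendsto_coupling`). Their variances add up to an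
expression in the Poisson means, which converges by the power law
(`IsSample.tendsto_sum_variance`). The characteristic function of such a sum is close to the
Gaussian one (`norm_charFun_sum_sub_le`).

*Positivity of the variance.* The limiting covariance is a mixture over `y > 0` of the kernels
`exp (-y max(s, t)) + exp (-y min(s + t, 1)) - 2 exp (-y (s + t))`. Up to a factor 2, the
quadratic form of such a kernel is the variance of `a(S) + a(S')`, where `a(u)` is the mass which
the weight gives to `[0, u]` and `S`, `S'` are the times to the first point of a Poisson process of
rate `y` on `[0, 1]` from either end (`integral_expCov_eq`). If it vanished then `a` would vanish
almost everywhere on `(0, 1)`. But then integration by parts would give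
`∫ t ^ θ log t · t ^ (-θ) dA(t) = 0`, while this integral is `∫ log t dA(t) = 1`
(`integral_totalCov_pos`).
-/

namespace UrnScheme

set_option linter.unusedSectionVars false

/-! ### Occupancy counts of an i.i.d. sample -/

/-- `X` is a measurable i.i.d. sequence of natural numbers. -/
structure IsSample {Ω : Type*} [MeasurableSpace Ω] (μ : Measure Ω) (X : ℕ → Ω → ℕ) : Prop where
  meas : ∀ j, Measurable (X j)
  indep : iIndepFun X μ
  ident : ∀ j, IdentDistrib (X j) (X 0) μ μ

/-- The number of different elements among the observations with index in `J`. -/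
def distinct {Ω : Type*} (X : ℕ → Ω → ℕ) (J : Finset ℕ) (ω : Ω) : ℕ :=
  (J.image fun j => X j ω).card

/-- The probability that an observation has value `i`. -/
noncomputable def freq {Ω : Type*} [MeasurableSpace Ω] (μ : Measure Ω) (X : ℕ → Ω → ℕ) (i : ℕ) :
    ℝ :=
  μ.real {ω | X 0 ω = i}

/-- The expected number of different values among `k` independent draws from the weights `p`. -/
noncomputable def meanFn (p : ℕ → ℝ) (k : ℕ) : ℝ := ∑' i, (1 - (1 - p i) ^ k)

section Sample

variable {Ω : Type*} [MeasurableSpace Ω] {μ : Measure Ω} [IsProbabilityMeasure μ] {X : ℕ → Ω → ℕ}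

lemma distinct_le (J : Finset ℕ) (ω : Ω) : distinct X J ω ≤ J.card := Finset.card_image_le

omit [IsProbabilityMeasure μ] in
lemma freq_nonneg (i : ℕ) : 0 ≤ freq μ X i := measureReal_nonneg

lemma freq_le_one (i : ℕ) : freq μ X i ≤ 1 := measureReal_le_one

lemma IsSample.measurable_distinct (h : IsSample μ X) (J : Finset ℕ) : Measurable (distinct X J) := by
  classical
  have : distinct X J = (fun x : J → ℕ => (Finset.univ.image x).card) ∘ fun ω (j : J) => X j ω := by
    funext ω
    simp only [distinct, Function.comp]
    congr 1
    ext i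
    simp
  rw [this]
  exact (Measurable.of_discrete).comp (measurable_pi_lambda (fun ω (j : J) => X j ω) fun j => h.meas j)

lemma IsSample.integrable_comp_distinct (h : IsSample μ X) (J : Finset ℕ) (f : ℕ → ℝ) :
    Integrable (fun ω => f (distinct X J ω)) μ := by
  have hm : Measurable fun ω => f (distinct X J ω) :=
    (measurable_from_top (f := f)).comp (h.measurable_distinct J)
  refine Integrable.of_bound hm.aestronglyMeasurable (∑ k ∈ Finset.range (J.card + 1), |f k|) ?_
  refine Eventually.of_forall fun ω => ?_
  rw [Real.norm_eq_abs]
  exact Finset.single_le_sum (f := fun k => |f k|) (fun _ _ => abs_nonneg _)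
    (Finset.mem_range.2 (Nat.lt_succ_of_le (distinct_le J ω)))

lemma IsSample.measureReal_mem (h : IsSample μ X) (j : ℕ) (D : Finset ℕ) :
    μ.real {ω | X j ω ∈ D} = ∑ i ∈ D, freq μ X i := by
  have h1 : μ.real {ω | X j ω ∈ D} = μ.real {ω | X 0 ω ∈ D} := by
    simp only [measureReal_def]
    congr 1
    exact (h.ident j).measure_mem_eq (s := (D : Set ℕ)) (by measurability)
  rw [h1]
  have h2 : {ω | X 0 ω ∈ D} = ⋃ i ∈ D, {ω | X 0 ω = i} := by ext ω; simp
  rw [h2, measureReal_biUnion_finset]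
  · rfl
  · intro i _ j _ hij
    refine Set.disjoint_left.2 fun ω hi hj => hij ?_
    exact (show X 0 ω = i from hi).symm.trans hj
  · intro i _
    exact h.meas 0 (measurableSet_singleton i)

/-- Independent observations avoid prescribed sets with the product of the probabilities. -/
lemma IsSample.measureReal_forall_notMem (h : IsSample μ X) (J : Finset ℕ) (D : ℕ → Finset ℕ) :
    μ.real {ω | ∀ r ∈ J, X r ω ∉ D r} = ∏ r ∈ J, (1 - ∑ i ∈ D r, freq μ X i) := by
  have h1 : {ω | ∀ r ∈ J, X r ω ∉ D r} = ⋂ r ∈ J, X r ⁻¹' ((D r : Set ℕ)ᶜ) := by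
    ext ω; simp
  have h2 := h.indep.measure_inter_preimage_eq_mul J (sets := fun r => ((D r : Set ℕ)ᶜ))
    (fun r _ => by measurability)
  rw [h1, measureReal_def, h2, ENNReal.toReal_prod]
  refine Finset.prod_congr rfl fun r _ => ?_
  rw [← h.measureReal_mem r (D r), ← probReal_compl_eq_one_sub]
  · rfl
  · exact h.meas r (by measurability)

lemma IsSample.hasSum_freq (h : IsSample μ X) : HasSum (freq μ X) 1 := by
  have h1 : ∑' i, μ {ω | X 0 ω = i} = 1 := by
    rw [← measure_iUnion]
    · have : (⋃ i, {ω | X 0 ω = i}) = Set.univ := by ext ω; simp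
      rw [this, measure_univ]
    · intro i j hij
      refine Set.disjoint_left.2 fun ω hi hj => hij ?_
      exact (show X 0 ω = i from hi).symm.trans hj
    · intro i
      exact h.meas 0 (measurableSet_singleton i)
  have h2 : Summable fun i => (μ {ω | X 0 ω = i}).toReal :=
    ENNReal.summable_toReal (by rw [h1]; simp)
  have h3 := h2.hasSum
  rwa [← ENNReal.tsum_toReal_eq (fun i => measure_ne_top _ _), h1, ENNReal.toReal_one] at h3

end Sample

lemma one_sub_pow_le {p : ℝ} (h1 : p ≤ 1) (k : ℕ) : 1 - (1 - p) ^ k ≤ k * p := by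
  have := one_add_mul_le_pow (a := -p) (by linarith) k
  rw [← sub_eq_add_neg] at this
  linarith

lemma one_sub_pow_nonneg {p : ℝ} (h0 : 0 ≤ p) (h1 : p ≤ 1) (k : ℕ) : 0 ≤ 1 - (1 - p) ^ k := by
  have := pow_le_one₀ (n := k) (sub_nonneg.2 h1) (by linarith)
  linarith

/-- Nonnegative weights with sum one. -/
structure IsWeight (p : ℕ → ℝ) : Prop where
  nonneg : ∀ i, 0 ≤ p i
  hasSum : HasSum p 1

lemma IsWeight.le_one {p : ℕ → ℝ} (hp : IsWeight p) (i : ℕ) : p i ≤ 1 :=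
  le_hasSum hp.hasSum i fun j _ => hp.nonneg j

lemma IsWeight.summable_one_sub_pow {p : ℕ → ℝ} (hp : IsWeight p) (k : ℕ) :
    Summable fun i => 1 - (1 - p i) ^ k :=
  Summable.of_nonneg_of_le (fun i => one_sub_pow_nonneg (hp.nonneg i) (hp.le_one i) k)
    (fun i => one_sub_pow_le (hp.le_one i) k) (hp.hasSum.summable.mul_left _)

lemma meanFn_zero (p : ℕ → ℝ) : meanFn p 0 = 0 := by simp [meanFn]

lemma IsWeight.meanFn_one {p : ℕ → ℝ} (hp : IsWeight p) : meanFn p 1 = 1 := by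
  simp [meanFn, hp.hasSum.tsum_eq]

lemma IsWeight.meanFn_succ_sub {p : ℕ → ℝ} (hp : IsWeight p) (k : ℕ) :
    meanFn p (k + 1) - meanFn p k = ∑' i, p i * (1 - p i) ^ k := by
  rw [meanFn, meanFn, ← (hp.summable_one_sub_pow _).tsum_sub (hp.summable_one_sub_pow _)]
  congr 1
  funext i
  ring

lemma IsWeight.summable_mul_pow {p : ℕ → ℝ} (hp : IsWeight p) (k : ℕ) :
    Summable fun i => p i * (1 - p i) ^ k :=
  Summable.of_nonneg_of_le
    (fun i => mul_nonneg (hp.nonneg i) (pow_nonneg (sub_nonneg.2 (hp.le_one i)) _))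
    (fun i => mul_le_of_le_one_right (hp.nonneg i)
      (pow_le_one₀ (sub_nonneg.2 (hp.le_one i)) (by linarith [hp.nonneg i]))) hp.hasSum.summable

lemma IsWeight.meanFn_mono {p : ℕ → ℝ} (hp : IsWeight p) : Monotone (meanFn p) := by
  refine monotone_nat_of_le_succ fun k => ?_
  have := hp.meanFn_succ_sub k
  have h2 : 0 ≤ ∑' i, p i * (1 - p i) ^ k := tsum_nonneg fun i =>
    mul_nonneg (hp.nonneg i) (pow_nonneg (sub_nonneg.2 (hp.le_one i)) _)
  linarith

lemma IsWeight.meanFn_nonneg {p : ℕ → ℝ} (hp : IsWeight p) (k : ℕ) : 0 ≤ meanFn p k := by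
  rw [← meanFn_zero p]; exact hp.meanFn_mono (Nat.zero_le k)

lemma IsWeight.one_le_meanFn {p : ℕ → ℝ} (hp : IsWeight p) {k : ℕ} (hk : 1 ≤ k) :
    1 ≤ meanFn p k := by
  rw [← hp.meanFn_one]; exact hp.meanFn_mono hk

lemma IsWeight.antitone_increment {p : ℕ → ℝ} (hp : IsWeight p) :
    Antitone fun k => meanFn p (k + 1) - meanFn p k := by
  refine antitone_nat_of_succ_le fun k => ?_
  rw [hp.meanFn_succ_sub, hp.meanFn_succ_sub]
  refine (hp.summable_mul_pow _).tsum_le_tsum (fun i => ?_) (hp.summable_mul_pow _)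
  refine mul_le_mul_of_nonneg_left ?_ (hp.nonneg i)
  exact pow_le_pow_of_le_one (sub_nonneg.2 (hp.le_one i)) (by linarith [hp.nonneg i]) (Nat.le_succ k)

/-- Concavity of the mean: later increments are at most the average of the earlier ones. -/
lemma IsWeight.mul_meanFn_add_sub_le {p : ℕ → ℝ} (hp : IsWeight p) (k e : ℕ) :
    k * (meanFn p (k + e) - meanFn p k) ≤ e * meanFn p k := by
  set d : ℕ → ℝ := fun k => meanFn p (k + 1) - meanFn p k with hd
  have h1 : ∀ m, m * d m ≤ meanFn p m := by
    intro m
    have : ∑ j ∈ Finset.range m, d j = meanFn p m := by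
      rw [hd, Finset.sum_range_sub, meanFn_zero, sub_zero]
    rw [← this, ← nsmul_eq_mul]
    have h := Finset.card_nsmul_le_sum (Finset.range m) d (d m) fun j hj =>
      hp.antitone_increment (Finset.mem_range.1 hj).le
    rwa [Finset.card_range] at h
  have h2 : meanFn p (k + e) - meanFn p k ≤ e * d k := by
    induction e with
    | zero => simp
    | succ e ih =>
      have h3 : d (k + e) ≤ d k := hp.antitone_increment (Nat.le_add_right k e)
      have h4 : d (k + e) = meanFn p (k + (e + 1)) - meanFn p (k + e) := rfl
      push_cast
      linarith
  calc (k : ℝ) * (meanFn p (k + e) - meanFn p k) ≤ k * (e * d k) := by gcongr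
    _ = e * (k * d k) := by ring
    _ ≤ e * meanFn p k := by gcongr; exact h1 k

lemma IsWeight.mul_meanFn_sub_le {p : ℕ → ℝ} (hp : IsWeight p) (k e : ℕ) :
    k * (meanFn p k - meanFn p (k - e)) ≤ e * meanFn p k := by
  rcases le_total k e with h | h
  · rw [Nat.sub_eq_zero_of_le h, meanFn_zero, sub_zero]
    have := hp.meanFn_nonneg k
    gcongr
  · obtain ⟨l, rfl⟩ := Nat.exists_eq_add_of_le' h
    rw [Nat.add_sub_cancel]
    have := hp.mul_meanFn_add_sub_le l e
    push_cast
    linarith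

section Sample

variable {Ω : Type*} [MeasurableSpace Ω] {μ : Measure Ω} [IsProbabilityMeasure μ] {X : ℕ → Ω → ℕ}

lemma IsSample.isWeight (h : IsSample μ X) : IsWeight (freq μ X) :=
  ⟨fun i => freq_nonneg i, h.hasSum_freq⟩

/-- The event that the value `i` occurs among the observations with index in `J`. -/
def hit (X : ℕ → Ω → ℕ) (J : Finset ℕ) (i : ℕ) : Set Ω := {ω | ∃ r ∈ J, X r ω = i}

lemma IsSample.measurableSet_hit (h : IsSample μ X) (J : Finset ℕ) (i : ℕ) :
    MeasurableSet (hit X J i) := by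
  have : hit X J i = ⋃ r ∈ J, X r ⁻¹' {i} := by ext ω; simp [hit]
  rw [this]
  exact Finset.measurableSet_biUnion _ fun r _ => h.meas r (measurableSet_singleton i)

lemma IsSample.measureReal_compl_hit (h : IsSample μ X) (J : Finset ℕ) (i : ℕ) :
    μ.real (hit X J i)ᶜ = (1 - freq μ X i) ^ J.card := by
  have := h.measureReal_forall_notMem J fun _ => {i}
  simp only [Finset.mem_singleton, Finset.sum_singleton, Finset.prod_const] at this
  rw [← this]
  congr 1
  ext ω
  simp [hit]

lemma IsSample.measureReal_hit (h : IsSample μ X) (J : Finset ℕ) (i : ℕ) :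
    μ.real (hit X J i) = 1 - (1 - freq μ X i) ^ J.card := by
  rw [← h.measureReal_compl_hit, probReal_compl_eq_one_sub (h.measurableSet_hit J i)]
  ring

lemma distinct_eq_sum (J : Finset ℕ) (ω : Ω) (m : ℕ) (hm : ∀ r ∈ J, X r ω < m) :
    (distinct X J ω : ℝ) = ∑ i ∈ Finset.range m, (hit X J i).indicator 1 ω := by
  classical
  have h1 : J.image (fun j => X j ω) = (Finset.range m).filter fun i => ω ∈ hit X J i := by
    ext i
    rw [Finset.mem_filter, Finset.mem_image, Finset.mem_range]
    constructor
    · rintro ⟨r, hr, rfl⟩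
      exact ⟨hm r hr, r, hr, rfl⟩
    · rintro ⟨_, r, hr, rfl⟩
      exact ⟨r, hr, rfl⟩
  rw [distinct, h1, Finset.card_filter]
  push_cast
  refine Finset.sum_congr rfl fun i _ => ?_
  by_cases hi : ω ∈ hit X J i <;> simp [hi]

lemma tendsto_sum_hit (J : Finset ℕ) (ω : Ω) :
    Tendsto (fun m => ∑ i ∈ Finset.range m, (hit X J i).indicator (1 : Ω → ℝ) ω) atTop
      (𝓝 (distinct X J ω : ℝ)) := by
  refine tendsto_const_nhds.congr' ?_
  filter_upwards [eventually_gt_atTop (J.sup fun r => X r ω)] with m hm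
  exact distinct_eq_sum J ω m fun r hr => (Finset.le_sup (f := fun r => X r ω) hr).trans_lt hm

lemma sum_hit_le (J : Finset ℕ) (ω : Ω) (m : ℕ) :
    ∑ i ∈ Finset.range m, (hit X J i).indicator (1 : Ω → ℝ) ω ≤ distinct X J ω := by
  rw [distinct_eq_sum J ω (max m (J.sup (fun r => X r ω) + 1))]
  · refine Finset.sum_le_sum_of_subset_of_nonneg ?_ fun _ _ _ =>
      Set.indicator_nonneg (fun _ _ => zero_le_one) _
    exact Finset.range_mono (le_max_left _ _)
  · intro r hr
    exact (Nat.lt_succ_of_le (Finset.le_sup (f := fun r => X r ω) hr)).trans_le (le_max_right _ _)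

lemma sum_hit_nonneg (J : Finset ℕ) (ω : Ω) (m : ℕ) :
    0 ≤ ∑ i ∈ Finset.range m, (hit X J i).indicator (1 : Ω → ℝ) ω :=
  Finset.sum_nonneg fun _ _ => Set.indicator_nonneg (fun _ _ => zero_le_one) _

lemma IsSample.integrable_hit (h : IsSample μ X) (J : Finset ℕ) (i : ℕ) :
    Integrable ((hit X J i).indicator (1 : Ω → ℝ)) μ :=
  (integrable_const 1).indicator (h.measurableSet_hit J i)

lemma IsSample.integral_sum_hit (h : IsSample μ X) (J : Finset ℕ) (m : ℕ) :
    ∫ ω, ∑ i ∈ Finset.range m, (hit X J i).indicator (1 : Ω → ℝ) ω ∂μ =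
      ∑ i ∈ Finset.range m, (1 - (1 - freq μ X i) ^ J.card) := by
  rw [integral_finsetSum _ fun i _ => h.integrable_hit J i]
  refine Finset.sum_congr rfl fun i _ => ?_
  rw [integral_indicator_one (h.measurableSet_hit J i), h.measureReal_hit]

/-- The expected number of different observations. -/
lemma IsSample.integral_distinct (h : IsSample μ X) (J : Finset ℕ) :
    ∫ ω, (distinct X J ω : ℝ) ∂μ = meanFn (freq μ X) J.card := by
  have h1 := tendsto_integral_of_dominated_convergence (μ := μ)
    (F := fun m ω => ∑ i ∈ Finset.range m, (hit X J i).indicator (1 : Ω → ℝ) ω)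
    (f := fun ω => (distinct X J ω : ℝ)) (fun _ => (J.card : ℝ))
    (fun m => (integrable_finsetSum _ fun i _ => h.integrable_hit J i).aestronglyMeasurable)
    (integrable_const _)
    (fun m => Eventually.of_forall fun ω => by
      rw [Real.norm_eq_abs, abs_of_nonneg (sum_hit_nonneg J ω m)]
      exact (sum_hit_le J ω m).trans (by exact_mod_cast distinct_le J ω))
    (Eventually.of_forall fun ω => tendsto_sum_hit J ω)
  simp_rw [h.integral_sum_hit J] at h1
  exact tendsto_nhds_unique h1
    (h.isWeight.summable_one_sub_pow J.card).hasSum.tendsto_sum_nat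

lemma IsSample.memLp_hit (h : IsSample μ X) (J : Finset ℕ) (i : ℕ) :
    MemLp ((hit X J i).indicator (1 : Ω → ℝ)) 2 μ :=
  memLp_indicator_const 2 (h.measurableSet_hit J i) 1 (Or.inr (measure_ne_top _ _))

/-- The occurrences of two different values are negatively correlated. -/
lemma IsSample.covariance_hit_nonpos (h : IsSample μ X) (J : Finset ℕ) {i j : ℕ} (hij : i ≠ j) :
    cov[(hit X J i).indicator (1 : Ω → ℝ), (hit X J j).indicator (1 : Ω → ℝ); μ] ≤ 0 := by
  rw [covariance_eq_sub (h.memLp_hit J i) (h.memLp_hit J j)]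
  have h1 : (hit X J i).indicator (1 : Ω → ℝ) * (hit X J j).indicator (1 : Ω → ℝ) =
      (hit X J i ∩ hit X J j).indicator 1 := by
    rw [Set.inter_indicator_one]
  have hi := h.measurableSet_hit J i
  have hj := h.measurableSet_hit J j
  rw [h1, integral_indicator_one (hi.inter hj), integral_indicator_one hi,
    integral_indicator_one hj]
  have h2 : μ.real (hit X J i ∪ hit X J j)ᶜ = (1 - (freq μ X i + freq μ X j)) ^ J.card := by
    -- all the observations avoid `i` and `j`
    have := h.measureReal_forall_notMem J fun _ => {i, j}
    simp only [Finset.mem_insert, Finset.mem_singleton, Finset.sum_pair hij,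
      Finset.prod_const] at this
    rw [← this]
    congr 1
    ext ω
    simp only [hit, Set.mem_compl_iff, Set.mem_union, Set.mem_ofPred_eq]
    grind
  rw [probReal_compl_eq_one_sub (hi.union hj)] at h2
  have h3 := measureReal_union_add_inter (μ := μ) (s := hit X J i) hj
  rw [h.measureReal_hit, h.measureReal_hit] at *
  set a := freq μ X i
  set b := freq μ X j
  have hab : a + b ≤ 1 := by
    have := h.hasSum_freq.summable.sum_le_tsum {i, j} fun i _ => freq_nonneg (μ := μ) (X := X) i
    rwa [Finset.sum_pair hij, h.hasSum_freq.tsum_eq] at this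
  have ha : 0 ≤ a := freq_nonneg i
  have hb : 0 ≤ b := freq_nonneg j
  have h4 : (1 - (a + b)) ^ J.card ≤ (1 - a) ^ J.card * (1 - b) ^ J.card := by
    rw [← mul_pow]
    refine pow_le_pow_left₀ (by linarith) ?_ _
    nlinarith
  nlinarith

/-- The variance of the number of different observations is at most its mean. -/
lemma IsSample.integral_sq_distinct_sub_le (h : IsSample μ X) (J : Finset ℕ) :
    ∫ ω, ((distinct X J ω : ℝ) - meanFn (freq μ X) J.card) ^ 2 ∂μ ≤ meanFn (freq μ X) J.card := by
  set S : ℕ → Ω → ℝ := fun m ω => ∑ i ∈ Finset.range m, (hit X J i).indicator (1 : Ω → ℝ) ω with hS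
  set e : ℕ → ℝ := fun m => ∑ i ∈ Finset.range m, (1 - (1 - freq μ X i) ^ J.card) with he
  have het : Tendsto e atTop (𝓝 (meanFn (freq μ X) J.card)) :=
    (h.isWeight.summable_one_sub_pow J.card).hasSum.tendsto_sum_nat
  have hele : ∀ m, e m ≤ meanFn (freq μ X) J.card := fun m =>
    (h.isWeight.summable_one_sub_pow J.card).sum_le_tsum _ fun i _ =>
      one_sub_pow_nonneg (freq_nonneg i) (freq_le_one i) _
  have he0 : ∀ m, 0 ≤ e m := fun m => Finset.sum_nonneg fun i _ =>
      one_sub_pow_nonneg (freq_nonneg i) (freq_le_one i) _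
  have hSm : ∀ m, AEStronglyMeasurable (S m) μ := fun m =>
    (integrable_finsetSum _ fun i _ => h.integrable_hit J i).aestronglyMeasurable
  have hvar : ∀ m, ∫ ω, (S m ω - e m) ^ 2 ∂μ ≤ meanFn (freq μ X) J.card := by
    intro m
    have h1 : ∫ ω, S m ω ∂μ = e m := h.integral_sum_hit J m
    have h2 := variance_eq_integral (hSm m).aemeasurable
    rw [h1] at h2
    rw [← h2]
    have h3 : S m = ∑ i ∈ Finset.range m, (hit X J i).indicator (1 : Ω → ℝ) := by
      funext ω; simp [hS, Finset.sum_apply]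
    rw [h3, variance_sum' fun i _ => h.memLp_hit J i]
    refine le_trans ?_ (hele m)
    refine Finset.sum_le_sum fun i hi => ?_
    -- the diagonal term is a variance of an indicator, the others are nonpositive
    rw [← Finset.add_sum_erase _ _ hi]
    have h4 : ∑ j ∈ (Finset.range m).erase i,
        cov[(hit X J i).indicator (1 : Ω → ℝ), (hit X J j).indicator (1 : Ω → ℝ); μ] ≤ 0 :=
      Finset.sum_nonpos fun j hj => h.covariance_hit_nonpos J (Finset.ne_of_mem_erase hj).symm
    have h5 : cov[(hit X J i).indicator (1 : Ω → ℝ), (hit X J i).indicator (1 : Ω → ℝ); μ] ≤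
        1 - (1 - freq μ X i) ^ J.card := by
      rw [covariance_self (h.integrable_hit J i).aemeasurable]
      refine (variance_le_expectation_sq (h.integrable_hit J i).aestronglyMeasurable).trans ?_
      have h6 : (hit X J i).indicator (1 : Ω → ℝ) ^ 2 = (hit X J i).indicator 1 := by
        rw [pow_two, ← Set.inter_indicator_one, Set.inter_self]
      rw [h6, integral_indicator_one (h.measurableSet_hit J i), h.measureReal_hit]
    linarith
  have hlim := tendsto_integral_of_dominated_convergence (μ := μ)
    (F := fun m ω => (S m ω - e m) ^ 2)
    (f := fun ω => ((distinct X J ω : ℝ) - meanFn (freq μ X) J.card) ^ 2)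
    (fun _ => ((J.card : ℝ) + meanFn (freq μ X) J.card) ^ 2)
    (fun m => ((hSm m).sub aestronglyMeasurable_const).pow 2)
    (integrable_const _)
    (fun m => Eventually.of_forall fun ω => by
      rw [Real.norm_eq_abs, abs_pow]
      refine pow_le_pow_left₀ (abs_nonneg _) ?_ 2
      have h1 := sum_hit_nonneg (X := X) J ω m
      have h2 : S m ω ≤ J.card :=
        (sum_hit_le J ω m).trans (by exact_mod_cast distinct_le J ω)
      have h3 := hele m
      have h4 := he0 m
      have h5 : 0 ≤ S m ω := h1
      rw [abs_le]
      constructor <;> linarith [(Nat.cast_nonneg J.card : (0 : ℝ) ≤ J.card)])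
    (Eventually.of_forall fun ω => ((tendsto_sum_hit J ω).sub het).pow 2)
  exact le_of_tendsto' hlim hvar

/-- The mean absolute deviation of a count is at most the root of its mean. -/
lemma IsSample.integral_abs_distinct_sub_le (h : IsSample μ X) (J : Finset ℕ) :
    ∫ ω, |(distinct X J ω : ℝ) - meanFn (freq μ X) J.card| ∂μ ≤ √(meanFn (freq μ X) J.card) := by
  have hi := h.integrable_comp_distinct J fun k => |(k : ℝ) - meanFn (freq μ X) J.card|
  have hi2 := h.integrable_comp_distinct J fun k => ((k : ℝ) - meanFn (freq μ X) J.card) ^ 2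
  refine Real.le_sqrt_of_sq_le (le_trans ?_ (h.integral_sq_distinct_sub_le J))
  have := variance_nonneg (fun ω => |(distinct X J ω : ℝ) - meanFn (freq μ X) J.card|) μ
  rw [variance_eq_sub] at this
  · simp only [Pi.pow_apply, sq_abs] at this
    linarith
  · refine (memLp_two_iff_integrable_sq hi.aestronglyMeasurable).2 ?_
    simpa only [sq_abs] using hi2

/-- Replacing the window `A` of observations by a window `B` that differs from it in at most `e`
places changes the count in mean by at most `3 e` times the average slope of the expected count:
the difference is controlled by the counts in `A ∪ B`, `A` and `B`, and the expected count is
concave in the size of the window. -/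
lemma IsSample.integral_abs_distinct_sub_distinct_le (h : IsSample μ X) (A B : Finset ℕ) {e : ℕ}
    (hU : (A ∪ B).card ≤ A.card + e) (hB : A.card ≤ B.card + e) :
    A.card * ∫ ω, |(distinct X A ω : ℝ) - distinct X B ω| ∂μ ≤ 3 * e * meanFn (freq μ X) A.card := by
  have hint : ∀ J : Finset ℕ, Integrable (fun ω => (distinct X J ω : ℝ)) μ := fun J =>
    h.integrable_comp_distinct J fun k => (k : ℝ)
  have hmono : ∀ {J J' : Finset ℕ}, J ⊆ J' → ∀ ω, (distinct X J ω : ℝ) ≤ distinct X J' ω :=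
    fun hJ ω => by exact_mod_cast Finset.card_le_card (Finset.image_subset_image hJ)
  have h1 : ∫ ω, |(distinct X A ω : ℝ) - distinct X B ω| ∂μ ≤
      ∫ ω, (2 * (distinct X (A ∪ B) ω : ℝ) - distinct X A ω - distinct X B ω) ∂μ := by
    refine integral_mono ((hint A).sub (hint B)).abs
      ((((hint _).const_mul 2).sub (hint A)).sub (hint B)) fun ω => ?_
    have ha := hmono (Finset.subset_union_left (s₁ := A) (s₂ := B)) ω
    have hb := hmono (Finset.subset_union_right (s₁ := A) (s₂ := B)) ω
    simp only
    rw [abs_le]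
    constructor <;> linarith
  rw [integral_sub (f := fun ω => 2 * (distinct X (A ∪ B) ω : ℝ) - distinct X A ω)
      (((hint _).const_mul 2).sub (hint A)) (hint B),
    integral_sub ((hint _).const_mul 2) (hint A), integral_const_mul, h.integral_distinct,
    h.integral_distinct, h.integral_distinct] at h1
  have hw := h.isWeight
  have h2 : meanFn (freq μ X) (A ∪ B).card ≤ meanFn (freq μ X) (A.card + e) := hw.meanFn_mono hU
  have h3 : meanFn (freq μ X) (A.card - e) ≤ meanFn (freq μ X) B.card :=
    hw.meanFn_mono (by omega)
  have h4 := hw.mul_meanFn_add_sub_le A.card e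
  have h5 := hw.mul_meanFn_sub_le A.card e
  calc (A.card : ℝ) * ∫ ω, |(distinct X A ω : ℝ) - distinct X B ω| ∂μ
      ≤ A.card * (2 * (meanFn (freq μ X) (A.card + e) - meanFn (freq μ X) A.card) +
          (meanFn (freq μ X) A.card - meanFn (freq μ X) (A.card - e))) := by
        gcongr
        linarith
    _ ≤ _ := by linarith

end Sample

/-! ### Asymptotics of the mean for power-law weights -/

/-- The mean number of occupied urns after a Poisson number of draws with mean `l`. -/
noncomputable def poissonMean (p : ℕ → ℝ) (l : ℝ) : ℝ := ∑' i, (1 - Real.exp (-(l * p i)))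

lemma one_sub_exp_le (x : ℝ) : 1 - Real.exp (-x) ≤ x := by
  have := Real.add_one_le_exp (-x); linarith

lemma one_sub_exp_nonneg {x : ℝ} (hx : 0 ≤ x) : 0 ≤ 1 - Real.exp (-x) := by
  have := Real.exp_le_one_iff.2 (neg_nonpos.2 hx); linarith

lemma one_sub_exp_le_one (x : ℝ) : 1 - Real.exp (-x) ≤ 1 := by
  have := Real.exp_pos (-x); linarith

lemma IsWeight.summable_one_sub_exp {p : ℕ → ℝ} (hp : IsWeight p) {l : ℝ} (hl : 0 ≤ l) :
    Summable fun i => 1 - Real.exp (-(l * p i)) :=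
  Summable.of_nonneg_of_le (fun i => one_sub_exp_nonneg (mul_nonneg hl (hp.nonneg i)))
    (fun _ => one_sub_exp_le _) (hp.hasSum.summable.mul_left _)

/-- The error of the Poisson approximation for a single value is between zero and its weight. -/
lemma exp_sub_pow_bounds {p : ℝ} (h0 : 0 ≤ p) (h1 : p ≤ 1) (k : ℕ) :
    0 ≤ Real.exp (-(k * p)) - (1 - p) ^ k ∧ Real.exp (-(k * p)) - (1 - p) ^ k ≤ p := by
  have he : Real.exp (-(k * p)) = Real.exp (-p) ^ k := by
    rw [← Real.exp_nat_mul]; congr 1; ring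
  constructor
  · rw [he, sub_nonneg]
    exact pow_le_pow_left₀ (by linarith) (by have := Real.add_one_le_exp (-p); linarith) _
  · -- `(1 - p) e ^ p ≥ 1 - p ^ 2` and Bernoulli's inequality
    have h2 : 1 - p ^ 2 ≤ (1 - p) * Real.exp p := by
      have := Real.add_one_le_exp p
      nlinarith
    have h3 : 1 - k * p ^ 2 ≤ (1 - p ^ 2) ^ k := by
      have := one_add_mul_le_pow (a := -p ^ 2) (by nlinarith) k
      rw [← sub_eq_add_neg] at this
      linarith
    have h4 : (1 - p ^ 2) ^ k ≤ ((1 - p) * Real.exp p) ^ k :=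
      pow_le_pow_left₀ (by nlinarith) h2 k
    have h5 : Real.exp (-p) ^ k * ((1 - p) * Real.exp p) ^ k = (1 - p) ^ k := by
      rw [← mul_pow]
      congr 1
      rw [mul_left_comm, ← Real.exp_add, neg_add_cancel, Real.exp_zero, mul_one]
    have h6 : k * p * Real.exp (-(k * p)) ≤ 1 := by
      have := Real.add_one_le_exp (k * p)
      rw [Real.exp_neg, ← div_eq_mul_inv, div_le_one (Real.exp_pos _)]
      linarith
    have h7 : Real.exp (-p) ^ k * (1 - k * p ^ 2) ≤ (1 - p) ^ k := by
      rw [← h5]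
      gcongr
      linarith
    rw [← he] at h7
    nlinarith

/-- The means for a fixed and for a Poisson number of draws differ by at most one. -/
lemma IsWeight.abs_meanFn_sub_poissonMean_le {p : ℕ → ℝ} (hp : IsWeight p) (k : ℕ) :
    |meanFn p k - poissonMean p k| ≤ 1 := by
  have hs1 := hp.summable_one_sub_pow k
  have hs2 := hp.summable_one_sub_exp (Nat.cast_nonneg k)
  rw [meanFn, poissonMean, ← hs1.tsum_sub hs2]
  have h1 : ∀ i, (1 - (1 - p i) ^ k) - (1 - Real.exp (-(k * p i))) =
      Real.exp (-(k * p i)) - (1 - p i) ^ k := fun i => by ring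
  have hb := fun i => exp_sub_pow_bounds (hp.nonneg i) (hp.le_one i) k
  simp_rw [h1]
  have hs : Summable fun i => Real.exp (-(k * p i)) - (1 - p i) ^ k :=
    Summable.of_nonneg_of_le (fun i => (hb i).1) (fun i => (hb i).2) hp.hasSum.summable
  rw [abs_of_nonneg (tsum_nonneg fun i => (hb i).1)]
  exact (hs.tsum_le_tsum (fun i => (hb i).2) hp.hasSum.summable).trans_eq hp.hasSum.tsum_eq

section PowerLaw

variable {θ c : ℝ}

lemma integrableOn_Ioi_zero_of_le {f : ℝ → ℝ} (hf : Measurable f) {a : ℝ} (ha : a < -1) {b : ℝ}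
    (hb : -1 < b) {K K' : ℝ}
    (h1 : ∀ x ∈ Set.Ioc (0 : ℝ) 1, |f x| ≤ K' * x ^ b) (h2 : ∀ x ∈ Set.Ioi (1 : ℝ), |f x| ≤ K * x ^ a) :
    IntegrableOn f (Set.Ioi 0) := by
  rw [← Set.Ioc_union_Ioi_eq_Ioi (zero_le_one (α := ℝ))]
  refine IntegrableOn.union ?_ ?_
  · have h3 : IntegrableOn (fun x : ℝ => K' * x ^ b) (Set.Ioc 0 1) := by
      have := (intervalIntegral.intervalIntegrable_rpow' (a := 0) (b := 1) hb)
      rw [intervalIntegrable_iff_integrableOn_Ioc_of_le zero_le_one] at this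
      exact this.const_mul _
    refine Integrable.mono' h3 hf.aestronglyMeasurable ?_
    filter_upwards [ae_restrict_mem measurableSet_Ioc] with x hx using h1 x hx
  · have h3 : IntegrableOn (fun x : ℝ => K * x ^ a) (Set.Ioi 1) :=
      (integrableOn_Ioi_rpow_of_lt ha one_pos).const_mul _
    refine Integrable.mono' h3 hf.aestronglyMeasurable ?_
    filter_upwards [ae_restrict_mem measurableSet_Ioi] with x hx using h2 x hx

/-- The constant in the asymptotic mean `C n ^ θ`. -/
noncomputable def meanConst (θ c : ℝ) : ℝ :=
  ∫ x in Set.Ioi (0 : ℝ), (1 - Real.exp (-(c * x ^ (-(1 / θ)))))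

lemma neg_inv_lt_neg_one (hθ : θ ∈ Set.Ioo (0 : ℝ) 1) : -(1 / θ) < -1 := by
  have := (one_lt_div hθ.1).2 hθ.2
  linarith

lemma integrableOn_meanConst (hθ : θ ∈ Set.Ioo (0 : ℝ) 1) (hc : 0 < c) :
    IntegrableOn (fun x : ℝ => 1 - Real.exp (-(c * x ^ (-(1 / θ))))) (Set.Ioi 0) := by
  refine integrableOn_Ioi_zero_of_le (by fun_prop) (neg_inv_lt_neg_one hθ)
    (b := 0) (by norm_num) (K' := 1) (K := c) ?_ ?_
  · intro x hx
    have : 0 ≤ x ^ (-(1 / θ)) := Real.rpow_nonneg hx.1.le _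
    rw [abs_of_nonneg (one_sub_exp_nonneg (by positivity)), Real.rpow_zero, mul_one]
    exact one_sub_exp_le_one _
  · intro x hx
    have : 0 ≤ x ^ (-(1 / θ)) := Real.rpow_nonneg (zero_le_one.trans hx.le) _
    rw [abs_of_nonneg (one_sub_exp_nonneg (by positivity))]
    exact one_sub_exp_le _

lemma meanConst_pos (hθ : θ ∈ Set.Ioo (0 : ℝ) 1) (hc : 0 < c) : 0 < meanConst θ c := by
  rw [meanConst, setIntegral_pos_iff_support_of_nonneg_ae]
  · refine lt_of_lt_of_le ?_ (measure_mono (s := Set.Ioi (0 : ℝ)) ?_)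
    · simp
    · intro x hx
      refine ⟨?_, hx⟩
      rw [Function.mem_support]
      have : 0 < x ^ (-(1 / θ)) := Real.rpow_pos_of_pos hx _
      have := Real.exp_lt_one_iff.2 (neg_neg_of_pos (mul_pos hc this))
      linarith
  · filter_upwards [ae_restrict_mem measurableSet_Ioi] with x hx
    have : 0 ≤ x ^ (-(1 / θ)) := Real.rpow_nonneg (le_of_lt hx) _
    exact one_sub_exp_nonneg (by positivity)
  · exact integrableOn_meanConst hθ hc

lemma rpow_scale (hθ : θ ∈ Set.Ioo (0 : ℝ) 1) {l x : ℝ} (hl : 0 < l) (hx : 0 < x) :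
    (l ^ (-θ) * x) ^ (-(1 / θ)) = l * x ^ (-(1 / θ)) := by
  rw [Real.mul_rpow (by positivity) hx.le, ← Real.rpow_mul hl.le]
  congr 1
  have : -θ * -(1 / θ) = 1 := by have := hθ.1.ne'; field_simp
  rw [this, Real.rpow_one]

/-- The exact power law: the sum over the urns is within one of its integral. -/
lemma abs_tsum_one_sub_exp_sub_le (hθ : θ ∈ Set.Ioo (0 : ℝ) 1) (hc : 0 < c) {l : ℝ} (hl : 0 < l) :
    |∑' i : ℕ, (1 - Real.exp (-(l * (c * ((i + 1 : ℕ) : ℝ) ^ (-(1 / θ)))))) -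
      meanConst θ c * l ^ θ| ≤ 1 := by
  -- the value at `0` is set to `1`, since `0 ^ (-1 / θ)` has the junk value `0`
  set g : ℝ → ℝ := fun x => if x ≤ 0 then 1 else 1 - Real.exp (-(l * (c * x ^ (-(1 / θ))))) with hg
  have hgpos : ∀ x, 0 < x → g x = 1 - Real.exp (-(c * (l ^ (-θ) * x) ^ (-(1 / θ)))) := by
    intro x hx
    rw [rpow_scale hθ hl hx]
    simp only [hg, not_le.2 hx, if_false]
    ring_nf
  have hle1 : ∀ x, g x ≤ 1 := by
    intro x
    simp only [hg]
    split_ifs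
    · exact le_rfl
    · exact one_sub_exp_le_one _
  have hnn : ∀ x, 0 ≤ g x := by
    intro x
    simp only [hg]
    split_ifs with h
    · exact zero_le_one
    · have : 0 ≤ x ^ (-(1 / θ)) := Real.rpow_nonneg (not_le.1 h).le _
      exact one_sub_exp_nonneg (by positivity)
  have hanti : AntitoneOn g (Set.Ici 0) := by
    intro x hx y hy hxy
    rcases (show (0 : ℝ) ≤ x from hx).eq_or_lt with h | h
    · have : g x = 1 := by simp [hg, ← h]
      rw [this]; exact hle1 y
    · have hy0 : 0 < y := h.trans_le hxy
      simp only [hg, not_le.2 h, not_le.2 hy0, if_false]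
      have : y ^ (-(1 / θ)) ≤ x ^ (-(1 / θ)) :=
        Real.rpow_le_rpow_of_nonpos h hxy (by have := neg_inv_lt_neg_one hθ; linarith)
      gcongr
  have hlp : 0 < l ^ (-θ) := Real.rpow_pos_of_pos hl _
  have hint : IntegrableOn g (Set.Ioi 0) := by
    have h1 := (integrableOn_Ioi_comp_mul_left_iff
      (fun x : ℝ => 1 - Real.exp (-(c * x ^ (-(1 / θ))))) 0 hlp).2
      (by rw [mul_zero]; exact integrableOn_meanConst hθ hc)
    exact h1.congr_fun (fun x hx => (hgpos x hx).symm) measurableSet_Ioi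
  have hval : ∫ x in Set.Ioi (0 : ℝ), g x = meanConst θ c * l ^ θ := by
    rw [setIntegral_congr_fun measurableSet_Ioi fun x hx => hgpos x hx,
      integral_comp_mul_left_Ioi (fun x : ℝ => 1 - Real.exp (-(c * x ^ (-(1 / θ))))) 0 hlp,
      mul_zero, ← meanConst, Real.rpow_neg hl.le, inv_inv, smul_eq_mul, mul_comm]
  -- integral test for the antitone function `g`
  have hsum := hanti.summable_of_integrableOn_Ioi_zero hint fun t _ => hnn t
  have h1 := hanti.tsum_add_one_le_integral hint fun t _ => hnn t
  have h2 := hanti.integral_le_tsum hsum fun t _ => hnn t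
  rw [hsum.tsum_eq_zero_add] at h2
  have h3 : ∀ i : ℕ, g ((i + 1 : ℕ) : ℝ) =
      1 - Real.exp (-(l * (c * ((i + 1 : ℕ) : ℝ) ^ (-(1 / θ))))) := by
    intro i
    have : ¬ (((i + 1 : ℕ) : ℝ) ≤ 0) := by push_cast; have := Nat.cast_nonneg (α := ℝ) i; linarith
    simp only [hg, this, if_false]
  simp_rw [h3] at h1 h2
  rw [hval] at h1 h2
  have h4 : g ((0 : ℕ) : ℝ) = 1 := by simp [hg]
  rw [h4] at h2
  rw [abs_le]
  constructor <;> linarith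

/-- Bound for the sum by which the perturbation of the power law is controlled: substituting
`x = l ^ θ y` in the corresponding integral gives `l ^ (θ / 2)` times a constant, because of the
factor `x ^ (-1 / 2)`. -/
lemma exists_tsum_min_le (hθ : θ ∈ Set.Ioo (0 : ℝ) 1) (hc : 0 < c) :
    ∃ K : ℝ, 0 ≤ K ∧ ∀ l : ℝ, 0 < l →
      Summable (fun i : ℕ => ((i + 1 : ℕ) : ℝ) ^ (-(1 / 2) : ℝ) *
        min 2 (l * (c * ((i + 1 : ℕ) : ℝ) ^ (-(1 / θ))))) ∧
      ∑' i : ℕ, ((i + 1 : ℕ) : ℝ) ^ (-(1 / 2) : ℝ) *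
        min 2 (l * (c * ((i + 1 : ℕ) : ℝ) ^ (-(1 / θ)))) ≤ 2 + K * l ^ (θ / 2) := by
  set u : ℝ → ℝ := fun x => x ^ (-(1 / 2) : ℝ) * min 2 (c * x ^ (-(1 / θ))) with hu
  have hunn : ∀ x, 0 < x → 0 ≤ u x := by
    intro x hx
    have h1 : 0 ≤ x ^ (-(1 / θ)) := Real.rpow_nonneg hx.le _
    have h2 : 0 ≤ x ^ (-(1 / 2) : ℝ) := Real.rpow_nonneg hx.le _
    exact mul_nonneg h2 (le_min zero_le_two (by positivity))
  have huint : IntegrableOn u (Set.Ioi 0) := by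
    refine integrableOn_Ioi_zero_of_le (by fun_prop) (neg_inv_lt_neg_one hθ)
      (b := -(1 / 2)) (by norm_num) (K' := 2) (K := c) ?_ ?_
    · intro x hx
      have h2 : 0 ≤ x ^ (-(1 / 2) : ℝ) := Real.rpow_nonneg hx.1.le _
      rw [abs_of_nonneg (hunn x hx.1), mul_comm 2]
      exact mul_le_mul_of_nonneg_left (min_le_left _ _) h2
    · intro x hx
      have hx0 : (0 : ℝ) < x := zero_lt_one.trans hx
      have h2 : x ^ (-(1 / 2) : ℝ) ≤ 1 :=
        Real.rpow_le_one_of_one_le_of_nonpos hx.le (by norm_num)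
      have h1 : 0 ≤ x ^ (-(1 / θ)) := Real.rpow_nonneg hx0.le _
      rw [abs_of_nonneg (hunn x hx0)]
      calc u x ≤ 1 * (c * x ^ (-(1 / θ))) :=
            mul_le_mul h2 (min_le_right _ _) (le_min zero_le_two (by positivity)) zero_le_one
        _ = _ := one_mul _
  refine ⟨∫ x in Set.Ioi (0 : ℝ), u x,
    setIntegral_nonneg measurableSet_Ioi fun x hx => hunn x hx, fun l hl => ?_⟩
  set f : ℝ → ℝ := fun x => x ^ (-(1 / 2) : ℝ) * min 2 (l * (c * x ^ (-(1 / θ)))) with hf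
  have hlp : 0 < l ^ (-θ) := Real.rpow_pos_of_pos hl _
  have hfu : ∀ x, 0 < x → f x = l ^ (-(θ / 2)) * u (l ^ (-θ) * x) := by
    intro x hx
    simp only [hf, hu]
    rw [rpow_scale hθ hl hx, Real.mul_rpow hlp.le hx.le, ← Real.rpow_mul hl.le]
    have : l ^ (-(θ / 2)) * l ^ (-θ * -(1 / 2)) = 1 := by
      rw [← Real.rpow_add hl]
      have : -(θ / 2) + -θ * -(1 / 2) = 0 := by ring
      rw [this, Real.rpow_zero]
    rw [mul_left_comm c l]
    linear_combination -(x ^ (-(1 / 2) : ℝ) * min 2 (l * (c * x ^ (-(1 / θ))))) * this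
  have hfnn : ∀ x, 0 < x → 0 ≤ f x := by
    intro x hx
    rw [hfu x hx]
    exact mul_nonneg (Real.rpow_nonneg hl.le _) (hunn _ (by positivity))
  -- the integral test starts at `1`, the first summand is bounded separately
  have hanti : AntitoneOn f (Set.Ici ((1 : ℕ) : ℝ)) := by
    intro x hx y hy hxy
    have hx0 : (0 : ℝ) < x := by simp only [Nat.cast_one, Set.mem_Ici] at hx; linarith
    have hy0 : 0 < y := hx0.trans_le hxy
    have h1 : y ^ (-(1 / θ)) ≤ x ^ (-(1 / θ)) :=
        Real.rpow_le_rpow_of_nonpos hx0 hxy (by have := neg_inv_lt_neg_one hθ; linarith)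
    have h2 : y ^ (-(1 / 2) : ℝ) ≤ x ^ (-(1 / 2) : ℝ) :=
        Real.rpow_le_rpow_of_nonpos hx0 hxy (by norm_num)
    have h3 : 0 ≤ y ^ (-(1 / θ)) := Real.rpow_nonneg hy0.le _
    have h4 : 0 ≤ x ^ (-(1 / 2) : ℝ) := Real.rpow_nonneg hx0.le _
    simp only [hf]
    refine mul_le_mul h2 ?_ (le_min zero_le_two (by positivity)) h4
    exact min_le_min le_rfl (by gcongr)
  have hint0 : IntegrableOn f (Set.Ioi 0) := by
    have h1 := ((integrableOn_Ioi_comp_mul_left_iff u 0 hlp).2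
      (by rw [mul_zero]; exact huint)).const_mul (l ^ (-(θ / 2)))
    exact IntegrableOn.congr_fun h1 (fun x hx => (hfu x hx).symm) measurableSet_Ioi
  have hval : ∫ x in Set.Ioi (0 : ℝ), f x = (∫ x in Set.Ioi (0 : ℝ), u x) * l ^ (θ / 2) := by
    rw [setIntegral_congr_fun measurableSet_Ioi fun x hx => hfu x hx, integral_const_mul,
      integral_comp_mul_left_Ioi u 0 hlp, mul_zero, Real.rpow_neg hl.le θ, inv_inv, smul_eq_mul,
      ← mul_assoc, ← Real.rpow_add hl, mul_comm]
    congr 2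
    ring
  have hsub : Set.Ioi ((1 : ℕ) : ℝ) ⊆ Set.Ioi 0 := Set.Ioi_subset_Ioi (by norm_num)
  have hnn1 : ∀ t ∈ Set.Ioi ((1 : ℕ) : ℝ), 0 ≤ f t := fun t ht => hfnn t (hsub ht)
  have hsum := hanti.summable_of_integrableOn_Ioi (hint0.mono_set hsub) hnn1
  have hsum1 : Summable fun i : ℕ => f ((i + 1 : ℕ) : ℝ) := (summable_nat_add_iff 1).2 hsum
  refine ⟨hsum1, ?_⟩
  change ∑' i : ℕ, f ((i + 1 : ℕ) : ℝ) ≤ _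
  rw [hsum1.tsum_eq_zero_add]
  have h1 := hanti.tsum_comp_add_le_integral 1 (hint0.mono_set hsub) hnn1
  have h2 : ∫ x in Set.Ioi ((1 : ℕ) : ℝ), f x ≤ ∫ x in Set.Ioi (0 : ℝ), f x := by
    refine setIntegral_mono_set hint0 ?_ hsub.eventuallyLE
    filter_upwards [ae_restrict_mem measurableSet_Ioi] with x hx using hfnn x hx
  have h3 : f ((0 + 1 : ℕ) : ℝ) ≤ 2 := by
    simp only [hf, zero_add, Nat.cast_one, Real.one_rpow, one_mul]
    exact min_le_left _ _
  rw [hval] at h2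
  exact add_le_add h3 (h1.trans h2)

lemma abs_exp_neg_sub_exp_neg_le {a b : ℝ} (hb : 0 ≤ b) (hab : b / 2 ≤ a) :
    |Real.exp (-a) - Real.exp (-b)| ≤ |a - b| * Real.exp (-(b / 2)) := by
  have key : ∀ x y : ℝ, x ≤ y → Real.exp (-x) - Real.exp (-y) ≤ (y - x) * Real.exp (-x) := by
    intro x y _
    have h1 := Real.add_one_le_exp (-(y - x))
    have h2 : Real.exp (-y) = Real.exp (-(y - x)) * Real.exp (-x) := by
      rw [← Real.exp_add]; ring_nf
    rw [h2]
    nlinarith [Real.exp_pos (-x)]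
  rcases le_total a b with h | h
  · have h1 : Real.exp (-b) ≤ Real.exp (-a) := Real.exp_le_exp.2 (by linarith)
    rw [abs_of_nonneg (by linarith), abs_of_nonpos (by linarith)]
    refine (key a b h).trans ?_
    have h2 : Real.exp (-a) ≤ Real.exp (-(b / 2)) := Real.exp_le_exp.2 (by linarith)
    nlinarith
  · have h1 : Real.exp (-a) ≤ Real.exp (-b) := Real.exp_le_exp.2 (by linarith)
    rw [abs_of_nonpos (by linarith), abs_of_nonneg (by linarith)]
    have h2 : Real.exp (-b) ≤ Real.exp (-(b / 2)) := Real.exp_le_exp.2 (by linarith)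
    have := key b a h
    nlinarith

/-- For weights `c i ^ (-1 / θ) (1 + o(i ^ (-1 / 2)))` the Poisson mean is
`C l ^ θ + o(l ^ (θ / 2))`, in a form uniform in `l`. -/
lemma exists_abs_poissonMean_sub_le (hθ : θ ∈ Set.Ioo (0 : ℝ) 1) (hc : 0 < c) {p : ℕ → ℝ}
    (hw : IsWeight p) {ε : ℕ → ℝ} (hε : ε =o[atTop] fun i : ℕ => (i : ℝ) ^ (-(1 / 2) : ℝ))
    (hp : ∀ i : ℕ, 1 ≤ i → p i = c * (i : ℝ) ^ (-(1 / θ)) * (1 + ε i)) {η : ℝ} (hη : 0 < η) :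
    ∃ K : ℝ, 0 ≤ K ∧ ∀ l : ℝ, 0 ≤ l →
      |poissonMean p l - meanConst θ c * l ^ θ| ≤ η * l ^ (θ / 2) + K := by
  obtain ⟨K₀, hK₀, hmin⟩ := exists_tsum_min_le hθ hc
  -- beyond `N` the relative perturbation `ε i` is at most `η' i ^ (-1 / 2)` with `η' K₀ ≤ η`
  set η' : ℝ := min (η / (K₀ + 1)) (1 / 2) with hη'
  have hη'pos : 0 < η' := lt_min (by positivity) (by norm_num)
  have hη'half : η' ≤ 1 / 2 := min_le_right _ _
  have hη'K : η' * K₀ ≤ η := by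
    calc η' * K₀ ≤ η / (K₀ + 1) * K₀ := by gcongr; exact min_le_left _ _
      _ ≤ η / (K₀ + 1) * (K₀ + 1) := by gcongr; linarith
      _ = η := by field_simp
  obtain ⟨N, hN⟩ := eventually_atTop.1 (hε.bound hη'pos)
  refine ⟨1 + N + 2 * η' + 1, by positivity, fun l hl => ?_⟩
  rcases hl.eq_or_lt with rfl | hl
  · have h1 : poissonMean p 0 = 0 := by simp [poissonMean]
    rw [h1, Real.zero_rpow hθ.1.ne', mul_zero, sub_zero, abs_zero]
    positivity
  set q : ℕ → ℝ := fun i => c * ((i + 1 : ℕ) : ℝ) ^ (-(1 / θ)) with hq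
  have hq0 : ∀ i, 0 ≤ q i := fun i => by positivity
  have hsp : Summable fun i => 1 - Real.exp (-(l * p (i + 1))) :=
    (summable_nat_add_iff 1).2 (hw.summable_one_sub_exp hl.le)
  -- a summable bound for the differences of the terms: `1` for the first `N` of them
  set b : ℕ → ℝ := fun i => (if i < N then 1 else 0) + η' * (((i + 1 : ℕ) : ℝ) ^ (-(1 / 2) : ℝ) *
        min 2 (l * (c * ((i + 1 : ℕ) : ℝ) ^ (-(1 / θ))))) with hb
  have hbsum0 : HasSum (fun i : ℕ => if i < N then (1 : ℝ) else 0) N := by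
    have : HasSum (fun i : ℕ => if i < N then (1 : ℝ) else 0)
        (∑ i ∈ Finset.range N, if i < N then (1 : ℝ) else 0) :=
      hasSum_sum_of_ne_finset_zero (fun i hi => if_neg (by simpa using hi))
    convert this using 1
    rw [Finset.sum_congr rfl fun i hi => if_pos (Finset.mem_range.1 hi)]
    simp
  have hbs : Summable b := hbsum0.summable.add ((hmin l hl).1.mul_left _)
  have hbt : ∑' i, b i ≤ N + η' * (2 + K₀ * l ^ (θ / 2)) := by
    rw [hbsum0.summable.tsum_add ((hmin l hl).1.mul_left _), hbsum0.tsum_eq, tsum_mul_left]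
    gcongr
    exact (hmin l hl).2
  have hterm : ∀ i, |Real.exp (-(l * p (i + 1))) - Real.exp (-(l * q i))| ≤ b i := by
    intro i
    have hmn : 0 ≤ ((i + 1 : ℕ) : ℝ) ^ (-(1 / 2) : ℝ) *
        min 2 (l * (c * ((i + 1 : ℕ) : ℝ) ^ (-(1 / θ)))) :=
      mul_nonneg (by positivity) (le_min zero_le_two (by positivity))
    by_cases hi : i < N
    · have h1 := one_sub_exp_nonneg (mul_nonneg hl.le (hw.nonneg (i + 1)))
      have h2 := one_sub_exp_nonneg (mul_nonneg hl.le (hq0 i))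
      have h3 := Real.exp_pos (-(l * p (i + 1)))
      have h4 := Real.exp_pos (-(l * q i))
      have h5 : |Real.exp (-(l * p (i + 1))) - Real.exp (-(l * q i))| ≤ 1 := by
        rw [abs_le]; constructor <;> linarith
      refine h5.trans ?_
      simp only [hb, hi, if_true]
      have := mul_nonneg hη'pos.le hmn
      linarith
    · have hε1 := hN (i + 1) (by omega)
      rw [Real.norm_eq_abs, Real.norm_eq_abs, abs_of_nonneg (by positivity :
        0 ≤ ((i + 1 : ℕ) : ℝ) ^ (-(1 / 2) : ℝ))] at hε1
      have hle1 : ((i + 1 : ℕ) : ℝ) ^ (-(1 / 2) : ℝ) ≤ 1 :=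
        Real.rpow_le_one_of_one_le_of_nonpos (by push_cast; linarith [Nat.cast_nonneg (α := ℝ) i])
          (by norm_num)
      have hε2 : |ε (i + 1)| ≤ 1 / 2 := hε1.trans (by nlinarith)
      have hpq : p (i + 1) = q i * (1 + ε (i + 1)) := hp (i + 1) (by omega)
      have hx : 0 ≤ l * q i := mul_nonneg hl.le (hq0 i)
      have h1 := abs_exp_neg_sub_exp_neg_le (a := l * p (i + 1)) hx
        (by rw [hpq]; nlinarith [(abs_le.1 hε2).1])
      refine h1.trans ?_
      have h2 : |l * p (i + 1) - l * q i| = l * q i * |ε (i + 1)| := by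
        rw [hpq, show l * (q i * (1 + ε (i + 1))) - l * q i = l * q i * ε (i + 1) by ring,
          abs_mul, abs_of_nonneg hx]
      -- `x e ^ (-x / 2) ≤ min 2 x`
      have h3 : l * q i * Real.exp (-(l * q i / 2)) ≤ min 2 (l * q i) := by
        refine le_min ?_ ?_
        · have := Real.add_one_le_exp (l * q i / 2)
          rw [Real.exp_neg, ← div_eq_mul_inv, div_le_iff₀ (Real.exp_pos _)]
          linarith
        · exact mul_le_of_le_one_right hx (Real.exp_le_one_iff.2 (by linarith))
      rw [h2]
      simp only [hb, hi, if_false, zero_add]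
      calc l * q i * |ε (i + 1)| * Real.exp (-(l * q i / 2))
          = |ε (i + 1)| * (l * q i * Real.exp (-(l * q i / 2))) := by ring
        _ ≤ (η' * ((i + 1 : ℕ) : ℝ) ^ (-(1 / 2) : ℝ)) * min 2 (l * q i) := by
            gcongr
        _ = _ := by ring
  have hsd : Summable fun i => Real.exp (-(l * p (i + 1))) - Real.exp (-(l * q i)) :=
    Summable.of_norm_bounded hbs hterm
  have hsq : Summable fun i => 1 - Real.exp (-(l * q i)) := by
    refine (hsp.add hsd).congr fun i => ?_
    ring
  have hdiff : |∑' i, (1 - Real.exp (-(l * p (i + 1)))) - ∑' i, (1 - Real.exp (-(l * q i)))| ≤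
      ∑' i, b i := by
    rw [← hsp.tsum_sub hsq, ← Real.norm_eq_abs]
    refine tsum_of_norm_bounded hbs.hasSum fun i => ?_
    rw [Real.norm_eq_abs, show 1 - Real.exp (-(l * p (i + 1))) - (1 - Real.exp (-(l * q i))) =
      -(Real.exp (-(l * p (i + 1))) - Real.exp (-(l * q i))) by ring, abs_neg]
    exact hterm i
  have hmain := abs_tsum_one_sub_exp_sub_le hθ hc hl
  have h0 : |1 - Real.exp (-(l * p 0))| ≤ 1 := by
    rw [abs_of_nonneg (one_sub_exp_nonneg (mul_nonneg hl.le (hw.nonneg 0)))]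
    exact one_sub_exp_le_one _
  rw [poissonMean, (hw.summable_one_sub_exp hl.le).tsum_eq_zero_add]
  have h5 : η' * (2 + K₀ * l ^ (θ / 2)) ≤ 2 * η' + η * l ^ (θ / 2) := by
    have : 0 ≤ l ^ (θ / 2) := by positivity
    nlinarith
  rw [abs_le] at *
  constructor <;> linarith

/-- The same statement for the mean after a fixed number of draws. -/
lemma exists_abs_meanFn_sub_le (hθ : θ ∈ Set.Ioo (0 : ℝ) 1) (hc : 0 < c) {p : ℕ → ℝ}
    (hw : IsWeight p) {ε : ℕ → ℝ} (hε : ε =o[atTop] fun i : ℕ => (i : ℝ) ^ (-(1 / 2) : ℝ))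
    (hp : ∀ i : ℕ, 1 ≤ i → p i = c * (i : ℝ) ^ (-(1 / θ)) * (1 + ε i)) {η : ℝ} (hη : 0 < η) :
    ∃ K : ℝ, 0 ≤ K ∧ ∀ k : ℕ,
      |meanFn p k - meanConst θ c * (k : ℝ) ^ θ| ≤ η * (k : ℝ) ^ (θ / 2) + K := by
  obtain ⟨K, hK, h⟩ := exists_abs_poissonMean_sub_le hθ hc hw hε hp hη
  refine ⟨K + 1, by linarith, fun k => ?_⟩
  have h1 := h k (Nat.cast_nonneg k)
  have h2 := hw.abs_meanFn_sub_poissonMean_le k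
  rw [abs_le] at *
  constructor <;> linarith

end PowerLaw

/-! ### Characteristic functions of sums of small independent variables -/

lemma norm_prod_sub_prod_le_sum {ι : Type*} (s : Finset ι) (a b : ι → ℂ) (ha : ∀ i ∈ s, ‖a i‖ ≤ 1)
    (hb : ∀ i ∈ s, ‖b i‖ ≤ 1) : ‖∏ i ∈ s, a i - ∏ i ∈ s, b i‖ ≤ ∑ i ∈ s, ‖a i - b i‖ := by
  classical
  induction s using Finset.induction_on with
  | empty => simp
  | insert i s hi ih =>
    rw [Finset.prod_insert hi, Finset.prod_insert hi, Finset.sum_insert hi]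
    -- the products are exchanged one factor at a time
    have h1 : a i * ∏ j ∈ s, a j - b i * ∏ j ∈ s, b j =
        (a i - b i) * ∏ j ∈ s, a j + b i * (∏ j ∈ s, a j - ∏ j ∈ s, b j) := by ring
    have h2 : ‖∏ j ∈ s, a j‖ ≤ 1 := by
      rw [norm_prod]
      exact Finset.prod_le_one (fun _ _ => norm_nonneg _)
        fun j hj => ha j (Finset.mem_insert_of_mem hj)
    have h3 := ih (fun j hj => ha j (Finset.mem_insert_of_mem hj))
      fun j hj => hb j (Finset.mem_insert_of_mem hj)
    have h4 := hb i (Finset.mem_insert_self _ _)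
    rw [h1]
    refine (norm_add_le _ _).trans ?_
    rw [norm_mul, norm_mul]
    have := norm_nonneg (a i - b i)
    have := norm_nonneg (∏ j ∈ s, a j - ∏ j ∈ s, b j)
    nlinarith

lemma norm_exp_mul_I_sub_le {x : ℝ} (hx : |x| ≤ 1) :
    ‖Complex.exp (x * Complex.I) - (1 + x * Complex.I - x ^ 2 / 2)‖ ≤ |x| ^ 3 := by
  have hn : ‖(x : ℂ) * Complex.I‖ = |x| := by simp
  have h := Complex.exp_bound (x := x * Complex.I) (by rwa [hn]) (n := 3) (by norm_num)
  rw [hn] at h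
  have h1 : ∑ m ∈ Finset.range 3, ((x : ℂ) * Complex.I) ^ m / (m.factorial : ℂ) =
      1 + x * Complex.I - x ^ 2 / 2 := by
    simp only [Finset.sum_range_succ, Finset.sum_range_zero, Nat.factorial, mul_pow,
      Complex.I_sq]
    push_cast
    ring
  rw [h1] at h
  refine h.trans ?_
  have : (((Nat.succ 3 : ℕ) : ℝ) * (((Nat.factorial 3 : ℕ) : ℝ) * ((3 : ℕ) : ℝ))⁻¹) ≤ 1 := by
    norm_num [Nat.factorial]
  exact mul_le_of_le_one_right (by positivity) this

lemma abs_exp_neg_sub_le {y : ℝ} (h0 : 0 ≤ y) (h1 : y ≤ 1) : |Real.exp (-y) - (1 - y)| ≤ y ^ 2 := by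
  have := Real.abs_exp_sub_one_sub_id_le (x := -y) (by rwa [abs_neg, abs_of_nonneg h0])
  rw [neg_sq] at this
  convert this using 2
  ring

section

variable {Ω : Type*} [MeasurableSpace Ω] {P : Measure Ω} [IsProbabilityMeasure P]

/-- Second-order expansion of the characteristic function of a small centered variable. -/
lemma norm_charFun_sub_le {U : Ω → ℝ} (hU : AEMeasurable U P) {b t : ℝ} (hb : ∀ ω, |U ω| ≤ b)
    (hmean : ∫ ω, U ω ∂P = 0) (htb : |t| * b ≤ 1) :
    ‖charFun (P.map U) t - Real.exp (-(t ^ 2 * (∫ ω, U ω ^ 2 ∂P) / 2))‖ ≤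
      (|t| ^ 3 * b + t ^ 4 * b ^ 2) * ∫ ω, U ω ^ 2 ∂P := by
  obtain ⟨ω₀⟩ : Nonempty Ω := P.nonempty_of_neZero
  have hb0 : 0 ≤ b := (abs_nonneg _).trans (hb ω₀)
  have hUi : Integrable U P := Integrable.of_bound hU.aestronglyMeasurable b
    (Eventually.of_forall hb)
  have hU2i : Integrable (fun ω => U ω ^ 2) P := by
    refine Integrable.of_bound (hU.pow_const 2).aestronglyMeasurable (b ^ 2)
      (Eventually.of_forall fun ω => ?_)
    rw [Real.norm_eq_abs, abs_pow]
    exact pow_le_pow_left₀ (abs_nonneg _) (hb ω) 2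
  set v := ∫ ω, U ω ^ 2 ∂P with hv
  have hv0 : 0 ≤ v := integral_nonneg fun ω => sq_nonneg _
  have hvb : v ≤ b ^ 2 := by
    have : v ≤ ∫ _ω, b ^ 2 ∂P := by
      refine integral_mono hU2i (integrable_const _) fun ω => ?_
      rw [← sq_abs]
      exact pow_le_pow_left₀ (abs_nonneg _) (hb ω) 2
    simpa using this
  have h1 : charFun (P.map U) t = ∫ ω, Complex.exp (((t * U ω : ℝ) : ℂ) * Complex.I) ∂P := by
    rw [charFun_apply_real, integral_map hU (by fun_prop)]
    simp
  have hei : Integrable (fun ω => Complex.exp (((t * U ω : ℝ) : ℂ) * Complex.I)) P := by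
    refine Integrable.of_bound (by fun_prop) 1 (Eventually.of_forall fun ω => ?_)
    rw [Complex.norm_exp_ofReal_mul_I]
  have hqi : Integrable (fun ω => (1 + ((t * U ω : ℝ) : ℂ) * Complex.I -
      ((t * U ω : ℝ) : ℂ) ^ 2 / 2)) P := by
    refine ((integrable_const _).add ((hUi.const_mul t).ofReal.mul_const _)).sub ?_
    have := ((hU2i.const_mul (t ^ 2)).ofReal (𝕜 := ℂ)).div_const 2
    refine this.congr (Eventually.of_forall fun ω => ?_)
    simp only [Complex.coe_algebraMap, Complex.ofReal_mul, Complex.ofReal_pow]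
    ring
  have hq : ∫ ω, (1 + ((t * U ω : ℝ) : ℂ) * Complex.I - ((t * U ω : ℝ) : ℂ) ^ 2 / 2) ∂P =
      ((1 - t ^ 2 * v / 2 : ℝ) : ℂ) := by
    have e1 : (fun ω => (1 + ((t * U ω : ℝ) : ℂ) * Complex.I - ((t * U ω : ℝ) : ℂ) ^ 2 / 2)) =
        fun ω => (1 : ℂ) + (((t * U ω : ℝ) : ℂ) * Complex.I - ((t ^ 2 * U ω ^ 2 : ℝ) : ℂ) / 2) := by
      funext ω
      push_cast
      ring
    have i1 : Integrable (fun ω => ((t * U ω : ℝ) : ℂ) * Complex.I) P :=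
      (hUi.const_mul t).ofReal.mul_const _
    have i2 : Integrable (fun ω => ((t ^ 2 * U ω ^ 2 : ℝ) : ℂ) / 2) P :=
      (hU2i.const_mul (t ^ 2)).ofReal.div_const (2 : ℂ)
    have e2 : ∫ ω, ((1 : ℂ) + (((t * U ω : ℝ) : ℂ) * Complex.I -
        ((t ^ 2 * U ω ^ 2 : ℝ) : ℂ) / 2)) ∂P = ∫ _ω, (1 : ℂ) ∂P +
        ∫ ω, (((t * U ω : ℝ) : ℂ) * Complex.I - ((t ^ 2 * U ω ^ 2 : ℝ) : ℂ) / 2) ∂P :=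
      integral_add (integrable_const _) (i1.sub i2)
    rw [e1, e2, integral_sub i1 i2, integral_mul_const, integral_div]
    rw [integral_complex_ofReal, integral_complex_ofReal, integral_const_mul, integral_const_mul,
      hmean]
    simp only [integral_const, probReal_univ, one_smul, mul_zero, Complex.ofReal_zero, zero_mul]
    rw [← hv]
    push_cast
    ring
  have h2 : ‖charFun (P.map U) t - ((1 - t ^ 2 * v / 2 : ℝ) : ℂ)‖ ≤ |t| ^ 3 * b * v := by
    rw [h1, ← hq, ← integral_sub hei hqi]
    refine (norm_integral_le_integral_norm _).trans ?_
    calc ∫ ω, ‖Complex.exp (((t * U ω : ℝ) : ℂ) * Complex.I) -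
          (1 + ((t * U ω : ℝ) : ℂ) * Complex.I - ((t * U ω : ℝ) : ℂ) ^ 2 / 2)‖ ∂P
        ≤ ∫ ω, |t| ^ 3 * b * U ω ^ 2 ∂P := by
          refine integral_mono (hei.sub hqi).norm (hU2i.const_mul _) fun ω => ?_
          have hx : |t * U ω| ≤ 1 := by
            rw [abs_mul]
            exact (mul_le_mul_of_nonneg_left (hb ω) (abs_nonneg t)).trans htb
          refine (norm_exp_mul_I_sub_le hx).trans ?_
          rw [abs_mul, mul_pow, ← sq_abs (U ω)]
          have : |U ω| ^ 3 ≤ b * |U ω| ^ 2 := by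
            rw [pow_succ']
            exact mul_le_mul_of_nonneg_right (hb ω) (sq_nonneg _)
          calc |t| ^ 3 * |U ω| ^ 3 ≤ |t| ^ 3 * (b * |U ω| ^ 2) := by gcongr
            _ = _ := by ring
      _ = |t| ^ 3 * b * v := by rw [integral_const_mul]
  have h3 : ‖((1 - t ^ 2 * v / 2 : ℝ) : ℂ) - ((Real.exp (-(t ^ 2 * v / 2)) : ℝ) : ℂ)‖ ≤
      t ^ 4 * b ^ 2 * v := by
    rw [← Complex.ofReal_sub, Complex.norm_real, Real.norm_eq_abs, abs_sub_comm]
    have h4 : t ^ 2 * b ^ 2 ≤ 1 := by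
      rw [← sq_abs t, ← mul_pow]
      exact pow_le_one₀ (by positivity) htb
    have h5 : t ^ 2 * (v / 2) ≤ 1 := by
      have : t ^ 2 * v ≤ t ^ 2 * b ^ 2 := by gcongr
      nlinarith [mul_nonneg (sq_nonneg t) hv0]
    have h6 := abs_exp_neg_sub_le (y := t ^ 2 * (v / 2)) (by positivity) h5
    rw [← mul_div_assoc] at h6
    refine h6.trans ?_
    have : v ^ 2 ≤ b ^ 2 * v := by rw [pow_two]; gcongr
    calc (t ^ 2 * v / 2) ^ 2 = t ^ 4 * v ^ 2 / 4 := by ring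
      _ ≤ t ^ 4 * v ^ 2 := by
        have : 0 ≤ t ^ 4 * v ^ 2 := by positivity
        linarith
      _ ≤ t ^ 4 * (b ^ 2 * v) := by gcongr
      _ = _ := by ring
  calc _ ≤ _ := norm_sub_le_norm_sub_add_norm_sub _ ((1 - t ^ 2 * v / 2 : ℝ) : ℂ) _
    _ ≤ |t| ^ 3 * b * v + t ^ 4 * b ^ 2 * v := add_le_add h2 h3
    _ = _ := by ring

/-- A quantitative central limit theorem for sums of small independent centered variables. -/
lemma norm_charFun_sum_sub_le {ι : Type*} (s : Finset ι) {U : ι → Ω → ℝ}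
    (hU : ∀ i, AEMeasurable (U i) P) (hind : iIndepFun U P) {b t : ℝ} (hb : ∀ i ω, |U i ω| ≤ b)
    (hmean : ∀ i, ∫ ω, U i ω ∂P = 0) (htb : |t| * b ≤ 1) :
    ‖charFun (P.map fun ω => ∑ i ∈ s, U i ω) t -
        Real.exp (-(t ^ 2 * (∑ i ∈ s, ∫ ω, U i ω ^ 2 ∂P) / 2))‖ ≤
      (|t| ^ 3 * b + t ^ 4 * b ^ 2) * ∑ i ∈ s, ∫ ω, U i ω ^ 2 ∂P := by
  have h1 : charFun (P.map fun ω => ∑ i ∈ s, U i ω) t = ∏ i ∈ s, charFun (P.map (U i)) t := by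
    rw [(hind.restrict s).charFun_map_fun_finsetSum_eq_prod fun i _ => hU i, Finset.prod_apply]
  have h2 : (Real.exp (-(t ^ 2 * (∑ i ∈ s, ∫ ω, U i ω ^ 2 ∂P) / 2)) : ℂ) =
      ∏ i ∈ s, (Real.exp (-(t ^ 2 * (∫ ω, U i ω ^ 2 ∂P) / 2)) : ℂ) := by
    rw [← Complex.ofReal_prod, ← Real.exp_sum]
    rw [Finset.sum_neg_distrib, Finset.mul_sum, Finset.sum_div]
  rw [h1, h2]
  refine (norm_prod_sub_prod_le_sum s _ _ (fun i _ => ?_) fun i _ => ?_).trans ?_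
  · have := Measure.isProbabilityMeasure_map (hU i)
    exact norm_charFun_le_one t
  · rw [Complex.norm_real, Real.norm_eq_abs, abs_of_pos (Real.exp_pos _)]
    refine Real.exp_le_one_iff.2 (neg_nonpos.2 (div_nonneg (mul_nonneg (sq_nonneg t) ?_) zero_le_two))
    exact integral_nonneg fun ω => sq_nonneg _
  · rw [Finset.mul_sum]
    exact Finset.sum_le_sum fun i _ => norm_charFun_sub_le (hU i) (hb i) (hmean i) htb

end

/-! ### Poissonization: a Poisson number of observations in every step -/

/-- The law of a sequence of independent Poisson variables with mean one. -/
noncomputable def stepLaw : Measure (ℕ → ℕ) := Measure.infinitePi fun _ : ℕ => poissonMeasure 1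

instance : IsProbabilityMeasure stepLaw := by unfold stepLaw; infer_instance

/-- The number of observations made in the first `k` steps. -/
def cum (N : ℕ → ℕ) (k : ℕ) : ℕ := ∑ j ∈ Finset.range k, N j

lemma cum_mono (N : ℕ → ℕ) : Monotone (cum N) := fun _ _ h =>
  Finset.sum_le_sum_of_subset (Finset.range_mono h)

lemma cum_succ (N : ℕ → ℕ) (k : ℕ) : cum N (k + 1) = cum N k + N k := Finset.sum_range_succ _ _

@[fun_prop]
lemma measurable_cum (k : ℕ) : Measurable fun N : ℕ → ℕ => cum N k := by
  unfold cum; fun_prop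

lemma hasSum_poissonOne (f : ℕ → ℝ) {a : ℝ}
    (h : HasSum (fun n : ℕ => f n / (n.factorial : ℝ)) (Real.exp 1 * a)) :
    ∫ n, f n ∂(poissonMeasure 1) = a := by
  rw [integral_poissonMeasure]
  have h1 := h.mul_left (Real.exp (-1))
  rw [← mul_assoc, ← Real.exp_add, neg_add_cancel, Real.exp_zero, one_mul] at h1
  rw [← h1.tsum_eq]
  congr 1
  funext n
  simp only [NNReal.coe_one, one_pow, mul_one, smul_eq_mul]
  ring

lemma hasSum_exp_series (x : ℝ) : HasSum (fun n : ℕ => x ^ n / (n.factorial : ℝ)) (Real.exp x) := by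
  have := NormedSpace.expSeries_div_hasSum_exp x
  rwa [← Real.exp_eq_exp_ℝ] at this

lemma integral_pow_poissonOne (x : ℝ) :
    ∫ n : ℕ, x ^ n ∂(poissonMeasure 1) = Real.exp (-(1 - x)) := by
  refine hasSum_poissonOne _ ?_
  rw [← Real.exp_add]
  convert hasSum_exp_series x using 2
  ring

lemma hasSum_nat_div_factorial : HasSum (fun n : ℕ => (n : ℝ) / (n.factorial : ℝ)) (Real.exp 1) := by
  rw [← hasSum_nat_add_iff' 1]
  simp only [Finset.range_one, Finset.sum_singleton, Nat.cast_zero, zero_div, sub_zero]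
  have h : ∀ n : ℕ, ((n + 1 : ℕ) : ℝ) / ((n + 1).factorial : ℝ) = 1 ^ n / (n.factorial : ℝ) := by
    intro n
    rw [Nat.factorial_succ, one_pow]
    push_cast
    have : (n.factorial : ℝ) ≠ 0 := by positivity
    field_simp
  simp_rw [h]
  exact hasSum_exp_series 1

lemma hasSum_nat_sq_div_factorial :
    HasSum (fun n : ℕ => (n : ℝ) ^ 2 / (n.factorial : ℝ)) (Real.exp 1 * 2) := by
  rw [← hasSum_nat_add_iff' 1]
  simp only [Finset.range_one, Finset.sum_singleton, Nat.cast_zero, zero_pow two_ne_zero, zero_div,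
    sub_zero]
  have h := hasSum_nat_div_factorial.add (hasSum_exp_series 1)
  rw [← mul_two] at h
  have h1 : ∀ n : ℕ, ((n + 1 : ℕ) : ℝ) ^ 2 / ((n + 1).factorial : ℝ) =
      n / (n.factorial : ℝ) + 1 ^ n / (n.factorial : ℝ) := by
    intro n
    rw [Nat.factorial_succ, one_pow]
    push_cast
    have : (n.factorial : ℝ) ≠ 0 := by positivity
    field_simp
  simp_rw [h1]
  exact h

lemma integral_cast_poissonOne : ∫ n : ℕ, (n : ℝ) ∂(poissonMeasure 1) = 1 :=
  hasSum_poissonOne _ (by rw [mul_one]; exact hasSum_nat_div_factorial)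

lemma integral_sq_poissonOne : ∫ n : ℕ, (n : ℝ) ^ 2 ∂(poissonMeasure 1) = 2 :=
  hasSum_poissonOne _ hasSum_nat_sq_div_factorial

lemma memLp_poissonOne : MemLp (fun n : ℕ => (n : ℝ)) 2 (poissonMeasure 1) :=
  (memLp_two_iff_integrable_sq Measurable.of_discrete.aestronglyMeasurable).2
    (.of_integral_ne_zero (by rw [integral_sq_poissonOne]; norm_num))

lemma map_stepLaw (j : ℕ) : stepLaw.map (fun N => N j) = poissonMeasure 1 :=
  Measure.infinitePi_map_eval _ j

lemma integral_step (j : ℕ) (f : ℕ → ℝ) :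
    ∫ N, f (N j) ∂stepLaw = ∫ n, f n ∂(poissonMeasure 1) := by
  rw [← map_stepLaw j, integral_map (measurable_pi_apply j).aemeasurable Measurable.of_discrete.aestronglyMeasurable]

lemma memLp_step (j : ℕ) : MemLp (fun N : ℕ → ℕ => (N j : ℝ)) 2 stepLaw := by
  have h := memLp_poissonOne
  rw [← map_stepLaw j] at h
  exact h.comp_of_map (measurable_pi_apply j).aemeasurable

lemma iIndepFun_step (f : ℕ → ℕ → ℝ) : iIndepFun (fun j (N : ℕ → ℕ) => f j (N j)) stepLaw :=
  iIndepFun_infinitePi fun _ => Measurable.of_discrete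

lemma cast_cum_eq (k : ℕ) : (fun N : ℕ → ℕ => (cum N k : ℝ)) =
    ∑ j ∈ Finset.range k, fun N : ℕ → ℕ => (N j : ℝ) := by
  funext N
  simp [cum, Finset.sum_apply]

lemma memLp_cum (k : ℕ) : MemLp (fun N : ℕ → ℕ => (cum N k : ℝ)) 2 stepLaw := by
  rw [cast_cum_eq]
  exact memLp_finsetSum' _ fun j _ => memLp_step j

lemma integral_cum (k : ℕ) : ∫ N, (cum N k : ℝ) ∂stepLaw = k := by
  simp only [cum, Nat.cast_sum]
  rw [integral_finsetSum _ fun j _ => (memLp_step j).integrable one_le_two]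
  simp_rw [integral_step _ fun n => (n : ℝ), integral_cast_poissonOne]
  simp

lemma variance_cum (k : ℕ) : Var[fun N : ℕ → ℕ => (cum N k : ℝ); stepLaw] = k := by
  rw [cast_cum_eq, IndepFun.variance_sum (fun j _ => memLp_step j)
    (fun i _ j _ hij => (iIndepFun_step fun _ n => (n : ℝ)).indepFun hij)]
  have : ∀ j, Var[fun N : ℕ → ℕ => (N j : ℝ); stepLaw] = 1 := by
    intro j
    rw [variance_eq_sub (memLp_step j)]
    simp only [Pi.pow_apply]
    rw [integral_step j fun n => (n : ℝ) ^ 2, integral_step j fun n => (n : ℝ),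
      integral_sq_poissonOne, integral_cast_poissonOne]
    norm_num
  simp [this]

lemma integral_abs_le_sqrt {Ω : Type*} [MeasurableSpace Ω] {P : Measure Ω} [IsProbabilityMeasure P]
    {Y : Ω → ℝ} (hY : MemLp Y 2 P) : ∫ ω, |Y ω| ∂P ≤ √(∫ ω, Y ω ^ 2 ∂P) := by
  refine Real.le_sqrt_of_sq_le ?_
  have h := variance_nonneg |Y| P
  rw [variance_eq_sub hY.abs] at h
  simp only [Pi.pow_apply, Pi.abs_apply, sq_abs] at h
  linarith

lemma integral_abs_cum_sub_le (k : ℕ) : ∫ N, |(cum N k : ℝ) - k| ∂stepLaw ≤ √k := by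
  have h := variance_cum k
  rw [variance_eq_integral (memLp_cum k).aestronglyMeasurable.aemeasurable, integral_cum] at h
  refine (integral_abs_le_sqrt ((memLp_cum k).sub (memLp_const (k : ℝ)))).trans_eq ?_
  exact congrArg Real.sqrt h

lemma forall_steps_iff (N : ℕ → ℕ) {a b : ℕ} (hab : a ≤ b) (Q : ℕ → Prop) :
    (∀ j ∈ Finset.Ico a b, ∀ r ∈ Finset.Ico (cum N j) (cum N (j + 1)), Q r) ↔
      ∀ r ∈ Finset.Ico (cum N a) (cum N b), Q r := by
  induction b, hab using Nat.le_induction with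
  | base => simp
  | succ b hab ih =>
    have h1 := cum_mono N hab
    have h2 := cum_mono N (Nat.le_succ b)
    constructor
    · intro h r hr
      rw [Finset.mem_Ico] at hr
      rcases lt_or_ge r (cum N b) with hlt | hge
      · refine ih.1 (fun j hj => h j ?_) r (Finset.mem_Ico.2 ⟨hr.1, hlt⟩)
        rw [Finset.mem_Ico] at hj ⊢
        omega
      · exact h b (Finset.mem_Ico.2 ⟨hab, Nat.lt_succ_self b⟩) r (Finset.mem_Ico.2 ⟨hge, hr.2⟩)
    · intro h j hj r hr
      rw [Finset.mem_Ico] at hj hr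
      refine h r (Finset.mem_Ico.2 ⟨(cum_mono N hj.1).trans hr.1, hr.2.trans_le ?_⟩)
      exact cum_mono N (by omega)

lemma prod_range_cum {M : Type*} [CommMonoid M] (N : ℕ → ℕ) (g : ℕ → M) (n : ℕ) :
    ∏ r ∈ Finset.range (cum N n), g r =
      ∏ j ∈ Finset.range n, ∏ r ∈ Finset.Ico (cum N j) (cum N (j + 1)), g r := by
  induction n with
  | zero => simp [cum]
  | succ n ih =>
    rw [Finset.prod_range_succ, ← ih, Finset.prod_range_mul_prod_Ico g (cum_mono N (Nat.le_succ n))]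

section Sample

variable {Ω : Type*} [MeasurableSpace Ω] {μ : Measure Ω} [IsProbabilityMeasure μ] {X : ℕ → Ω → ℕ}

/-- The event that the value `i` is observed in none of the steps in `J`. -/
def miss (X : ℕ → Ω → ℕ) (i : ℕ) (J : Finset ℕ) : Set (Ω × (ℕ → ℕ)) :=
  {z | ∀ j ∈ J, ∀ r ∈ Finset.Ico (cum z.2 j) (cum z.2 (j + 1)), X r z.1 ≠ i}

lemma miss_inter (i : ℕ) (J J' : Finset ℕ) : miss X i J ∩ miss X i J' = miss X i (J ∪ J') := by
  ext z
  simp only [miss, Set.mem_inter_iff, Set.mem_ofPred_eq, Finset.mem_union]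
  grind

lemma IsSample.measurableSet_miss (h : IsSample μ X) (i : ℕ) (J : Finset ℕ) :
    MeasurableSet (miss X i J) := by
  have : miss X i J = ⋂ j ∈ J, ⋂ r : ℕ, (({z | cum z.2 j ≤ r} ∩ {z | r < cum z.2 (j + 1)})ᶜ ∪
      Prod.fst ⁻¹' (X r ⁻¹' {i})ᶜ) := by
    ext z
    simp only [miss, Set.mem_ofPred_eq, Finset.mem_Ico, Set.mem_iInter, Set.mem_union,
      Set.mem_compl_iff, Set.mem_inter_iff, Set.mem_preimage, Set.mem_singleton_iff,
      ← imp_iff_not_or]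
  rw [this]
  refine Finset.measurableSet_biInter _ fun j _ => MeasurableSet.iInter fun r => ?_
  refine MeasurableSet.union (MeasurableSet.compl (MeasurableSet.inter ?_ ?_)) ?_
  · exact measurableSet_le (by fun_prop) measurable_const
  · exact measurableSet_lt measurable_const (by fun_prop)
  · exact measurable_fst (h.meas r (measurableSet_singleton i)).compl

/-- In the Poissonized scheme different values, and different steps, are independent. -/
lemma IsSample.measure_biInter_miss (h : IsSample μ X) (s : Finset ℕ) (J : ℕ → Finset ℕ) :
    (μ.prod stepLaw) (⋂ i ∈ s, miss X i (J i)) =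
      ∏ i ∈ s, ENNReal.ofReal (Real.exp (-((J i).card * freq μ X i))) := by
  classical
  obtain ⟨n, hn⟩ : ∃ n, ∀ i ∈ s, ∀ j ∈ J i, j < n :=
    ⟨s.sup (fun i => (J i).sup id) + 1, fun i hi j hj => Nat.lt_succ_of_le
      ((Finset.le_sup (f := id) hj).trans (Finset.le_sup (f := fun i => (J i).sup id) hi))⟩
  -- the values that must not appear in step `j`
  set D : ℕ → Finset ℕ := fun j => s.filter fun i => j ∈ J i with hD
  have hmeas : MeasurableSet (⋂ i ∈ s, miss X i (J i)) :=
    Finset.measurableSet_biInter _ fun i _ => h.measurableSet_miss i _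
  have hsum1 : ∀ j, ∑ i ∈ D j, freq μ X i ≤ 1 := fun j => by
    rw [← h.hasSum_freq.tsum_eq]
    exact h.hasSum_freq.summable.sum_le_tsum _ fun i _ => freq_nonneg i
  -- given the numbers of observations, each observation avoids a prescribed set
  have hsec : ∀ N : ℕ → ℕ, μ ((fun ω => (ω, N)) ⁻¹' (⋂ i ∈ s, miss X i (J i))) =
      ENNReal.ofReal (∏ j ∈ Finset.range n, (1 - ∑ i ∈ D j, freq μ X i) ^ N j) := by
    intro N
    -- the values which the observation `r` must avoid, being part of a forbidden step
    set D' : ℕ → Finset ℕ := fun r => s.filter fun i => ∃ j ∈ J i,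
      r ∈ Finset.Ico (cum N j) (cum N (j + 1)) with hD'
    have hev : (fun ω => (ω, N)) ⁻¹' (⋂ i ∈ s, miss X i (J i)) =
        {ω | ∀ r ∈ Finset.range (cum N n), X r ω ∉ D' r} := by
      ext ω
      simp only [Set.mem_preimage, Set.mem_iInter, miss, Set.mem_ofPred_eq]
      constructor
      · intro hω r _ hr
        obtain ⟨hs, j, hj, hrj⟩ := Finset.mem_filter.1 hr
        exact hω _ hs j hj r hrj rfl
      · intro hω i hi j hj r hr hX
        refine hω r (Finset.mem_range.2 ?_) (Finset.mem_filter.2 ⟨hX ▸ hi, j, hX ▸ hj, hr⟩)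
        exact (Finset.mem_Ico.1 hr).2.trans_le (cum_mono N (hn i hi j hj))
    have hblock : ∀ j ∈ Finset.range n, ∀ r ∈ Finset.Ico (cum N j) (cum N (j + 1)),
        D' r = D j := by
      intro j _ r hr
      refine Finset.filter_congr fun i _ => ⟨?_, fun hj => ⟨j, hj, hr⟩⟩
      rintro ⟨l, hl, hrl⟩
      rw [Finset.mem_Ico] at hr hrl
      have : l = j := by
        rcases lt_trichotomy l j with hlt | heq | hgt
        · have := cum_mono N (Nat.succ_le_of_lt hlt)
          simp only [Nat.succ_eq_add_one] at this
          omega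
        · exact heq
        · have := cum_mono N (Nat.succ_le_of_lt hgt)
          simp only [Nat.succ_eq_add_one] at this
          omega
      exact this ▸ hl
    rw [hev, ← ENNReal.ofReal_toReal (measure_ne_top μ _)]
    change ENNReal.ofReal (μ.real _) = _
    rw [h.measureReal_forall_notMem, prod_range_cum]
    congr 1
    refine Finset.prod_congr rfl fun j hj => ?_
    rw [Finset.prod_congr rfl fun r hr => by rw [hblock j hj r hr], Finset.prod_const,
      Nat.card_Ico, cum_succ, Nat.add_sub_cancel_left]
  -- averaging over the independent Poisson numbers of observations in the steps
  rw [Measure.prod_apply_symm hmeas]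
  simp_rw [hsec]
  have hnn : ∀ N : ℕ → ℕ, 0 ≤ ∏ j ∈ Finset.range n, (1 - ∑ i ∈ D j, freq μ X i) ^ N j := fun N =>
    Finset.prod_nonneg fun j _ => pow_nonneg (sub_nonneg.2 (hsum1 j)) _
  have hle : ∀ N : ℕ → ℕ, ∏ j ∈ Finset.range n, (1 - ∑ i ∈ D j, freq μ X i) ^ N j ≤ 1 := fun N =>
    Finset.prod_le_one (fun j _ => pow_nonneg (sub_nonneg.2 (hsum1 j)) _) fun j _ =>
      pow_le_one₀ (sub_nonneg.2 (hsum1 j)) (by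
        have : 0 ≤ ∑ i ∈ D j, freq μ X i := Finset.sum_nonneg fun i _ => freq_nonneg i
        linarith)
  have hms : Measurable fun N : ℕ → ℕ =>
      ∏ j ∈ Finset.range n, (1 - ∑ i ∈ D j, freq μ X i) ^ N j := by
    refine Finset.measurable_prod _ fun j _ => ?_
    exact (Measurable.of_discrete (f := fun m : ℕ => (1 - ∑ i ∈ D j, freq μ X i) ^ m)).comp
      (measurable_pi_apply j)
  rw [← ofReal_integral_eq_lintegral_ofReal
    (Integrable.of_bound hms.aestronglyMeasurable 1 (Eventually.of_forall fun N => by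
      rw [Real.norm_eq_abs, abs_of_nonneg (hnn N)]; exact hle N)) (Eventually.of_forall hnn),
    ← ENNReal.ofReal_prod_of_nonneg fun i _ => (Real.exp_pos _).le]
  congr 1
  simp_rw [Finset.prod_range]
  have hind := (iIndepFun_step fun j m => (1 - ∑ i ∈ D j, freq μ X i) ^ m).precomp
    (g := fun j : Fin n => (j : ℕ)) Fin.val_injective
  rw [hind.integral_fun_prod_eq_prod_integral fun j =>
    ((Measurable.of_discrete (f := fun m : ℕ => (1 - ∑ i ∈ D j, freq μ X i) ^ m)).comp
      (measurable_pi_apply (j : ℕ))).aestronglyMeasurable]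
  have : ∀ j : Fin n, ∫ N : ℕ → ℕ, (1 - ∑ i ∈ D j, freq μ X i) ^ N j ∂stepLaw =
      Real.exp (-∑ i ∈ D j, freq μ X i) := by
    intro j
    rw [integral_step (j : ℕ) fun m => (1 - ∑ i ∈ D j, freq μ X i) ^ m, integral_pow_poissonOne]
    congr 1
    ring
  simp_rw [this]
  rw [← Finset.prod_range fun j => Real.exp (-∑ i ∈ D j, freq μ X i), ← Real.exp_sum,
    ← Real.exp_sum, Finset.sum_neg_distrib, Finset.sum_neg_distrib]
  congr 2
  -- exchange the sums over steps and values
  simp_rw [hD, Finset.sum_filter]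
  rw [Finset.sum_comm]
  refine Finset.sum_congr rfl fun i hi => ?_
  rw [← Finset.sum_filter, Finset.sum_const, nsmul_eq_mul]
  congr 3
  ext j
  rw [Finset.mem_filter, Finset.mem_range]
  exact ⟨fun hj => hj.2, fun hj => ⟨hn i hi j hj, hj⟩⟩

lemma IsSample.measure_miss (h : IsSample μ X) (i : ℕ) (J : Finset ℕ) :
    (μ.prod stepLaw) (miss X i J) = ENNReal.ofReal (Real.exp (-(J.card * freq μ X i))) := by
  simpa using h.measure_biInter_miss {i} fun _ => J

lemma IsSample.measureReal_miss (h : IsSample μ X) (i : ℕ) (J : Finset ℕ) :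
    (μ.prod stepLaw).real (miss X i J) = Real.exp (-(J.card * freq μ X i)) := by
  rw [measureReal_def, h.measure_miss, ENNReal.toReal_ofReal (Real.exp_pos _).le]

/-- The σ-algebra of the occurrences of the value `i`. -/
abbrev missField (X : ℕ → Ω → ℕ) (i : ℕ) : MeasurableSpace (Ω × (ℕ → ℕ)) :=
  MeasurableSpace.generateFrom (Set.range (miss X i))

/-- The occurrences of different values in the Poissonized scheme are independent: the generating
events form a π-system on which the probabilities multiply. -/
lemma IsSample.iIndep_missField (h : IsSample μ X) : iIndep (missField X) (μ.prod stepLaw) := by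
  refine iIndepSets.iIndep (fun i => ?_) (fun i => Set.range (miss X i)) (fun i => ?_)
    (fun i => rfl) ?_
  · refine MeasurableSpace.generateFrom_le ?_
    rintro _ ⟨J, rfl⟩
    exact h.measurableSet_miss i J
  · rintro _ ⟨J, rfl⟩ _ ⟨J', rfl⟩ _
    exact ⟨J ∪ J', (miss_inter i J J').symm⟩
  · rw [iIndepSets_iff]
    intro s f hf
    choose! J hJ using hf
    have : ⋂ i ∈ s, f i = ⋂ i ∈ s, miss X i (J i) :=
      Set.iInter₂_congr fun i hi => (hJ i hi).symm
    rw [this, h.measure_biInter_miss]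
    refine Finset.prod_congr rfl fun i hi => ?_
    rw [← hJ i hi, h.measure_miss]

lemma IsSample.iIndepFun_of_missField (h : IsSample μ X) {U : ℕ → Ω × (ℕ → ℕ) → ℝ}
    (hU : ∀ i, Measurable[missField X i] (U i)) : iIndepFun U (μ.prod stepLaw) := by
  rw [iIndepFun_iff_iIndep]
  exact iIndep_of_iIndep_of_le h.iIndep_missField fun i => (hU i).comap_le

/-- Appearing in a window of steps is appearing among the observations made during these steps. -/
lemma notMem_miss_Ico_iff (i : ℕ) {a b : ℕ} (hab : a ≤ b) (z : Ω × (ℕ → ℕ)) :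
    z ∈ miss X i (Finset.Ico a b) ↔ z.1 ∉ hit X (Finset.Ico (cum z.2 a) (cum z.2 b)) i := by
  have := forall_steps_iff z.2 hab fun r => X r z.1 ≠ i
  simp only [miss, Set.mem_ofPred_eq, this, hit, not_exists, not_and]

lemma IsSample.covariance_miss (h : IsSample μ X) (i : ℕ) (J J' : Finset ℕ) :
    cov[(miss X i J).indicator (1 : Ω × (ℕ → ℕ) → ℝ), (miss X i J').indicator 1; μ.prod stepLaw] =
      Real.exp (-((J ∪ J').card * freq μ X i)) -
        Real.exp (-((J.card + J'.card : ℝ) * freq μ X i)) := by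
  have hL : ∀ J, MemLp ((miss X i J).indicator (1 : Ω × (ℕ → ℕ) → ℝ)) 2 (μ.prod stepLaw) :=
    fun J => memLp_indicator_const 2 (h.measurableSet_miss i J) 1 (Or.inr (measure_ne_top _ _))
  rw [covariance_eq_sub (hL J) (hL J'), ← Set.inter_indicator_one, miss_inter,
    integral_indicator_one (h.measurableSet_miss i _),
    integral_indicator_one (h.measurableSet_miss i _),
    integral_indicator_one (h.measurableSet_miss i _), h.measureReal_miss, h.measureReal_miss,
    h.measureReal_miss, ← Real.exp_add]
  congr 2
  ring

lemma IsSample.measurable_distinct_cum (h : IsSample μ X) (a b : ℕ) :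
    Measurable fun z : Ω × (ℕ → ℕ) =>
      (distinct X (Finset.Ico (cum z.2 a) (cum z.2 b)) z.1 : ℝ) := by
  have h1 : Measurable fun q : Ω × (ℕ × ℕ) =>
      (distinct X (Finset.Ico q.2.1 q.2.2) q.1 : ℝ) :=
    measurable_from_prod_countable_left fun y =>
      measurable_from_top.comp (h.measurable_distinct (Finset.Ico y.1 y.2))
  exact h1.comp (g := fun q : Ω × (ℕ × ℕ) => (distinct X (Finset.Ico q.2.1 q.2.2) q.1 : ℝ))
    (f := fun z : Ω × (ℕ → ℕ) => (z.1, (cum z.2 a, cum z.2 b))) (by fun_prop)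

lemma distinct_cum_le (a b : ℕ) (z : Ω × (ℕ → ℕ)) :
    (distinct X (Finset.Ico (cum z.2 a) (cum z.2 b)) z.1 : ℝ) ≤ cum z.2 b := by
  have := (distinct_le (X := X) (Finset.Ico (cum z.2 a) (cum z.2 b)) z.1).trans_eq
    (Nat.card_Ico _ _)
  exact_mod_cast this.trans (Nat.sub_le _ _)

lemma integrable_cum_snd (b : ℕ) :
    Integrable (fun z : Ω × (ℕ → ℕ) => (cum z.2 b : ℝ)) (μ.prod stepLaw) :=
  ((memLp_cum b).integrable one_le_two).comp_snd μ

/-- The counts in the original and in the Poissonized scheme are close in mean: the ends of the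
window move from `a`, `b` to the sums of `a` and `b` Poisson variables, which deviate by `√a` and
`√b` in mean. -/
lemma IsSample.integral_abs_poissonization_le (h : IsSample μ X) {a b : ℕ} (hab : a ≤ b) :
    Integrable (fun z : Ω × (ℕ → ℕ) => (distinct X (Finset.Ico a b) z.1 : ℝ) -
      distinct X (Finset.Ico (cum z.2 a) (cum z.2 b)) z.1) (μ.prod stepLaw) ∧
    ((b - a : ℕ) : ℝ) * ∫ z : Ω × (ℕ → ℕ), |(distinct X (Finset.Ico a b) z.1 : ℝ) -
        distinct X (Finset.Ico (cum z.2 a) (cum z.2 b)) z.1| ∂(μ.prod stepLaw) ≤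
      3 * (√a + √b) * meanFn (freq μ X) (b - a) := by
  have hmeas := h.measurable_distinct_cum a b
  have hmeas0 : Measurable fun z : Ω × (ℕ → ℕ) => (distinct X (Finset.Ico a b) z.1 : ℝ) :=
    (measurable_from_top.comp (h.measurable_distinct (Finset.Ico a b))).comp measurable_fst
  have hint : Integrable (fun z : Ω × (ℕ → ℕ) => (distinct X (Finset.Ico a b) z.1 : ℝ) -
      distinct X (Finset.Ico (cum z.2 a) (cum z.2 b)) z.1) (μ.prod stepLaw) := by
    have hb : Integrable (fun z : Ω × (ℕ → ℕ) => ((b - a : ℕ) : ℝ) + cum z.2 b)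
        (μ.prod stepLaw) :=
      (integrable_const _).add (integrable_cum_snd b)
    refine hb.mono' (hmeas0.sub hmeas).aestronglyMeasurable (Eventually.of_forall fun z => ?_)
    have h1 : (distinct X (Finset.Ico a b) z.1 : ℝ) ≤ (b - a : ℕ) := by
      exact_mod_cast (distinct_le (X := X) (Finset.Ico a b) z.1).trans_eq (Nat.card_Ico a b)
    have h2 := distinct_cum_le (X := X) a b z
    rw [Real.norm_eq_abs, abs_le]
    constructor <;> linarith [(Nat.cast_nonneg _ : (0 : ℝ) ≤ distinct X (Finset.Ico a b) z.1),
      (Nat.cast_nonneg _ : (0 : ℝ) ≤ distinct X (Finset.Ico (cum z.2 a) (cum z.2 b)) z.1)]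
  refine ⟨hint, ?_⟩
  rw [integral_prod_symm _ hint.abs, ← integral_const_mul]
  have habs : ∀ k, Integrable (fun N : ℕ → ℕ => |(cum N k : ℝ) - k|) stepLaw := fun k =>
    (((memLp_cum k).integrable one_le_two).sub (integrable_const _)).abs
  calc ∫ N, ((b - a : ℕ) : ℝ) * ∫ ω, |(distinct X (Finset.Ico a b) ω : ℝ) -
        distinct X (Finset.Ico (cum N a) (cum N b)) ω| ∂μ ∂stepLaw
      ≤ ∫ N, 3 * (|(cum N a : ℝ) - a| + |(cum N b : ℝ) - b|) * meanFn (freq μ X) (b - a)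
          ∂stepLaw := by
        refine integral_mono (hint.abs.integral_prod_right.const_mul _)
          ((((habs a).add (habs b)).const_mul 3).mul_const _) fun N => ?_
        set a' := cum N a
        set b' := cum N b
        have ha'b' : a' ≤ b' := cum_mono N hab
        -- with truncated subtraction, `e` is the sum of the distances between the ends
        set e := (a - a') + (a' - a) + ((b - b') + (b' - b)) with he
        have hU : (Finset.Ico a b ∪ Finset.Ico a' b').card ≤ (Finset.Ico a b).card + e := by
          have hsub : Finset.Ico a b ∪ Finset.Ico a' b' ⊆
              (Finset.Ico a b ∪ Finset.Ico a' a) ∪ Finset.Ico b b' := by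
            intro r hr
            simp only [Finset.mem_union, Finset.mem_Ico] at hr ⊢
            omega
          refine (Finset.card_le_card hsub).trans ((Finset.card_union_le _ _).trans ?_)
          have := Finset.card_union_le (Finset.Ico a b) (Finset.Ico a' a)
          simp only [Nat.card_Ico] at this ⊢
          omega
        have hB : (Finset.Ico a b).card ≤ (Finset.Ico a' b').card + e := by
          simp only [Nat.card_Ico]
          omega
        have hec : (e : ℝ) = |(a' : ℝ) - a| + |(b' : ℝ) - b| := by
          have key : ∀ x y : ℕ, (((x - y) + (y - x) : ℕ) : ℝ) = |(y : ℝ) - x| := by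
            intro x y
            rcases le_total x y with hxy | hxy
            · rw [Nat.sub_eq_zero_of_le hxy, zero_add, Nat.cast_sub hxy, abs_of_nonneg]
              exact sub_nonneg.2 (by exact_mod_cast hxy)
            · rw [Nat.sub_eq_zero_of_le hxy, add_zero, Nat.cast_sub hxy, abs_of_nonpos]
              · ring
              · exact sub_nonpos.2 (by exact_mod_cast hxy)
          rw [he, Nat.cast_add, key, key]
        have := h.integral_abs_distinct_sub_distinct_le (Finset.Ico a b) (Finset.Ico a' b') hU hB
        rw [Nat.card_Ico, hec] at this
        exact this
    _ = 3 * (∫ N, |(cum N a : ℝ) - a| ∂stepLaw + ∫ N, |(cum N b : ℝ) - b| ∂stepLaw) *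
          meanFn (freq μ X) (b - a) := by
        rw [integral_mul_const, integral_const_mul, integral_add (habs a) (habs b)]
    _ ≤ _ := by
        have := h.isWeight.meanFn_nonneg (b - a)
        gcongr
        · exact integral_abs_cum_sub_le a
        · exact integral_abs_cum_sub_le b

end Sample

/-! ### Integration against a function of bounded variation -/

/-- A signed measure has a density of absolute value one with respect to a finite measure, and
the two integrals agree even where they are undefined. -/
lemma exists_signDensity {α : Type*} [MeasurableSpace α] (s : SignedMeasure α) :
    ∃ (m : Measure α) (h : α → ℝ), IsFiniteMeasure m ∧ Measurable h ∧ (∀ x, |h x| = 1) ∧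
      (∀ f : α → ℝ, s.integral f (ContinuousLinearMap.lsmul ℝ ℝ) = ∫ x, f x * h x ∂m) ∧
      ∀ D, MeasurableSet D → (∀ E, MeasurableSet E → E ⊆ D → s E = 0) → m D = 0 := by
  classical
  set j := s.toJordanDecomposition with hj
  obtain ⟨S, hS, hpos, hneg⟩ := j.mutuallySingular
  refine ⟨s.totalVariation, fun x => if x ∈ S then -1 else 1, inferInstance,
    Measurable.ite hS measurable_const measurable_const, fun x => ?_, fun f => ?_, ?_⟩
  · dsimp only
    split_ifs <;> simp
  · have hm : s.totalVariation = j.posPart + j.negPart := rfl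
    by_cases hf : Integrable f s.totalVariation
    · have hf' := hf
      rw [hm, integrable_add_measure] at hf'
      have hmul : Integrable (fun x => f x * if x ∈ S then (-1 : ℝ) else 1) s.totalVariation := by
        refine hf.mul_bdd (c := 1)
          (Measurable.ite hS measurable_const measurable_const).aestronglyMeasurable ?_
        refine Eventually.of_forall fun x => ?_
        split_ifs <;> simp
      rw [hm] at hmul ⊢
      have hmul' := integrable_add_measure.1 hmul
      rw [integral_add_measure hmul'.1 hmul'.2]
      -- the set `S` is null for the positive part, its complement for the negative part
      have h1 : ∫ x, f x * (if x ∈ S then (-1 : ℝ) else 1) ∂j.posPart = ∫ x, f x ∂j.posPart := by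
        refine integral_congr_ae ?_
        have : ∀ᵐ x ∂j.posPart, x ∉ S := measure_eq_zero_iff_ae_notMem.1 hpos
        filter_upwards [this] with x hx
        simp [hx]
      have h2 : ∫ x, f x * (if x ∈ S then (-1 : ℝ) else 1) ∂j.negPart = -∫ x, f x ∂j.negPart := by
        rw [← integral_neg]
        refine integral_congr_ae ?_
        have : ∀ᵐ x ∂j.negPart, x ∉ Sᶜ := measure_eq_zero_iff_ae_notMem.1 hneg
        filter_upwards [this] with x hx
        simp [not_not.1 hx]
      rw [h1, h2, ← sub_eq_add_neg]
      conv_lhs => rw [← s.toSignedMeasure_toJordanDecomposition]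
      rw [JordanDecomposition.toSignedMeasure, VectorMeasure.integral_sub_vectorMeasure
        (by rw [VectorMeasure.Integrable, Measure.variation_toSignedMeasure]; exact hf'.1)
        (by rw [VectorMeasure.Integrable, Measure.variation_toSignedMeasure]; exact hf'.2)]
      have hflip : (ContinuousLinearMap.lsmul ℝ ℝ : ℝ →L[ℝ] ℝ →L[ℝ] ℝ) =
          (ContinuousLinearMap.lsmul ℝ ℝ).flip := by
        ext; simp
      rw [hflip, VectorMeasure.integral_toSignedMeasure, VectorMeasure.integral_toSignedMeasure]
      -- both integrals have the junk value zero
    · rw [VectorMeasure.integral_undef (by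
        rwa [VectorMeasure.Integrable, ← SignedMeasure.totalVariation_eq_variation]),
        integral_undef]
      intro hmul
      refine hf ?_
      have := hmul.mul_bdd (c := 1) (g := fun x => if x ∈ S then (-1 : ℝ) else 1)
        (Measurable.ite hS measurable_const measurable_const).aestronglyMeasurable
        (Eventually.of_forall fun x => by split_ifs <;> simp)
      refine this.congr (Eventually.of_forall fun x => ?_)
      dsimp only
      split_ifs <;> ring
  · intro D hD hE
    have hval : ∀ E, MeasurableSet E → E ⊆ D → j.posPart E = j.negPart E := by
      intro E hEm hED
      have := s.apply_eq_posPart_real_sub_negPart_real hEm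
      rw [hE E hEm hED, eq_comm, sub_eq_zero, measureReal_def, measureReal_def,
        ENNReal.toReal_eq_toReal_iff' (measure_ne_top _ _) (measure_ne_top _ _)] at this
      exact this
    have h1 : j.posPart (D ∩ Sᶜ) = 0 := by
      rw [hval _ (hD.inter hS.compl) Set.inter_subset_left]
      exact measure_mono_null Set.inter_subset_right hneg
    have h2 : j.negPart (D ∩ S) = 0 := by
      rw [← hval _ (hD.inter hS) Set.inter_subset_left]
      exact measure_mono_null Set.inter_subset_right hpos
    have h3 : j.posPart (D ∩ S) = 0 := measure_mono_null Set.inter_subset_right hpos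
    have h4 : j.negPart (D ∩ Sᶜ) = 0 := measure_mono_null Set.inter_subset_right hneg
    change (j.posPart + j.negPart) D = 0
    rw [Measure.add_apply, ← measure_inter_add_sdiff D hS, ← measure_inter_add_sdiff (μ := j.negPart) D hS,
      Set.sdiff_eq, h1, h2, h3, h4]
    simp

section BoundedVariation

variable {A : I → ℝ}

/-- If `A` vanishes up to `δ`, the measure `dA` has no mass to the left of `δ`. -/
lemma vectorMeasure_eq_zero_of_subset (hA : BoundedVariationOn A Set.univ) {δ : ℝ} (hδ : δ ∈ Set.Ioo (0 : ℝ) 1)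
    (hAδ : ∀ t : I, (t : ℝ) ≤ δ → A t = 0) {E : Set I} (hE : MeasurableSet E)
    (hEδ : E ⊆ {t : I | (t : ℝ) < δ}) : hA.vectorMeasure E = 0 := by
  obtain ⟨hδ, h1⟩ := hδ
  set d : I := ⟨δ, hδ.le, h1.le⟩ with hd
  have hD : E = E ∩ Set.Iio d := (Set.inter_eq_left.2 hEδ).symm
  have h0 : limUnder atBot A = 0 := by
    rw [OrderBot.atBot_eq]
    exact (tendsto_pure_nhds A ⊥).limUnder_eq.trans (hAδ _ (by simpa using hδ.le))
  have hleft : A.leftLim d = 0 := by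
    have : (𝓝[<] d).NeBot := nhdsLT_neBot_of_exists_lt ⟨0, hδ⟩
    refine leftLim_eq_of_tendsto (tendsto_const_nhds.congr' ?_)
    filter_upwards [self_mem_nhdsWithin] with t ht
    exact (hAδ t (le_of_lt ht)).symm
  have hright : ∀ a < d, A.rightLim a = 0 := by
    intro a ha
    have hc : A =ᶠ[𝓝 a] fun _ => 0 := by
      filter_upwards [Iio_mem_nhds ha] with t ht
      exact hAδ t (le_of_lt ht)
    have : ContinuousAt A a := continuousAt_const.congr hc.symm
    rw [this.continuousWithinAt.rightLim_eq, hAδ a (le_of_lt ha)]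
  have hvD : hA.vectorMeasure (Set.Iio d) = 0 := by
    rw [hA.vectorMeasure_Iio, hleft, h0, sub_zero]
  rw [hD]
  clear hD hEδ
  -- the intervals `Iic a` generate, and on them the distribution function vanishes
  induction E, hE using MeasurableSpace.induction_on_inter
    (BorelSpace.measurable_eq.trans (borel_eq_generateFrom_Iic I)) isPiSystem_Iic with
  | empty => simp
  | basic t ht =>
    obtain ⟨a, rfl⟩ := ht
    rcases lt_or_ge a d with had | had
    · rw [Set.inter_eq_left.2 (Set.Iic_subset_Iio.2 had), hA.vectorMeasure_Iic,
        hright a had, h0, sub_zero]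
    · rw [Set.inter_eq_right.2 (Set.Iio_subset_Iic_self.trans (Set.Iic_subset_Iic.2 had)), hvD]
  | compl t htm ih =>
    have hu := VectorMeasure.of_union (v := hA.vectorMeasure) (A := t ∩ Set.Iio d)
      (B := tᶜ ∩ Set.Iio d) ?_ (htm.inter measurableSet_Iio) (htm.compl.inter measurableSet_Iio)
    · rw [← Set.union_inter_distrib_right, Set.union_compl_self, Set.univ_inter, hvD, ih,
        zero_add] at hu
      exact hu.symm
    · exact (disjoint_compl_right.mono Set.inter_subset_left Set.inter_subset_left)
  | iUnion f hf hfm ih =>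
    rw [Set.iUnion_inter, VectorMeasure.of_disjoint_iUnion
      (fun i => (hfm i).inter measurableSet_Iio)
      (fun i j hij => (hf hij).mono Set.inter_subset_left Set.inter_subset_left)]
    simp [ih]

/-- The convention `A(0-) = A(0)`, `A(1+) = A(1)` makes `A 1 - A 0` the total mass. -/
lemma vectorMeasure_univ_eq_zero (hA : BoundedVariationOn A Set.univ) (h0 : A 0 = 0)
    (h1 : A 1 = 0) : hA.vectorMeasure Set.univ = 0 := by
  rw [hA.vectorMeasure_univ, OrderTop.atTop_eq, OrderBot.atBot_eq]
  have e1 : limUnder (pure (⊤ : I)) A = A ⊤ := (tendsto_pure_nhds A ⊤).limUnder_eq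
  have e2 : limUnder (pure (⊥ : I)) A = A ⊥ := (tendsto_pure_nhds A ⊥).limUnder_eq
  rw [e1, e2]
  exact sub_eq_zero.2 (h1.trans h0.symm)

/-- The measure `dA` has a density of absolute value one with respect to a finite measure that does
not charge `[0, δ)`, and its total mass is zero. -/
lemma exists_representation (hA : BoundedVariationOn A Set.univ) {δ : ℝ}
    (hδ : δ ∈ Set.Ioo (0 : ℝ) 1) (hAδ : ∀ t : I, (t : ℝ) ≤ δ → A t = 0) (hA1 : A 1 = 0) :
    ∃ (m : Measure I) (h : I → ℝ), IsFiniteMeasure m ∧ Measurable h ∧ (∀ t, |h t| = 1) ∧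
      (∀ f, stieltjesIntegral hA f = ∫ t, f t * h t ∂m) ∧ (∀ᵐ t : I ∂m, δ ≤ (t : ℝ)) ∧
      ∫ t, h t ∂m = 0 := by
  obtain ⟨m, h, hm, hh, habs, hint, hnull⟩ := exists_signDensity hA.vectorMeasure
  refine ⟨m, h, hm, hh, habs, hint, ?_, ?_⟩
  · have hD : MeasurableSet {t : I | (t : ℝ) < δ} :=
      measurableSet_lt measurable_subtype_coe measurable_const
    have h0 := hnull _ hD fun E hE hED => vectorMeasure_eq_zero_of_subset hA hδ hAδ hE hED
    filter_upwards [measure_eq_zero_iff_ae_notMem.1 h0] with t ht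
    exact not_lt.1 ht
  · have h1 := hint fun _ => 1
    simp only [one_mul] at h1
    rw [← h1]
    have hfin : IsFiniteMeasure hA.vectorMeasure.variation := by
      rw [← SignedMeasure.totalVariation_eq_variation]
      infer_instance
    rw [VectorMeasure.integral_const]
    simp [vectorMeasure_univ_eq_zero hA (hAδ 0 (by simpa using hδ.1.le)) hA1]

end BoundedVariation

/-! ### Integrals of functions of the time index -/

lemma measurable_timeIndex (n : ℕ) : Measurable (timeIndex n) :=
  Nat.measurable_floor.comp (measurable_subtype_coe.const_mul _)

lemma timeIndex_le (n : ℕ) (t : I) : timeIndex n t ≤ n := by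
  refine Nat.floor_le_of_le ?_
  have := t.2.2
  have hn : (0 : ℝ) ≤ n := Nat.cast_nonneg n
  nlinarith

lemma timeIndex_le_mul (n : ℕ) (t : I) : (timeIndex n t : ℝ) ≤ n * t :=
  Nat.floor_le (mul_nonneg (Nat.cast_nonneg n) t.2.1)

lemma mul_lt_timeIndex_add_one (n : ℕ) (t : I) : n * (t : ℝ) < timeIndex n t + 1 :=
  Nat.lt_floor_add_one _

section Weights

variable {m : Measure I} {g : I → ℝ}

/-- The mass which `g dm` gives to the times with index `k`. -/
noncomputable def stepWeight (m : Measure I) (g : I → ℝ) (n k : ℕ) : ℝ :=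
  ∫ t in timeIndex n ⁻¹' {k}, g t ∂m

lemma measurableSet_timeIndex (n k : ℕ) : MeasurableSet (timeIndex n ⁻¹' {k}) :=
  measurable_timeIndex n (measurableSet_singleton k)

lemma integral_comp_timeIndex (hg : Integrable g m) (n : ℕ) (F : ℕ → ℝ) :
    ∫ t, F (timeIndex n t) * g t ∂m = ∑ k ∈ Finset.range (n + 1), F k * stepWeight m g n k := by
  have h1 : ∀ t, F (timeIndex n t) * g t =
      ∑ k ∈ Finset.range (n + 1), (timeIndex n ⁻¹' {k}).indicator (fun t => F k * g t) t := by
    intro t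
    rw [Finset.sum_eq_single (timeIndex n t)]
    · simp
    · intro k _ hk
      simp [Set.indicator, hk.symm]
    · intro hk
      exact absurd (Finset.mem_range.2 (Nat.lt_succ_of_le (timeIndex_le n t))) hk
  simp_rw [h1]
  rw [integral_finsetSum _ fun k _ => (hg.const_mul _).indicator (measurableSet_timeIndex n k)]
  refine Finset.sum_congr rfl fun k _ => ?_
  rw [integral_indicator (measurableSet_timeIndex n k), integral_const_mul]
  rfl

lemma integrable_comp_timeIndex (hg : Integrable g m) (n : ℕ) (F : ℕ → ℝ) :
    Integrable (fun t => F (timeIndex n t) * g t) m := by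
  refine hg.bdd_mul (c := ∑ k ∈ Finset.range (n + 1), |F k|)
    ((Measurable.of_discrete (f := F)).comp (measurable_timeIndex n)).aestronglyMeasurable
    (Eventually.of_forall fun t => ?_)
  exact Finset.single_le_sum (f := fun k => |F k|) (fun _ _ => abs_nonneg _)
    (Finset.mem_range.2 (Nat.lt_succ_of_le (timeIndex_le n t)))

lemma sum_abs_stepWeight_le (hg : Integrable g m) (n : ℕ) :
    ∑ k ∈ Finset.range (n + 1), |stepWeight m g n k| ≤ ∫ t, |g t| ∂m := by
  have h := integral_comp_timeIndex hg.abs n fun _ => 1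
  simp only [one_mul] at h
  rw [h]
  exact Finset.sum_le_sum fun k _ => abs_integral_le_integral_abs

lemma stepWeight_eq_zero {δ : ℝ} (hm : ∀ᵐ t : I ∂m, δ ≤ (t : ℝ)) {n k : ℕ}
    (hk : (k : ℝ) + 1 ≤ n * δ) : stepWeight m g n k = 0 := by
  have : m (timeIndex n ⁻¹' {k}) = 0 := by
    rw [measure_eq_zero_iff_ae_notMem]
    filter_upwards [hm] with t ht hk'
    have h1 := mul_lt_timeIndex_add_one n t
    rw [Set.mem_preimage, Set.mem_singleton_iff] at hk'
    rw [hk'] at h1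
    have := mul_le_mul_of_nonneg_left ht (Nat.cast_nonneg n : (0 : ℝ) ≤ n)
    linarith
  rw [stepWeight, Measure.restrict_eq_zero.2 this, integral_zero_measure]

variable {Ω : Type*} [MeasurableSpace Ω] {P : Measure Ω}

lemma integrable_integral_comp_timeIndex (hg : Integrable g m) (n : ℕ) {F : ℕ → Ω → ℝ}
    (hF : ∀ k, Integrable (F k) P) :
    Integrable (fun ω => ∫ t, F (timeIndex n t) ω * g t ∂m) P := by
  simp_rw [fun ω => integral_comp_timeIndex hg n fun k => F k ω]
  exact integrable_finsetSum _ fun k _ => (hF k).mul_const _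

/-- Averaging over the times a family of random variables that are small in mean. -/
lemma integral_abs_integral_comp_timeIndex_le (hg : Integrable g m) {δ : ℝ}
    (hm : ∀ᵐ t : I ∂m, δ ≤ (t : ℝ)) (n : ℕ) {F : ℕ → Ω → ℝ} (hF : ∀ k, Integrable (F k) P) {B : ℝ}
    (hB0 : 0 ≤ B) (hB : ∀ k ≤ n, n * δ < k + 1 → ∫ ω, |F k ω| ∂P ≤ B) :
    ∫ ω, |∫ t, F (timeIndex n t) ω * g t ∂m| ∂P ≤ B * ∫ t, |g t| ∂m := by
  simp_rw [fun ω => integral_comp_timeIndex hg n fun k => F k ω]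
  calc ∫ ω, |∑ k ∈ Finset.range (n + 1), F k ω * stepWeight m g n k| ∂P
      ≤ ∫ ω, ∑ k ∈ Finset.range (n + 1), |F k ω| * |stepWeight m g n k| ∂P := by
        refine integral_mono (integrable_finsetSum _ fun k _ => (hF k).mul_const _).abs
          (integrable_finsetSum _ fun k _ => (hF k).abs.mul_const _) fun ω => ?_
        refine (Finset.abs_sum_le_sum_abs _ _).trans_eq ?_
        simp_rw [abs_mul]
    _ = ∑ k ∈ Finset.range (n + 1), (∫ ω, |F k ω| ∂P) * |stepWeight m g n k| := by
        rw [integral_finsetSum _ fun k _ => (hF k).abs.mul_const _]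
        simp_rw [integral_mul_const]
    _ ≤ ∑ k ∈ Finset.range (n + 1), B * |stepWeight m g n k| := by
        refine Finset.sum_le_sum fun k hk => ?_
        rcases lt_or_ge (n * δ) (k + 1) with hlt | hge
        · exact mul_le_mul_of_nonneg_right
            (hB k (Nat.lt_succ_iff.1 (Finset.mem_range.1 hk)) hlt) (abs_nonneg _)
        · rw [stepWeight_eq_zero hm hge]
          simp
    _ ≤ B * ∫ t, |g t| ∂m := by
        rw [← Finset.mul_sum]
        exact mul_le_mul_of_nonneg_left (sum_abs_stepWeight_le hg n) hB0

lemma integral_prod_comp_timeIndex [SFinite m] (hg : Integrable g m) (n : ℕ) (H : ℕ → ℕ → ℝ) :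
    ∫ q : I × I, H (timeIndex n q.1) (timeIndex n q.2) * (g q.1 * g q.2) ∂(m.prod m) =
      ∑ k ∈ Finset.range (n + 1), ∑ l ∈ Finset.range (n + 1),
        H k l * (stepWeight m g n k * stepWeight m g n l) := by
  have hint : Integrable
      (fun q : I × I => H (timeIndex n q.1) (timeIndex n q.2) * (g q.1 * g q.2)) (m.prod m) := by
    refine (hg.mul_prod hg).bdd_mul
      (c := ∑ k ∈ Finset.range (n + 1), ∑ l ∈ Finset.range (n + 1), |H k l|) ?_
      (Eventually.of_forall fun q => ?_)
    · exact ((Measurable.of_discrete (f := fun x : ℕ × ℕ => H x.1 x.2)).comp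
        (((measurable_timeIndex n).comp measurable_fst).prodMk
          ((measurable_timeIndex n).comp measurable_snd))).aestronglyMeasurable
    · have hmem : ∀ t, timeIndex n t ∈ Finset.range (n + 1) := fun t =>
        Finset.mem_range.2 (Nat.lt_succ_of_le (timeIndex_le n t))
      exact (Finset.single_le_sum (f := fun l => |H (timeIndex n q.1) l|)
        (fun _ _ => abs_nonneg _) (hmem q.2)).trans
        (Finset.single_le_sum (f := fun k => ∑ l ∈ Finset.range (n + 1), |H k l|)
          (fun _ _ => Finset.sum_nonneg fun _ _ => abs_nonneg _) (hmem q.1))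
  rw [integral_prod _ hint]
  have h1 : ∀ s, ∫ t, H (timeIndex n s) (timeIndex n t) * (g s * g t) ∂m =
      (∑ l ∈ Finset.range (n + 1), H (timeIndex n s) l * stepWeight m g n l) * g s := by
    intro s
    rw [← integral_comp_timeIndex hg n (H (timeIndex n s)), ← integral_mul_const]
    congr 1
    funext t
    ring
  simp_rw [h1]
  rw [integral_comp_timeIndex hg n fun k =>
    ∑ l ∈ Finset.range (n + 1), H k l * stepWeight m g n l]
  refine Finset.sum_congr rfl fun k _ => ?_
  rw [Finset.sum_mul]
  refine Finset.sum_congr rfl fun l _ => ?_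
  ring

end Weights

/-! ### Positivity of the limiting variance -/

section PowerIntegral

variable {θ : ℝ}

lemma integrableOn_one_sub_exp_rpow (hθ : θ ∈ Set.Ioo (0 : ℝ) 1) {l : ℝ} (hl : 0 ≤ l) :
    IntegrableOn (fun x : ℝ => 1 - Real.exp (-(l * x ^ (-(1 / θ))))) (Set.Ioi 0) := by
  rcases hl.eq_or_lt with rfl | hl
  · simp
  · exact integrableOn_meanConst hθ hl

lemma integral_one_sub_exp_rpow (hθ : θ ∈ Set.Ioo (0 : ℝ) 1) {l : ℝ} (hl : 0 ≤ l) :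
    ∫ x in Set.Ioi (0 : ℝ), (1 - Real.exp (-(l * x ^ (-(1 / θ))))) = meanConst θ 1 * l ^ θ := by
  rcases hl.eq_or_lt with rfl | hl
  · simp [Real.zero_rpow hθ.1.ne']
  · have h1 : ∀ x ∈ Set.Ioi (0 : ℝ), 1 - Real.exp (-(l * x ^ (-(1 / θ)))) =
        1 - Real.exp (-(1 * (l ^ (-θ) * x) ^ (-(1 / θ)))) := by
      intro x hx
      rw [rpow_scale hθ hl hx, one_mul]
    rw [setIntegral_congr_fun measurableSet_Ioi h1,
      integral_comp_mul_left_Ioi (fun x : ℝ => 1 - Real.exp (-(1 * x ^ (-(1 / θ))))) 0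
        (Real.rpow_pos_of_pos hl _),
      mul_zero, ← meanConst, Real.rpow_neg hl.le, inv_inv, smul_eq_mul, mul_comm]

end PowerIntegral

/-- The total limiting covariance of the forward and backward processes. -/
noncomputable def totalCov (θ : ℝ) (s t : I) : ℝ :=
  2 * ((s : ℝ) + t) ^ θ - (max (s : ℝ) t) ^ θ - (min ((s : ℝ) + t) 1) ^ θ

/-- The exponential kernels of which `totalCov` is a mixture. -/
noncomputable def expCov (y : ℝ) (s t : I) : ℝ :=
  Real.exp (-(max (s : ℝ) t * y)) + Real.exp (-(min ((s : ℝ) + t) 1 * y)) -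
    2 * Real.exp (-(((s : ℝ) + t) * y))

lemma covK_add_crossCovK {θ : ℝ} (hθ : 0 < θ) (s t : I) :
    covK θ s t + crossCovK θ s t = totalCov θ s t := by
  have hmax : max ((s : ℝ) ^ θ) ((t : ℝ) ^ θ) = (max (s : ℝ) t) ^ θ :=
    ((Real.monotoneOn_rpow_Ici_of_exponent_nonneg hθ.le).map_max s.2.1 t.2.1).symm
  rw [covK, crossCovK, totalCov, hmax]
  split_ifs with h
  · rw [min_eq_right h.le, Real.one_rpow]
    ring
  · rw [min_eq_left (not_lt.1 h)]
    ring

section Fubini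

lemma integral_integral_indicator {α β : Type*} [MeasurableSpace α] [MeasurableSpace β]
    (Q : Measure α) [IsFiniteMeasure Q] (N : Measure β) [SFinite N] {g : β → ℝ}
    (hg : Integrable g N) {E : Set (α × β)} (hE : MeasurableSet E) :
    ∫ q, ∫ x, E.indicator (fun z => g z.2) (q, x) ∂N ∂Q =
      ∫ x, Q.real {q | (q, x) ∈ E} * g x ∂N := by
  rw [integral_integral_swap]
  · refine integral_congr_ae (Eventually.of_forall fun x => ?_)
    have hm : MeasurableSet {q | (q, x) ∈ E} := measurable_prodMk_right hE
    have h1 : ∀ q, E.indicator (fun z => g z.2) (q, x) = {q | (q, x) ∈ E}.indicator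
        (fun _ => g x) q := fun q => rfl
    simp_rw [h1]
    rw [integral_indicator hm, setIntegral_const, smul_eq_mul]
  · exact (hg.comp_snd Q).indicator hE

end Fubini

section Exponential

variable {y : ℝ}

lemma expMeasure_singleton (x : ℝ) : expMeasure y {x} = 0 :=
  withDensity_absolutelyContinuous _ _ (Real.volume_singleton)

lemma measureReal_expMeasure_Ici (hy : 0 < y) {s : ℝ} (hs : 0 ≤ s) :
    (expMeasure y).real (Set.Ici s) = Real.exp (-(s * y)) := by
  have := isProbabilityMeasure_expMeasure hy
  have h1 := cdf_expMeasure_eq hy s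
  rw [cdf_eq_real, if_pos hs] at h1
  have h2 : (expMeasure y).real (Set.Ici s) = (expMeasure y).real (Set.Ioi s) := by
    refine measureReal_congr ?_
    have : NullSingletonClass (expMeasure y) := ⟨expMeasure_singleton⟩
    exact Ioi_ae_eq_Ici.symm
  rw [h2, ← Set.compl_Iic, probReal_compl_eq_one_sub measurableSet_Iic, h1, mul_comm]
  ring

lemma ae_expMeasure_nonneg : ∀ᵐ u ∂(expMeasure y), 0 ≤ u := by
  rw [expMeasure, gammaMeasure, ae_withDensity_iff (by unfold gammaPDF; fun_prop)]
  refine Eventually.of_forall fun u hu => ?_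
  by_contra h
  exact hu (gammaPDF_of_neg (not_le.1 h))

lemma ae_volume_of_ae_expMeasure (hy : 0 < y) {p : ℝ → Prop} (h : ∀ᵐ u ∂(expMeasure y), p u) :
    ∀ᵐ u : ℝ, 0 < u → p u := by
  rw [expMeasure, gammaMeasure, ae_withDensity_iff (by unfold gammaPDF; fun_prop)] at h
  filter_upwards [h] with u hu h0
  exact hu (ENNReal.ofReal_pos.2 (gammaPDFReal_pos zero_lt_one hy h0)).ne'

/-- The time to the first point of a Poisson process on `[0, 1]` from the right end. The first
exponential time `q.1` is the position of the first point from the left. If it is less than `1`,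
then, by the lack of memory of the process, the time from the right is a second exponential time
`q.2`, stopped at that point; without points it is set to `1`. -/
noncomputable def dualTime (q : ℝ × ℝ) : ℝ := if q.1 < 1 then min q.2 (1 - q.1) else 1

lemma measurable_dualTime : Measurable dualTime :=
  Measurable.ite (measurableSet_lt measurable_fst measurable_const) (by fun_prop) measurable_const

/-- The first times from the left and from the right exceed `s` and `t` when there are no points in
`[0, s] ∪ [1 - t, 1]`. -/
lemma measureReal_le_dualTime (hy : 0 < y) {s t : ℝ} (hs : s ∈ Set.Icc (0 : ℝ) 1)
    (ht : t ∈ Set.Icc (0 : ℝ) 1) :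
    ((expMeasure y).prod (expMeasure y)).real {q | s ≤ q.1 ∧ t ≤ dualTime q} =
      Real.exp (-(min (s + t) 1 * y)) := by
  have := isProbabilityMeasure_expMeasure hy
  -- either there is no point at all, or the first one lies in `[s, 1 - t]`
  have hset : {q : ℝ × ℝ | s ≤ q.1 ∧ t ≤ dualTime q} =
      Set.Ici 1 ×ˢ Set.univ ∪ (Set.Ici s ∩ Set.Iic (1 - t) ∩ Set.Iio 1) ×ˢ Set.Ici t := by
    ext q
    simp only [Set.mem_ofPred_eq, dualTime, Set.mem_union, Set.mem_prod, Set.mem_Ici, Set.mem_univ,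
      and_true, Set.mem_inter_iff, Set.mem_Iic, Set.mem_Iio]
    split_ifs with h
    · rw [le_min_iff]
      constructor
      · rintro ⟨h1, h2, h3⟩
        exact Or.inr ⟨⟨⟨h1, by linarith⟩, h⟩, h2⟩
      · rintro (h1 | ⟨⟨⟨h1, h2⟩, -⟩, h3⟩)
        · linarith
        · exact ⟨h1, h3, by linarith⟩
    · exact ⟨fun _ => Or.inl (not_lt.1 h), fun _ => ⟨hs.2.trans (not_lt.1 h), ht.2⟩⟩
  have hdisj : Disjoint ((Set.Ici (1 : ℝ)) ×ˢ (Set.univ : Set ℝ))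
      ((Set.Ici s ∩ Set.Iic (1 - t) ∩ Set.Iio 1) ×ˢ Set.Ici t) := by
    refine Set.disjoint_left.2 fun q h1 h2 => ?_
    exact absurd (show (1 : ℝ) ≤ q.1 from h1.1) (not_le.2 h2.1.2)
  have hm : MeasurableSet (Set.Ici s ∩ Set.Iic (1 - t) ∩ Set.Iio 1) :=
    (measurableSet_Ici.inter measurableSet_Iic).inter measurableSet_Iio
  rw [hset, measureReal_union hdisj (hm.prod measurableSet_Ici), measureReal_prod_prod,
    measureReal_prod_prod, measureReal_expMeasure_Ici hy zero_le_one,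
    measureReal_expMeasure_Ici hy ht.1, probReal_univ, mul_one]
  rcases le_or_gt (s + t) 1 with hst | hst
  · have h1 : (expMeasure y).real (Set.Ici s ∩ Set.Iic (1 - t) ∩ Set.Iio 1) =
        (expMeasure y).real (Set.Ici s \ Set.Ici (1 - t)) := by
      refine measureReal_congr ?_
      have hne : ∀ᵐ u ∂(expMeasure y), u ≠ 1 - t := by
        rw [ae_iff]
        simpa using expMeasure_singleton (y := y) (1 - t)
      filter_upwards [hne] with u hu
      refine propext ?_
      change ((s ≤ u ∧ u ≤ 1 - t) ∧ u < 1) ↔ (s ≤ u ∧ ¬ (1 - t ≤ u))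
      rw [not_le]
      constructor
      · rintro ⟨⟨h1, h2⟩, -⟩
        exact ⟨h1, lt_of_le_of_ne h2 hu⟩
      · rintro ⟨h1, h2⟩
        exact ⟨⟨h1, h2.le⟩, by linarith [ht.1]⟩
    rw [h1, measureReal_sdiff (Set.Ici_subset_Ici.2 (by linarith)) measurableSet_Ici,
      measureReal_expMeasure_Ici hy hs.1, measureReal_expMeasure_Ici hy (by linarith [ht.2]),
      min_eq_left hst, sub_mul, ← Real.exp_add, ← Real.exp_add]
    ring_nf
  · have h1 : Set.Ici s ∩ Set.Iic (1 - t) ∩ Set.Iio 1 = ∅ := by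
      refine Set.eq_empty_of_forall_notMem fun u hu => ?_
      have h2 : s ≤ u := hu.1.1
      have h3 : u ≤ 1 - t := hu.1.2
      linarith
    rw [h1, measureReal_empty, zero_mul, add_zero, min_eq_right hst.le]

end Exponential

section PartialMass

variable {m : Measure I} [IsFiniteMeasure m] {r : I → ℝ}

/-- The mass which `r dm` gives to the times up to `u`. -/
noncomputable def partialMass (m : Measure I) (r : I → ℝ) (u : ℝ) : ℝ :=
  ∫ t, {t : I | (t : ℝ) ≤ u}.indicator r t ∂m

lemma abs_partialMass_le (hr : Integrable r m) (u : ℝ) : |partialMass m r u| ≤ ∫ t, |r t| ∂m := by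
  refine abs_integral_le_integral_abs.trans (integral_mono_of_nonneg
    (Eventually.of_forall fun _ => abs_nonneg _) hr.abs (Eventually.of_forall fun t => ?_))
  simp only [Set.indicator]
  split_ifs
  · exact le_rfl
  · simp

lemma measurable_partialMass (hr : Measurable r) : Measurable (partialMass m r) := by
  have h1 : StronglyMeasurable fun z : ℝ × I =>
      {z : ℝ × I | (z.2 : ℝ) ≤ z.1}.indicator (fun z => r z.2) z :=
    ((hr.comp measurable_snd).indicator
      (measurableSet_le (measurable_subtype_coe.comp measurable_snd) measurable_fst)).stronglyMeasurable
  exact h1.integral_prod_right.measurable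

lemma partialMass_eq_zero {δ u : ℝ} (hm : ∀ᵐ t : I ∂m, δ ≤ (t : ℝ)) (hu : u < δ) :
    partialMass m r u = 0 := by
  refine integral_eq_zero_of_ae ?_
  filter_upwards [hm] with t ht
  exact Set.indicator_of_notMem (s := {t : I | (t : ℝ) ≤ u}) (fun h : (t : ℝ) ≤ u => absurd h (not_le.2 (hu.trans_le ht))) _

lemma integral_partialMass_comp {α : Type*} [MeasurableSpace α] (Q : Measure α) [IsFiniteMeasure Q]
    (hr : Integrable r m) {τ : α → ℝ} (hτ : Measurable τ) :
    ∫ q, partialMass m r (τ q) ∂Q = ∫ t : I, Q.real {q | (t : ℝ) ≤ τ q} * r t ∂m :=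
  integral_integral_indicator Q m hr (E := {z : α × I | (z.2 : ℝ) ≤ τ z.1})
    (measurableSet_le (by fun_prop) (by fun_prop))

lemma integral_partialMass_mul_comp {α : Type*} [MeasurableSpace α] (Q : Measure α)
    [IsFiniteMeasure Q] (hr : Integrable r m) {τ τ' : α → ℝ} (hτ : Measurable τ)
    (hτ' : Measurable τ') :
    ∫ q, partialMass m r (τ q) * partialMass m r (τ' q) ∂Q =
      ∫ z : I × I, Q.real {q | (z.1 : ℝ) ≤ τ q ∧ (z.2 : ℝ) ≤ τ' q} * (r z.1 * r z.2)
        ∂(m.prod m) := by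
  have hE : MeasurableSet {z : α × (I × I) | (z.2.1 : ℝ) ≤ τ z.1 ∧ (z.2.2 : ℝ) ≤ τ' z.1} := by
    have h1 : MeasurableSet {z : α × (I × I) | (z.2.1 : ℝ) ≤ τ z.1} :=
      measurableSet_le (by fun_prop) (by fun_prop)
    have h2 : MeasurableSet {z : α × (I × I) | (z.2.2 : ℝ) ≤ τ' z.1} :=
      measurableSet_le (by fun_prop) (by fun_prop)
    exact h1.inter h2
  refine Eq.trans ?_ (integral_integral_indicator Q (m.prod m) (hr.mul_prod hr) hE)
  congr 1
  funext q
  rw [partialMass, partialMass, ← integral_prod_mul]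
  congr 1
  funext z
  simp only [Set.indicator, Set.mem_ofPred_eq]
  split_ifs <;> simp_all

/-- The quadratic form of an exponential kernel is half a variance: the three terms of the kernel
are the probabilities `P(max(s, t) ≤ S)`, `P(s ≤ S, t ≤ S')` and `P(s ≤ S) P(t ≤ S)` for the two
first times `S` and `S'`. -/
lemma integral_expCov_eq (hr : Measurable r) (hri : Integrable r m) {y : ℝ} (hy : 0 < y) :
    2 * ∫ z : I × I, expCov y z.1 z.2 * (r z.1 * r z.2) ∂(m.prod m) =
      ∫ q, (partialMass m r q.1 + partialMass m r (dualTime q) -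
        2 * ∫ t : I, Real.exp (-(t * y)) * r t ∂m) ^ 2
          ∂((expMeasure y).prod (expMeasure y)) := by
  have := isProbabilityMeasure_expMeasure hy
  set Q := (expMeasure y).prod (expMeasure y) with hQ
  set a := partialMass m r with ha
  set β := ∫ t : I, Real.exp (-(t * y)) * r t ∂m with hβ
  have ham : Measurable a := measurable_partialMass hr
  have hd := measurable_dualTime
  have hfst : ∀ s : ℝ, 0 ≤ s → Q.real {q | s ≤ q.1} = Real.exp (-(s * y)) := by
    intro s hs
    have : {q : ℝ × ℝ | s ≤ q.1} = Set.Ici s ×ˢ Set.univ := by ext; simp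
    rw [this, hQ, measureReal_prod_prod, probReal_univ, mul_one, measureReal_expMeasure_Ici hy hs]
  have hsnd : ∀ t ∈ Set.Icc (0 : ℝ) 1, Q.real {q | t ≤ dualTime q} = Real.exp (-(t * y)) := by
    intro t ht
    have h1 := measureReal_le_dualTime hy (s := 0) (by simp) ht
    rw [zero_add, min_eq_left ht.2] at h1
    rw [← h1]
    refine measureReal_congr ?_
    have h2 : ∀ᵐ q ∂Q, 0 ≤ q.1 :=
      Measure.quasiMeasurePreserving_fst.ae (ae_expMeasure_nonneg (y := y))
    filter_upwards [h2] with q hq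
    exact propext ⟨fun h => ⟨hq, h⟩, fun h => h.2⟩
  have e1 : ∫ q, a q.1 ∂Q = β := by
    rw [integral_partialMass_comp Q hri measurable_fst]
    exact integral_congr_ae (Eventually.of_forall fun t => by
      dsimp only; rw [hfst t t.2.1])
  have e2 : ∫ q, a (dualTime q) ∂Q = β := by
    rw [integral_partialMass_comp Q hri hd]
    exact integral_congr_ae (Eventually.of_forall fun t => by
      dsimp only; rw [hsnd t t.2])
  set J : (I × I → ℝ) → ℝ := fun k => ∫ z : I × I, k z * (r z.1 * r z.2) ∂(m.prod m) with hJ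
  have e11 : ∫ q, a q.1 * a q.1 ∂Q = J fun z => Real.exp (-(max (z.1 : ℝ) z.2 * y)) := by
    rw [integral_partialMass_mul_comp Q hri measurable_fst measurable_fst]
    refine integral_congr_ae (Eventually.of_forall fun z => ?_)
    dsimp only
    rw [← hfst _ (le_max_of_le_left z.1.2.1)]
    simp_rw [max_le_iff]
  have e22 : ∫ q, a (dualTime q) * a (dualTime q) ∂Q =
      J fun z => Real.exp (-(max (z.1 : ℝ) z.2 * y)) := by
    rw [integral_partialMass_mul_comp Q hri hd hd]
    refine integral_congr_ae (Eventually.of_forall fun z => ?_)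
    dsimp only
    rw [← hsnd _ ⟨le_max_of_le_left z.1.2.1, max_le z.1.2.2 z.2.2.2⟩]
    simp_rw [max_le_iff]
  have e12 : ∫ q, a q.1 * a (dualTime q) ∂Q =
      J fun z => Real.exp (-(min ((z.1 : ℝ) + z.2) 1 * y)) := by
    rw [integral_partialMass_mul_comp Q hri measurable_fst hd]
    refine integral_congr_ae (Eventually.of_forall fun z => ?_)
    dsimp only
    rw [measureReal_le_dualTime hy z.1.2 z.2.2]
  have eβ : J (fun z => Real.exp (-(((z.1 : ℝ) + z.2) * y))) = β * β := by
    rw [hβ, ← integral_prod_mul]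
    refine integral_congr_ae (Eventually.of_forall fun z => ?_)
    dsimp only
    rw [add_mul, neg_add, Real.exp_add]
    ring
  have hJint : ∀ k : I × I → ℝ, Continuous k → Integrable (fun z => k z * (r z.1 * r z.2))
      (m.prod m) := by
    intro k hk
    obtain ⟨K, hK⟩ := isCompact_univ.exists_bound_of_continuousOn (hk.continuousOn (s := Set.univ))
    exact (hri.mul_prod hri).bdd_mul hk.aestronglyMeasurable
      (Eventually.of_forall fun z => hK z trivial)
  have i1 := hJint (fun z => Real.exp (-(max (z.1 : ℝ) z.2 * y))) (by fun_prop)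
  have i2 := hJint (fun z => Real.exp (-(min ((z.1 : ℝ) + z.2) 1 * y))) (by fun_prop)
  have i3 := hJint (fun z => Real.exp (-(((z.1 : ℝ) + z.2) * y))) (by fun_prop)
  have hk : ∫ z : I × I, expCov y z.1 z.2 * (r z.1 * r z.2) ∂(m.prod m) =
      J (fun z => Real.exp (-(max (z.1 : ℝ) z.2 * y))) +
        J (fun z => Real.exp (-(min ((z.1 : ℝ) + z.2) 1 * y))) -
        2 * J (fun z => Real.exp (-(((z.1 : ℝ) + z.2) * y))) := by
    simp only [hJ]
    have s1 := integral_sub (i1.add i2) (i3.const_mul 2)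
    have s2 := integral_add i1 i2
    simp only [Pi.add_apply] at s1 s2
    rw [← integral_const_mul, ← s2, ← s1]
    refine integral_congr_ae (Eventually.of_forall fun z => ?_)
    simp only [expCov]
    ring
  have hbd : ∀ f : ℝ × ℝ → ℝ, Measurable f → Integrable (fun q => a (f q)) Q := fun f hf =>
    Integrable.of_bound (ham.comp hf).aestronglyMeasurable _
      (Eventually.of_forall fun q => abs_partialMass_le hri (f q))
  have hbd2 : ∀ f g : ℝ × ℝ → ℝ, Measurable f → Measurable g →
      Integrable (fun q => a (f q) * a (g q)) Q := fun f g hf hg =>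
    (hbd g hg).bdd_mul (ham.comp hf).aestronglyMeasurable
      (Eventually.of_forall fun q => abs_partialMass_le hri (f q))
  have hexp : ∀ q, (a q.1 + a (dualTime q) - 2 * β) ^ 2 =
      a q.1 * a q.1 + a (dualTime q) * a (dualTime q) + 2 * (a q.1 * a (dualTime q)) -
        4 * β * (a q.1) - 4 * β * a (dualTime q) + 4 * β ^ 2 := fun q => by ring
  have j1 := hbd2 Prod.fst Prod.fst measurable_fst measurable_fst
  have j2 := hbd2 _ _ hd hd
  have j3 := (hbd2 Prod.fst _ measurable_fst hd).const_mul 2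
  have j4 := (hbd Prod.fst measurable_fst).const_mul (4 * β)
  have j5 := (hbd _ hd).const_mul (4 * β)
  simp_rw [hexp]
  have s1 := integral_add ((((j1.add j2).add j3).sub j4).sub j5) (integrable_const (4 * β ^ 2))
  have s2 := integral_sub (((j1.add j2).add j3).sub j4) j5
  have s3 := integral_sub ((j1.add j2).add j3) j4
  have s4 := integral_add (j1.add j2) j3
  have s5 := integral_add j1 j2
  simp only [Pi.add_apply, Pi.sub_apply, integral_const_mul] at s1 s2 s3 s4 s5
  rw [s1, s2, s3, s4, s5, hk, e1, e2, e11, e12, e22, eβ]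
  simp only [integral_const, probReal_univ, smul_eq_mul]
  ring

end PartialMass

section Positivity

variable {m : Measure I} [IsFiniteMeasure m] {r : I → ℝ} {δ θ : ℝ}

/-- Integration by parts: if `r dm` has vanishing partial masses, then it annihilates
`t ^ θ * log t`, which vanishes at `1`. -/
lemma integral_rpow_mul_log_eq_zero (hr : Integrable r m) (hδ : 0 < δ)
    (hm : ∀ᵐ t : I ∂m, δ ≤ (t : ℝ))
    (ha : ∀ᵐ u : ℝ, 0 < u → u < 1 → partialMass m r u = 0) :
    ∫ t : I, (t : ℝ) ^ θ * Real.log t * r t ∂m = 0 := by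
  set f' : ℝ → ℝ := fun u => θ * u ^ (θ - 1) * Real.log u + u ^ θ * u⁻¹ with hf'
  have hderiv : ∀ u : ℝ, 0 < u → HasDerivAt (fun u : ℝ => u ^ θ * Real.log u) (f' u) u :=
    fun u hu => (Real.hasDerivAt_rpow_const (Or.inl hu.ne')).mul (Real.hasDerivAt_log hu.ne')
  have hcont : ContinuousOn f' (Set.Icc (δ / 2) 1) := by
    intro u hu
    have hu0 : u ≠ 0 := (lt_of_lt_of_le (half_pos hδ) hu.1).ne'
    refine ContinuousAt.continuousWithinAt ?_
    refine ContinuousAt.add (ContinuousAt.mul (continuousAt_const.mul ?_) ?_) (ContinuousAt.mul ?_ ?_)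
    · exact Real.continuousAt_rpow_const _ _ (Or.inl hu0)
    · exact Real.continuousAt_log hu0
    · exact Real.continuousAt_rpow_const _ _ (Or.inl hu0)
    · exact continuousAt_inv₀ hu0
  have hint : IntegrableOn f' (Set.Ioc (δ / 2) 1) :=
    (hcont.integrableOn_compact isCompact_Icc).mono_set Set.Ioc_subset_Icc_self
  have h1 : ∀ᵐ t : I ∂m, (t : ℝ) ^ θ * Real.log t * r t =
      -∫ u in Set.Ioc (δ / 2) 1, {z : I × ℝ | (z.1 : ℝ) ≤ z.2}.indicator
        (fun z => r z.1 * f' z.2) (t, u) := by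
    filter_upwards [hm] with t ht
    have ht0 : 0 < (t : ℝ) := hδ.trans_le ht
    have e1 : ∀ u : ℝ, {z : I × ℝ | (z.1 : ℝ) ≤ z.2}.indicator (fun z => r z.1 * f' z.2) (t, u) =
        (Set.Ici (t : ℝ)).indicator (fun u => r t * f' u) u := fun u => rfl
    simp_rw [e1]
    rw [setIntegral_indicator measurableSet_Ici]
    have e2 : Set.Ioc (δ / 2) 1 ∩ Set.Ici (t : ℝ) = Set.Icc (t : ℝ) 1 := by
      ext u
      constructor
      · rintro ⟨h1, h2⟩
        exact ⟨h2, h1.2⟩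
      · rintro ⟨h1, h2⟩
        exact ⟨⟨by linarith, h2⟩, h1⟩
    rw [e2, integral_Icc_eq_integral_Ioc, ← intervalIntegral.integral_of_le t.2.2,
      intervalIntegral.integral_const_mul,
      intervalIntegral.integral_eq_sub_of_hasDerivAt (f := fun u : ℝ => u ^ θ * Real.log u)]
    · rw [Real.log_one]
      ring
    · intro u hu
      rw [Set.uIcc_of_le t.2.2] at hu
      exact hderiv u (ht0.trans_le hu.1)
    · refine ContinuousOn.intervalIntegrable ?_
      rw [Set.uIcc_of_le t.2.2]
      exact hcont.mono (Set.Icc_subset_Icc_left (by linarith))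
  rw [integral_congr_ae h1, integral_neg, neg_eq_zero,
    integral_integral_swap (f := fun (t : I) (u : ℝ) => {z : I × ℝ | (z.1 : ℝ) ≤ z.2}.indicator
        (fun z => r z.1 * f' z.2) (t, u))
      ((hr.mul_prod hint).indicator (measurableSet_le (by fun_prop) (by fun_prop)))]
  refine integral_eq_zero_of_ae ?_
  have h2 : ∀ᵐ u : ℝ ∂(volume.restrict (Set.Ioc (δ / 2) 1)), u ≠ 1 := by
    refine ae_restrict_of_ae ?_
    rw [ae_iff]
    simp
  filter_upwards [ae_restrict_of_ae ha, ae_restrict_mem measurableSet_Ioc, h2] with u hu hmem hu1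
  have h3 := hu ((half_pos hδ).trans hmem.1) (lt_of_le_of_ne hmem.2 hu1)
  have e1 : ∀ t : I, {z : I × ℝ | (z.1 : ℝ) ≤ z.2}.indicator (fun z => r z.1 * f' z.2) (t, u) =
      {t : I | (t : ℝ) ≤ u}.indicator r t * f' u := by
    intro t
    simp only [Set.indicator, Set.mem_ofPred_eq]
    split_ifs <;> simp
  simp_rw [e1]
  rw [integral_mul_const]
  change partialMass m r u * f' u = 0
  rw [h3, zero_mul]

lemma exists_mem_Ioo_of_ae {p : ℝ → Prop} (h : ∀ᵐ u : ℝ, p u) {a b : ℝ} (hab : a < b) :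
    ∃ u ∈ Set.Ioo a b, p u := by
  have hne : (ae (volume.restrict (Set.Ioo a b))).NeBot := by
    rw [ae_neBot]
    intro h0
    have := Measure.restrict_eq_zero.1 h0
    rw [Real.volume_Ioo, ENNReal.ofReal_eq_zero] at this
    linarith
  obtain ⟨u, h1, h2⟩ := ((ae_restrict_of_ae h (s := Set.Ioo a b)).and
    (ae_restrict_mem measurableSet_Ioo)).exists
  exact ⟨u, h2, h1⟩

/-- The quadratic form of an exponential kernel is strictly positive: a vanishing variance would
make all the partial masses vanish. -/
lemma integral_expCov_pos (hrm : Measurable r) (hr : Integrable r m) (hδ : δ ∈ Set.Ioo (0 : ℝ) 1)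
    (hm : ∀ᵐ t : I ∂m, δ ≤ (t : ℝ)) (hlog : ∫ t : I, (t : ℝ) ^ θ * Real.log t * r t ∂m ≠ 0)
    {y : ℝ} (hy : 0 < y) :
    0 < ∫ z : I × I, expCov y z.1 z.2 * (r z.1 * r z.2) ∂(m.prod m) := by
  have := isProbabilityMeasure_expMeasure hy
  have hvar := integral_expCov_eq hrm hr hy
  set κ := 2 * ∫ t : I, Real.exp (-(t * y)) * r t ∂m with hκ
  set Q := (expMeasure y).prod (expMeasure y) with hQ
  set a := partialMass m r with ha
  have hmeas : Measurable fun q : ℝ × ℝ => a q.1 + a (dualTime q) - κ :=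
    (((measurable_partialMass hrm).comp measurable_fst).add
      ((measurable_partialMass hrm).comp measurable_dualTime)).sub_const _
  have hnn : 0 ≤ fun q : ℝ × ℝ => (a q.1 + a (dualTime q) - κ) ^ 2 := fun q => sq_nonneg _
  by_contra hcon
  have h0 : ∫ q, (a q.1 + a (dualTime q) - κ) ^ 2 ∂Q = 0 :=
    le_antisymm (by linarith [not_lt.1 hcon]) (integral_nonneg hnn)
  have hint : Integrable (fun q : ℝ × ℝ => (a q.1 + a (dualTime q) - κ) ^ 2) Q := by
    refine Integrable.of_bound (hmeas.pow_const 2).aestronglyMeasurable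
      ((∫ t, |r t| ∂m + ∫ t, |r t| ∂m + |κ|) ^ 2) (Eventually.of_forall fun q => ?_)
    rw [Real.norm_eq_abs, abs_pow]
    refine pow_le_pow_left₀ (abs_nonneg _) ?_ 2
    refine (abs_sub _ _).trans (add_le_add ((abs_add_le _ _).trans (add_le_add ?_ ?_)) le_rfl)
    · exact abs_partialMass_le hr _
    · exact abs_partialMass_le hr _
  rw [integral_eq_zero_iff_of_nonneg hnn hint] at h0
  have h1 := Measure.ae_ae_of_ae_prod h0
  have h2 : ∀ᵐ u : ℝ, 0 < u → ∀ᵐ v : ℝ, 0 < v → a u + a (dualTime (u, v)) = κ := by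
    filter_upwards [ae_volume_of_ae_expMeasure hy h1] with u hu hu0
    filter_upwards [ae_volume_of_ae_expMeasure hy (hu hu0)] with v hv hv0
    have := hv hv0
    simp only [Pi.zero_apply, sq_eq_zero_iff] at this
    linarith
  -- let the first time `u` be small, so that it has no mass below it
  have hsmall : ∀ n : ℕ, ∃ u ∈ Set.Ioo 0 (δ / (n + 1)), 0 < u →
      ∀ᵐ v : ℝ, 0 < v → a u + a (dualTime (u, v)) = κ := fun n =>
    exists_mem_Ioo_of_ae h2 (div_pos hδ.1 (by positivity))
  choose u hu hgood using hsmall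
  have huδ : ∀ n, u n < δ := fun n =>
    (hu n).2.trans_le (div_le_self hδ.1.le (by linarith [(Nat.cast_nonneg n : (0 : ℝ) ≤ n)]))
  -- with the second time also less than `δ`, the constant is a sum of vanishing partial masses
  have hκ0 : κ = 0 := by
    obtain ⟨v, hv, hva⟩ := exists_mem_Ioo_of_ae (hgood 0 (hu 0).1) hδ.1
    rw [← hva hv.1, ha, partialMass_eq_zero hm (huδ 0), zero_add, dualTime,
      if_pos ((huδ 0).trans hδ.2)]
    exact partialMass_eq_zero hm ((min_le_left _ _).trans_lt hv.2)
  refine hlog (integral_rpow_mul_log_eq_zero hr hδ.1 hm ?_)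
  filter_upwards [ae_all_iff.2 fun n => hgood n (hu n).1] with v hv hv0 hv1
  -- for `u < 1 - v` the second time is `v` itself
  obtain ⟨n, hn⟩ := exists_nat_one_div_lt (sub_pos.2 hv1)
  have hun : u n < 1 - v := by
    refine (hu n).2.trans_le (le_trans ?_ hn.le)
    have : (0 : ℝ) < n + 1 := by positivity
    exact (div_le_div_iff_of_pos_right this).2 hδ.2.le
  have h3 := hv n hv0
  rw [ha, partialMass_eq_zero hm (huδ n), zero_add, dualTime, if_pos ((huδ n).trans hδ.2),
    min_eq_left (by dsimp only; linarith), hκ0] at h3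
  exact h3

lemma abs_expCov_le {y : ℝ} (hy : 0 ≤ y) (s t : I) :
    |expCov y s t| ≤ 4 * (1 - Real.exp (-(2 * y))) := by
  have key : ∀ l : ℝ, 0 ≤ l → l ≤ 2 → Real.exp (-(2 * y)) ≤ Real.exp (-(l * y)) ∧
      Real.exp (-(l * y)) ≤ 1 := fun l h0 h2 =>
    ⟨Real.exp_le_exp.2 (neg_le_neg (mul_le_mul_of_nonneg_right h2 hy)),
      Real.exp_le_one_iff.2 (neg_nonpos.2 (mul_nonneg h0 hy))⟩
  have hs := s.2
  have ht := t.2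
  have h1 := key (max (s : ℝ) t) (le_max_of_le_left hs.1) (max_le (by linarith [hs.2])
    (by linarith [ht.2]))
  have h2 := key (min ((s : ℝ) + t) 1) (le_min (by linarith [hs.1, ht.1]) zero_le_one)
    (min_le_of_right_le one_le_two)
  have h3 := key ((s : ℝ) + t) (by linarith [hs.1, ht.1]) (by linarith [hs.2, ht.2])
  rw [expCov, abs_le]
  constructor <;> linarith [h1.1, h1.2, h2.1, h2.2, h3.1, h3.2]

/-- The limiting covariance as a mixture of exponential kernels, from the integral representation of
the power `l ^ θ`. -/
lemma meanConst_mul_totalCov (hθ : θ ∈ Set.Ioo (0 : ℝ) 1) (s t : I) :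
    meanConst θ 1 * totalCov θ s t =
      ∫ x in Set.Ioi (0 : ℝ), expCov (x ^ (-(1 / θ))) s t := by
  have hs := s.2.1
  have ht := t.2.1
  have h1 : 0 ≤ max (s : ℝ) t := le_max_of_le_left hs
  have h2 : 0 ≤ min ((s : ℝ) + t) 1 := le_min (by linarith) zero_le_one
  have h3 : 0 ≤ (s : ℝ) + t := by linarith
  have i1 := integrableOn_one_sub_exp_rpow hθ h1
  have i2 := integrableOn_one_sub_exp_rpow hθ h2
  have i3 := (integrableOn_one_sub_exp_rpow hθ h3).const_mul 2
  have s1 := integral_sub (i3.sub i1) i2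
  have s2 := integral_sub i3 i1
  simp only [Pi.sub_apply] at s1 s2
  rw [s2, integral_const_mul, integral_one_sub_exp_rpow hθ h1, integral_one_sub_exp_rpow hθ h2,
    integral_one_sub_exp_rpow hθ h3] at s1
  rw [totalCov]
  calc _ = _ := by ring
    _ = _ := s1.symm
    _ = _ := by
      refine integral_congr_ae (Eventually.of_forall fun x => ?_)
      simp only [expCov]
      ring

/-- The quadratic form of the limiting covariance is strictly positive, because that covariance is
a mixture of exponential kernels. -/
lemma integral_totalCov_pos (hθ : θ ∈ Set.Ioo (0 : ℝ) 1) (hrm : Measurable r)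
    (hr : Integrable r m) (hδ : δ ∈ Set.Ioo (0 : ℝ) 1) (hm : ∀ᵐ t : I ∂m, δ ≤ (t : ℝ))
    (hlog : ∫ t : I, (t : ℝ) ^ θ * Real.log t * r t ∂m ≠ 0) :
    0 < ∫ z : I × I, totalCov θ z.1 z.2 * (r z.1 * r z.2) ∂(m.prod m) := by
  have hC := meanConst_pos hθ one_pos
  set N := volume.restrict (Set.Ioi (0 : ℝ)) with hN
  have hmeas : Measurable fun w : (I × I) × ℝ => expCov (w.2 ^ (-(1 / θ))) w.1.1 w.1.2 := by
    unfold expCov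
    fun_prop
  have hpos : ∀ᵐ x ∂N, 0 < x ^ (-(1 / θ)) := by
    filter_upwards [ae_restrict_mem measurableSet_Ioi] with x hx
    exact Real.rpow_pos_of_pos hx _
  have hint : Integrable (fun w : (I × I) × ℝ =>
      expCov (w.2 ^ (-(1 / θ))) w.1.1 w.1.2 * (r w.1.1 * r w.1.2)) ((m.prod m).prod N) := by
    have hdom := (hr.mul_prod hr).abs.mul_prod
      ((integrableOn_one_sub_exp_rpow hθ (zero_le_two (α := ℝ))).const_mul 4)
    refine hdom.mono' (hmeas.mul (by fun_prop)).aestronglyMeasurable ?_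
    filter_upwards [Measure.quasiMeasurePreserving_snd.ae hpos] with w hw
    rw [Real.norm_eq_abs, abs_mul, mul_comm]
    exact mul_le_mul_of_nonneg_left (abs_expCov_le hw.le _ _) (abs_nonneg _)
  have hswap := integral_integral_swap (f := fun (z : I × I) (x : ℝ) =>
    expCov (x ^ (-(1 / θ))) z.1 z.2 * (r z.1 * r z.2)) hint
  have h1 : ∀ z : I × I, ∫ x, expCov (x ^ (-(1 / θ))) z.1 z.2 * (r z.1 * r z.2) ∂N =
      meanConst θ 1 * (totalCov θ z.1 z.2 * (r z.1 * r z.2)) := by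
    intro z
    rw [integral_mul_const, ← meanConst_mul_totalCov hθ, mul_assoc]
  simp_rw [h1] at hswap
  rw [integral_const_mul] at hswap
  have h2 : 0 < ∫ x, ∫ z : I × I, expCov (x ^ (-(1 / θ))) z.1 z.2 * (r z.1 * r z.2)
      ∂(m.prod m) ∂N := by
    have hp : ∀ x ∈ Set.Ioi (0 : ℝ), 0 < ∫ z : I × I, expCov (x ^ (-(1 / θ))) z.1 z.2 *
        (r z.1 * r z.2) ∂(m.prod m) := fun x hx =>
      integral_expCov_pos hrm hr hδ hm hlog (Real.rpow_pos_of_pos hx _)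
    rw [hN, setIntegral_pos_iff_support_of_nonneg_ae]
    · refine lt_of_lt_of_le ?_ (measure_mono (s := Set.Ioi (0 : ℝ)) ?_)
      · simp
      · exact fun x hx => ⟨(hp x hx).ne', hx⟩
    · filter_upwards [ae_restrict_mem measurableSet_Ioi] with x hx
      exact (hp x hx).le
    · exact hint.integral_prod_right
  rw [← hswap] at h2
  exact (pos_iff_pos_of_mul_pos h2).1 hC

end Positivity

/-! ### Asymptotics of the expected counts -/

/-- The weights `p` have expected counts `C k ^ θ + o(k ^ (θ / 2))`, with a fixed and with a
Poisson number of draws. -/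
structure PowerLaw (p : ℕ → ℝ) (θ C : ℝ) : Prop where
  weight : IsWeight p
  exponent : θ ∈ Set.Ioo (0 : ℝ) 1
  pos : 0 < C
  mean : ∀ η : ℝ, 0 < η → ∃ K : ℝ, 0 ≤ K ∧ ∀ k : ℕ,
    |meanFn p k - C * (k : ℝ) ^ θ| ≤ η * (k : ℝ) ^ (θ / 2) + K
  poisson : ∀ η : ℝ, 0 < η → ∃ K : ℝ, 0 ≤ K ∧ ∀ l : ℝ, 0 ≤ l →
    |poissonMean p l - C * l ^ θ| ≤ η * l ^ (θ / 2) + K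

section Asymptotics

variable {p : ℕ → ℝ} {θ C : ℝ}

lemma tendsto_rpow_neg_nat {a : ℝ} (ha : 0 < a) :
    Tendsto (fun n : ℕ => (n : ℝ) ^ (-a)) atTop (𝓝 0) :=
  (tendsto_rpow_neg_atTop ha).comp tendsto_natCast_atTop_atTop

/-- If `f n` is `C x ^ θ` up to `x ^ (θ / 2)` at a point `x` of order `n u`, then it is of order
`C u ^ θ n ^ θ`. -/
lemma tendsto_div_rpow (hθ : 0 < θ) {K u : ℝ} {x f : ℕ → ℝ} (hx : ∀ n, 0 ≤ x n)
    (hxu : Tendsto (fun n => x n / n) atTop (𝓝 u))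
    (hf : ∀ᶠ n in atTop, |f n - C * x n ^ θ| ≤ x n ^ (θ / 2) + K) :
    Tendsto (fun n => f n / (n : ℝ) ^ θ) atTop (𝓝 (C * u ^ θ)) := by
  have hpow : ∀ a : ℝ, 0 < a → Tendsto (fun n => (x n / n) ^ a) atTop (𝓝 (u ^ a)) := fun a ha =>
    ((Real.continuousAt_rpow_const u a (Or.inr ha.le)).tendsto).comp hxu
  have herr : Tendsto (fun n : ℕ => f n / (n : ℝ) ^ θ - C * (x n / n) ^ θ) atTop (𝓝 0) := by
    have hb : Tendsto (fun n : ℕ => (x n / n) ^ (θ / 2) * (n : ℝ) ^ (-(θ / 2)) +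
        K * (n : ℝ) ^ (-θ)) atTop (𝓝 (u ^ (θ / 2) * 0 + K * 0)) :=
      ((hpow _ (half_pos hθ)).mul (tendsto_rpow_neg_nat (half_pos hθ))).add
        ((tendsto_rpow_neg_nat hθ).const_mul K)
    rw [mul_zero, mul_zero, add_zero] at hb
    refine squeeze_zero_norm' ?_ hb
    filter_upwards [hf, eventually_gt_atTop 0] with n hn hn0
    have hn' : (0 : ℝ) < n := Nat.cast_pos.2 hn0
    have e1 : f n / (n : ℝ) ^ θ - C * (x n / n) ^ θ = (f n - C * x n ^ θ) * (n : ℝ) ^ (-θ) := by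
      rw [Real.div_rpow (hx n) hn'.le, Real.rpow_neg hn'.le]
      ring
    have e2 : (x n / n) ^ (θ / 2) * (n : ℝ) ^ (-(θ / 2)) = x n ^ (θ / 2) * (n : ℝ) ^ (-θ) := by
      rw [Real.div_rpow (hx n) hn'.le, div_eq_mul_inv, ← Real.rpow_neg hn'.le, mul_assoc,
        ← Real.rpow_add hn']
      ring_nf
    have hpos : 0 < (n : ℝ) ^ (-θ) := Real.rpow_pos_of_pos hn' _
    rw [e1, e2, norm_mul, Real.norm_eq_abs, Real.norm_eq_abs, abs_of_pos hpos, ← add_mul]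
    exact mul_le_mul_of_nonneg_right hn hpos.le
  have := herr.add ((hpow θ hθ).const_mul C)
  simpa using this

lemma PowerLaw.tendsto_meanFn_div_rpow (h : PowerLaw p θ C) :
    Tendsto (fun n : ℕ => meanFn p n / (n : ℝ) ^ θ) atTop (𝓝 C) := by
  obtain ⟨K, -, hK⟩ := h.mean 1 one_pos
  have h1 : Tendsto (fun n : ℕ => (n : ℝ) / n) atTop (𝓝 1) := by
    refine tendsto_const_nhds.congr' ?_
    filter_upwards [eventually_gt_atTop 0] with n hn
    rw [div_self (Nat.cast_ne_zero.2 hn.ne')]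
  have := tendsto_div_rpow h.exponent.1 (fun n => Nat.cast_nonneg n) h1
    (Eventually.of_forall fun n => by simpa using hK n)
  simpa using this

lemma PowerLaw.tendsto_div_meanFn (h : PowerLaw p θ C) {K u : ℝ} {x f : ℕ → ℝ} (hx : ∀ n, 0 ≤ x n)
    (hxu : Tendsto (fun n => x n / n) atTop (𝓝 u))
    (hf : ∀ᶠ n in atTop, |f n - C * x n ^ θ| ≤ x n ^ (θ / 2) + K) :
    Tendsto (fun n : ℕ => f n / meanFn p n) atTop (𝓝 (u ^ θ)) := by
  have h1 := (tendsto_div_rpow h.exponent.1 hx hxu hf).div h.tendsto_meanFn_div_rpow h.pos.ne'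
  rw [mul_div_cancel_left₀ _ h.pos.ne'] at h1
  refine h1.congr' ?_
  filter_upwards [eventually_gt_atTop 0] with n hn
  have : (n : ℝ) ^ θ ≠ 0 := (Real.rpow_pos_of_pos (Nat.cast_pos.2 hn) _).ne'
  simp only [Pi.div_apply]
  rw [div_div_div_cancel_right₀ this]

lemma PowerLaw.tendsto_meanFn (h : PowerLaw p θ C) : Tendsto (meanFn p) atTop atTop := by
  have h1 : Tendsto (fun n : ℕ => (n : ℝ) ^ θ) atTop atTop :=
    (tendsto_rpow_atTop h.exponent.1).comp tendsto_natCast_atTop_atTop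
  refine (h.tendsto_meanFn_div_rpow.pos_mul_atTop h.pos h1).congr' ?_
  filter_upwards [eventually_gt_atTop 0] with n hn
  exact div_mul_cancel₀ _ (Real.rpow_pos_of_pos (Nat.cast_pos.2 hn) _).ne'

lemma PowerLaw.tendsto_meanFn_div (h : PowerLaw p θ C) :
    Tendsto (fun n : ℕ => meanFn p n / n) atTop (𝓝 0) := by
  have h1 := h.tendsto_meanFn_div_rpow.mul (tendsto_rpow_neg_nat (sub_pos.2 h.exponent.2))
  rw [mul_zero] at h1
  refine h1.congr' ?_
  filter_upwards [eventually_gt_atTop 0] with n hn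
  have hn' : (0 : ℝ) < n := Nat.cast_pos.2 hn
  rw [div_mul_eq_mul_div, div_eq_div_iff (Real.rpow_pos_of_pos hn' _).ne' hn'.ne', mul_assoc]
  congr 1
  nth_rw 2 [← Real.rpow_one (n : ℝ)]
  rw [← Real.rpow_add hn']
  congr 1
  ring

lemma tendsto_timeIndex_div (t : I) :
    Tendsto (fun n : ℕ => (timeIndex n t : ℝ) / n) atTop (𝓝 t) := by
  have := (tendsto_nat_floor_mul_div_atTop (R := ℝ) t.2.1).comp tendsto_natCast_atTop_atTop
  refine this.congr fun n => ?_
  simp only [Function.comp, timeIndex, mul_comm]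

/-- The indices that matter are a positive proportion of `n`, and so are their means. -/
lemma PowerLaw.eventually_index (h : PowerLaw p θ C) {δ : ℝ} (hδ : 0 < δ) :
    ∀ᶠ n : ℕ in atTop, ∀ k ≤ n, n * δ < k + 1 →
      1 ≤ k ∧ n * (δ / 2) ≤ k ∧ δ / 2 * meanFn p n ≤ meanFn p k := by
  obtain ⟨N, hN⟩ := exists_nat_gt (2 / δ)
  filter_upwards [eventually_ge_atTop N, eventually_gt_atTop 0] with n hn hn0 k hk hnk
  have hn' : (0 : ℝ) < n := Nat.cast_pos.2 hn0
  have h2 : 2 < n * δ := by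
    have : 2 / δ < n := hN.trans_le (by exact_mod_cast hn)
    rwa [div_lt_iff₀ hδ] at this
  have hk1 : n * (δ / 2) ≤ k := by linarith
  refine ⟨?_, hk1, ?_⟩
  · have : (1 : ℝ) < k := by linarith
    exact_mod_cast this.le
  · have h3 := h.weight.mul_meanFn_add_sub_le k (n - k)
    rw [Nat.add_sub_cancel' hk, Nat.cast_sub hk] at h3
    have hM := h.weight.meanFn_nonneg n
    have h4 : k * meanFn p n ≤ n * meanFn p k := by linarith
    have h5 : n * (δ / 2) * meanFn p n ≤ k * meanFn p n := mul_le_mul_of_nonneg_right hk1 hM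
    have h6 : n * (δ / 2 * meanFn p n) ≤ n * meanFn p k := by linarith
    exact le_of_mul_le_mul_left h6 hn'

lemma abs_log_sub_log_le {x y c : ℝ} (hc : 0 < c) (hx : c ≤ x) (hy : c ≤ y) :
    |Real.log x - Real.log y| ≤ |x - y| / c := by
  have key : ∀ x y : ℝ, c ≤ x → c ≤ y → Real.log x - Real.log y ≤ |x - y| / c := by
    intro x y hx hy
    have hx0 := hc.trans_le hx
    have hy0 := hc.trans_le hy
    rw [← Real.log_div hx0.ne' hy0.ne']
    refine (Real.log_le_sub_one_of_pos (div_pos hx0 hy0)).trans ?_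
    rw [div_sub_one hy0.ne']
    calc (x - y) / y ≤ |x - y| / y := by gcongr; exact le_abs_self _
      _ ≤ |x - y| / c := by gcongr
  rw [abs_le]
  constructor
  · have := key y x hy hx
    rw [abs_sub_comm] at this
    linarith
  · exact key x y hx hy

/-- The logarithm of the expected count at time `t` is `log (C (n t) ^ θ)`, up to an error that is
negligible even at the scale of the fluctuations. -/
lemma PowerLaw.eventually_log_le (h : PowerLaw p θ C) {δ : ℝ} (hδ : 0 < δ) {η : ℝ} (hη : 0 < η) :
    ∀ᶠ n : ℕ in atTop, ∀ t : I, δ ≤ (t : ℝ) →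
      √(meanFn p n) * |Real.log (meanFn p (timeIndex n t)) -
        (Real.log C + θ * Real.log n + θ * Real.log t)| ≤ η := by
  obtain ⟨hθ0, hθ1⟩ := h.exponent
  have hC := h.pos
  -- both arguments of the logarithm are at least `c₀ n ^ θ`
  set c₀ : ℝ := min (C * δ ^ θ) (δ / 2 * (C / 2)) with hc₀
  have hc₀pos : 0 < c₀ := lt_min (mul_pos hC (Real.rpow_pos_of_pos hδ _)) (by positivity)
  have hs : 0 < √(2 * C) := Real.sqrt_pos.2 (by positivity)
  obtain ⟨K, hK0, hK⟩ := h.mean (c₀ / √(2 * C) * (η / 2)) (by positivity)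
  have hlim := (tendsto_rpow_neg_nat (half_pos hθ0)).const_mul (√(2 * C) / c₀ * (K + C))
  rw [mul_zero] at hlim
  filter_upwards [h.eventually_index hδ, eventually_gt_atTop 0,
    h.tendsto_meanFn_div_rpow.eventually (Ioo_mem_nhds (show C / 2 < C by linarith)
      (show C < 2 * C by linarith)), hlim.eventually (gt_mem_nhds (half_pos hη))]
    with n hidx hn0 hM hsmall t ht
  have hn' : (0 : ℝ) < n := Nat.cast_pos.2 hn0
  have hpow : 0 < (n : ℝ) ^ θ := Real.rpow_pos_of_pos hn' _
  have hM1 : C / 2 * (n : ℝ) ^ θ ≤ meanFn p n := ((lt_div_iff₀ hpow).1 hM.1).le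
  have hM2 : meanFn p n ≤ 2 * C * (n : ℝ) ^ θ := ((div_lt_iff₀ hpow).1 hM.2).le
  set k := timeIndex n t with hk
  have ht0 : 0 < (t : ℝ) := hδ.trans_le ht
  have hkn : (k : ℝ) ≤ n := by exact_mod_cast timeIndex_le n t
  obtain ⟨-, -, hMk⟩ := hidx k (timeIndex_le n t)
    ((mul_le_mul_of_nonneg_left ht hn'.le).trans_lt (mul_lt_timeIndex_add_one n t))
  have hk_le : (k : ℝ) ≤ n * t := timeIndex_le_mul n t
  have hlt : n * (t : ℝ) ≤ k + 1 := (mul_lt_timeIndex_add_one n t).le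
  have hdiff : |meanFn p k - C * (n * t) ^ θ| ≤
      c₀ / √(2 * C) * (η / 2) * (n : ℝ) ^ (θ / 2) + (K + C) := by
    have h1 := hK k
    have h2 : (k : ℝ) ^ (θ / 2) ≤ (n : ℝ) ^ (θ / 2) :=
      Real.rpow_le_rpow (Nat.cast_nonneg k) hkn (half_pos hθ0).le
    have h3 : (k : ℝ) ^ θ ≤ (n * t) ^ θ := Real.rpow_le_rpow (Nat.cast_nonneg k) hk_le hθ0.le
    -- the integer part costs at most one, as `θ ≤ 1`
    have h4 : (n * (t : ℝ)) ^ θ ≤ (k : ℝ) ^ θ + 1 := by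
      refine (Real.rpow_le_rpow (by positivity) hlt hθ0.le).trans ?_
      have := Real.rpow_add_le_add_rpow (Nat.cast_nonneg k) zero_le_one hθ0.le hθ1.le
      rwa [Real.one_rpow] at this
    have h5 : c₀ / √(2 * C) * (η / 2) * (k : ℝ) ^ (θ / 2) ≤
        c₀ / √(2 * C) * (η / 2) * (n : ℝ) ^ (θ / 2) := by gcongr
    have h6 : C * (k : ℝ) ^ θ ≤ C * (n * t) ^ θ := by gcongr
    have h7 : C * (n * (t : ℝ)) ^ θ ≤ C * (k : ℝ) ^ θ + C := by
      have := mul_le_mul_of_nonneg_left h4 hC.le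
      linarith
    rw [abs_le] at h1 ⊢
    constructor <;> linarith [h1.1, h1.2]
  have hx : c₀ * (n : ℝ) ^ θ ≤ meanFn p k := by
    calc c₀ * (n : ℝ) ^ θ ≤ δ / 2 * (C / 2) * (n : ℝ) ^ θ := by gcongr; exact min_le_right _ _
      _ = δ / 2 * (C / 2 * (n : ℝ) ^ θ) := by ring
      _ ≤ δ / 2 * meanFn p n := by gcongr
      _ ≤ _ := hMk
  have hy : c₀ * (n : ℝ) ^ θ ≤ C * (n * t) ^ θ := by
    rw [Real.mul_rpow hn'.le ht0.le]
    calc c₀ * (n : ℝ) ^ θ ≤ C * δ ^ θ * (n : ℝ) ^ θ := by gcongr; exact min_le_left _ _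
      _ ≤ C * (t : ℝ) ^ θ * (n : ℝ) ^ θ := by gcongr
      _ = _ := by ring
  have hlog : Real.log C + θ * Real.log n + θ * Real.log t = Real.log (C * (n * t) ^ θ) := by
    rw [Real.log_mul hC.ne' (Real.rpow_pos_of_pos (by positivity) _).ne',
      Real.log_rpow (by positivity), Real.log_mul hn'.ne' ht0.ne']
    ring
  have hsq : √(meanFn p n) ≤ √(2 * C) * (n : ℝ) ^ (θ / 2) := by
    refine (Real.sqrt_le_sqrt hM2).trans_eq ?_
    rw [Real.sqrt_mul (by positivity), Real.sqrt_eq_rpow ((n : ℝ) ^ θ), ← Real.rpow_mul hn'.le]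
    congr 2
    ring
  have hhalf : (n : ℝ) ^ θ = (n : ℝ) ^ (θ / 2) * (n : ℝ) ^ (θ / 2) := by
    rw [← Real.rpow_add hn']
    ring_nf
  have hpow2 : 0 < (n : ℝ) ^ (θ / 2) := Real.rpow_pos_of_pos hn' _
  rw [hlog]
  calc √(meanFn p n) * |Real.log (meanFn p k) - Real.log (C * (n * t) ^ θ)|
      ≤ √(2 * C) * (n : ℝ) ^ (θ / 2) * ((c₀ / √(2 * C) * (η / 2) * (n : ℝ) ^ (θ / 2) + (K + C)) /
          (c₀ * (n : ℝ) ^ θ)) := by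
        gcongr
        exact (abs_log_sub_log_le (by positivity) hx hy).trans (by gcongr)
    _ = η / 2 + √(2 * C) / c₀ * (K + C) * (n : ℝ) ^ (-(θ / 2)) := by
        rw [hhalf, Real.rpow_neg hn'.le]
        field_simp
    _ ≤ η := by linarith

end Asymptotics

/-! ### Linearization of the logarithm -/

/-- For `R ≥ M / 2` the remainder is quadratic. For smaller `R` the logarithm of `R / M` is at least
`-log M` and the square is at least a quarter. -/
lemma abs_log_sub_le {M R : ℝ} (hM : 1 ≤ M) (hR : 1 ≤ R) :
    |Real.log R - Real.log M - (R - M) / M| ≤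
      (2 + 4 * Real.log M) / M ^ 2 * (R - M) ^ 2 := by
  have hM0 : 0 < M := by linarith
  have hR0 : 0 < R := by linarith
  have hlogM : 0 ≤ Real.log M := Real.log_nonneg hM
  set x := R / M with hx
  have hx0 : 0 < x := div_pos hR0 hM0
  have e1 : Real.log R - Real.log M = Real.log x := (Real.log_div hR0.ne' hM0.ne').symm
  have e2 : (R - M) / M = x - 1 := by rw [hx]; field_simp
  have e3 : (2 + 4 * Real.log M) / M ^ 2 * (R - M) ^ 2 = (2 + 4 * Real.log M) * (x - 1) ^ 2 := by
    rw [← e2, div_pow]; ring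
  rw [e1, e2, e3]
  have hle := Real.log_le_sub_one_of_pos hx0
  rw [abs_of_nonpos (by linarith)]
  have hsq : 0 ≤ (x - 1) ^ 2 := sq_nonneg _
  rcases le_or_gt (1 / 2) x with hx2 | hx2
  · have h1 := Real.one_sub_inv_le_log_of_pos hx0
    have h2 : x - 1 - (1 - x⁻¹) = (x - 1) ^ 2 / x := by field_simp
    have h3 : (x - 1) ^ 2 / x ≤ 2 * (x - 1) ^ 2 := by
      rw [div_le_iff₀ hx0]
      nlinarith
    nlinarith [mul_nonneg hlogM hsq]
  · have h1 : -Real.log M ≤ Real.log x := by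
      rw [← e1]
      linarith [Real.log_nonneg hR]
    have h2 : 1 ≤ 4 * (x - 1) ^ 2 := by nlinarith
    nlinarith [mul_le_mul_of_nonneg_left h2 hlogM]

section Sample

variable {Ω : Type*} [MeasurableSpace Ω] {μ : Measure Ω} [IsProbabilityMeasure μ] {X : ℕ → Ω → ℕ}

/-- The error in the linearization of the logarithm of a count at its mean. -/
noncomputable def logRem (μ : Measure Ω) (X : ℕ → Ω → ℕ) (J : Finset ℕ) (ω : Ω) : ℝ :=
  Real.posLog (distinct X J ω) - Real.log (meanFn (freq μ X) J.card) -
    (distinct X J ω - meanFn (freq μ X) J.card) / meanFn (freq μ X) J.card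

lemma IsSample.integrable_logRem (h : IsSample μ X) (J : Finset ℕ) :
    Integrable (logRem μ X J) μ :=
  h.integrable_comp_distinct J fun k => Real.posLog k - Real.log (meanFn (freq μ X) J.card) -
    (k - meanFn (freq μ X) J.card) / meanFn (freq μ X) J.card

/-- A nonempty window has a count of at least one, so `posLog` is the logarithm there. -/
lemma IsSample.integral_abs_logRem_le (h : IsSample μ X) {J : Finset ℕ} (hJ : J.Nonempty) :
    ∫ ω, |logRem μ X J ω| ∂μ ≤
      (2 + 4 * Real.log (meanFn (freq μ X) J.card)) / meanFn (freq μ X) J.card := by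
  set M := meanFn (freq μ X) J.card with hM
  have hM1 : 1 ≤ M := h.isWeight.one_le_meanFn (Finset.card_pos.2 hJ)
  have hM0 : 0 < M := by linarith
  have hlogM : 0 ≤ Real.log M := Real.log_nonneg hM1
  calc ∫ ω, |logRem μ X J ω| ∂μ
      ≤ ∫ ω, (2 + 4 * Real.log M) / M ^ 2 * ((distinct X J ω : ℝ) - M) ^ 2 ∂μ := by
        refine integral_mono (h.integrable_logRem J).abs ((h.integrable_comp_distinct J fun k =>
          ((k : ℝ) - M) ^ 2).const_mul _) fun ω => ?_
        have hR : (1 : ℝ) ≤ distinct X J ω := by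
          have : 1 ≤ distinct X J ω := Finset.card_pos.2 (hJ.image _)
          exact_mod_cast this
        have h1 := abs_log_sub_le hM1 hR
        rw [← Real.posLog_eq_log (by rw [Nat.abs_cast]; exact hR)] at h1
        exact h1
    _ ≤ (2 + 4 * Real.log M) / M ^ 2 * M := by
        rw [integral_const_mul]
        exact mul_le_mul_of_nonneg_left (h.integral_sq_distinct_sub_le J) (by positivity)
    _ = _ := by field_simp

end Sample

section LinearPart

variable {p : ℕ → ℝ} {θ C δ : ℝ} {m : Measure I} [IsFiniteMeasure m] {h : I → ℝ}

lemma integrable_sign (hh : Measurable h) (habs : ∀ t, |h t| = 1) : Integrable h m :=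
  Integrable.of_bound hh.aestronglyMeasurable 1 (Eventually.of_forall fun t => (habs t).le)

lemma abs_rpow_neg_le (hθ : 0 < θ) (hδ : 0 < δ) {t : ℝ} (ht : δ ≤ t) : |t ^ (-θ)| ≤ δ ^ (-θ) := by
  rw [abs_of_nonneg (Real.rpow_nonneg (hδ.le.trans ht) _)]
  exact Real.rpow_le_rpow_of_nonpos hδ ht (neg_nonpos.2 hθ.le)

lemma integrable_rpow_mul_sign (hθ : 0 < θ) (hδ : 0 < δ) (hh : Measurable h)
    (habs : ∀ t, |h t| = 1) (hm : ∀ᵐ t : I ∂m, δ ≤ (t : ℝ)) :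
    Integrable (fun t : I => (t : ℝ) ^ (-θ) * h t) m := by
  refine Integrable.of_bound (Measurable.aestronglyMeasurable (by fun_prop)) (δ ^ (-θ)) ?_
  filter_upwards [hm] with t ht
  rw [norm_mul, Real.norm_eq_abs, Real.norm_eq_abs, habs, mul_one]
  exact abs_rpow_neg_le hθ hδ ht

lemma PowerLaw.tendsto_meanFn_timeIndex (hp : PowerLaw p θ C) (t : I) :
    Tendsto (fun n => meanFn p (timeIndex n t) / meanFn p n) atTop (𝓝 ((t : ℝ) ^ θ)) := by
  obtain ⟨K, -, hK⟩ := hp.mean 1 one_pos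
  exact hp.tendsto_div_meanFn (fun n => Nat.cast_nonneg (timeIndex n t)) (tendsto_timeIndex_div t)
    (Eventually.of_forall fun n => by simpa using hK (timeIndex n t))

lemma measurable_ratio (hh : Measurable h) (n : ℕ) :
    Measurable fun t : I => (meanFn p n / meanFn p (timeIndex n t) - (t : ℝ) ^ (-θ)) * h t := by
  have : Measurable fun t : I => meanFn p n / meanFn p (timeIndex n t) :=
    (Measurable.of_discrete (f := fun k : ℕ => meanFn p n / meanFn p k)).comp (measurable_timeIndex n)
  fun_prop

lemma PowerLaw.eventually_ratio_le (hp : PowerLaw p θ C) (hδ : 0 < δ) :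
    ∀ᶠ n : ℕ in atTop, ∀ t : I, δ ≤ (t : ℝ) →
      |meanFn p n / meanFn p (timeIndex n t) - (t : ℝ) ^ (-θ)| ≤ 2 / δ + δ ^ (-θ) := by
  filter_upwards [hp.eventually_index hδ, eventually_ge_atTop 1] with n hn hn1 t ht
  obtain ⟨h1, -, h3⟩ := hn _ (timeIndex_le n t)
    ((mul_le_mul_of_nonneg_left ht (Nat.cast_nonneg n)).trans_lt (mul_lt_timeIndex_add_one n t))
  have hM := hp.weight.meanFn_nonneg n
  have hMk : 0 < meanFn p (timeIndex n t) := zero_lt_one.trans_le (hp.weight.one_le_meanFn h1)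
  refine (abs_sub _ _).trans (add_le_add ?_ (abs_rpow_neg_le hp.exponent.1 hδ ht))
  rw [abs_of_nonneg (div_nonneg hM hMk.le), div_le_div_iff₀ hMk hδ]
  linarith

lemma PowerLaw.tendsto_integral_ratio (hp : PowerLaw p θ C) (hδ : 0 < δ) (hh : Measurable h)
    (habs : ∀ t, |h t| = 1) (hm : ∀ᵐ t : I ∂m, δ ≤ (t : ℝ)) :
    Tendsto (fun n => ∫ t : I, |(meanFn p n / meanFn p (timeIndex n t) - (t : ℝ) ^ (-θ)) * h t| ∂m)
      atTop (𝓝 0) := by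
  have := tendsto_integral_filter_of_dominated_convergence (μ := m) (l := atTop)
    (F := fun n (t : I) => |(meanFn p n / meanFn p (timeIndex n t) - (t : ℝ) ^ (-θ)) * h t|)
    (f := fun _ => 0) (fun _ => 2 / δ + δ ^ (-θ))
    (Eventually.of_forall fun n => ((measurable_ratio hh n).abs).aestronglyMeasurable) ?_
    (integrable_const _) ?_
  · simpa using this
  · filter_upwards [hp.eventually_ratio_le hδ] with n hn
    filter_upwards [hm] with t ht
    rw [Real.norm_eq_abs, abs_abs, abs_mul, habs, mul_one]
    exact hn t ht
  · filter_upwards [hm] with t ht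
    have ht0 : 0 < (t : ℝ) := hδ.trans_le ht
    have h1 := (hp.tendsto_meanFn_timeIndex t).inv₀ (Real.rpow_pos_of_pos ht0 _).ne'
    have h2 := ((h1.sub_const ((t : ℝ) ^ (-θ))).mul_const (h t)).abs
    rw [Real.rpow_neg ht0.le, sub_self, zero_mul, abs_zero] at h2
    refine h2.congr fun n => ?_
    rw [inv_div, Real.rpow_neg ht0.le]

variable {Ω : Type*} [MeasurableSpace Ω] {μ : Measure Ω} [IsProbabilityMeasure μ] {X : ℕ → Ω → ℕ}

/-- The sum of the centered counts among the first and among the last `k` of `n` observations, in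
the scale of the fluctuations. -/
noncomputable def fluctuation (μ : Measure Ω) (X : ℕ → Ω → ℕ) (n k : ℕ) (ω : Ω) : ℝ :=
  ((distinct X (Finset.range k) ω - meanFn (freq μ X) k) +
    (distinct X (Finset.Ico (n - k) n) ω - meanFn (freq μ X) k)) / (2 * √(meanFn (freq μ X) n))

lemma card_last {n k : ℕ} (hk : k ≤ n) : (Finset.Ico (n - k) n).card = k := by
  rw [Nat.card_Ico]; omega

lemma IsSample.integrable_fluctuation (hX : IsSample μ X) (n k : ℕ) :
    Integrable (fluctuation μ X n k) μ :=
  (((hX.integrable_comp_distinct _ fun j => (j : ℝ)).sub (integrable_const _)).add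
    ((hX.integrable_comp_distinct _ fun j => (j : ℝ)).sub (integrable_const _))).div_const _

lemma IsSample.integral_abs_fluctuation_le (hX : IsSample μ X) {n k : ℕ} (hk : k ≤ n) :
    ∫ ω, |fluctuation μ X n k ω| ∂μ ≤ 1 := by
  set M := meanFn (freq μ X) with hM
  have hle : ∀ J : Finset ℕ, J.card = k →
      ∫ ω, |(distinct X J ω : ℝ) - M k| ∂μ ≤ √(M n) := by
    intro J hJ
    have h1 := hX.integral_abs_distinct_sub_le J
    rw [hJ] at h1
    exact h1.trans (Real.sqrt_le_sqrt (hX.isWeight.meanFn_mono hk))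
  have hi : ∀ J : Finset ℕ, Integrable (fun ω => |(distinct X J ω : ℝ) - M k|) μ := fun J =>
    hX.integrable_comp_distinct J fun j => |(j : ℝ) - M k|
  have hs := Real.sqrt_nonneg (M n)
  calc ∫ ω, |fluctuation μ X n k ω| ∂μ
      ≤ ∫ ω, (|(distinct X (Finset.range k) ω : ℝ) - M k| +
          |(distinct X (Finset.Ico (n - k) n) ω : ℝ) - M k|) / (2 * √(M n)) ∂μ := by
        refine integral_mono (hX.integrable_fluctuation n k).abs
          (((hi _).add (hi _)).div_const _) fun ω => ?_
        dsimp only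
        rw [fluctuation, abs_div, abs_of_nonneg (mul_nonneg zero_le_two hs)]
        gcongr
        exact abs_add_le _ _
    _ = (∫ ω, |(distinct X (Finset.range k) ω : ℝ) - M k| ∂μ +
          ∫ ω, |(distinct X (Finset.Ico (n - k) n) ω : ℝ) - M k| ∂μ) / (2 * √(M n)) := by
        rw [integral_div, integral_add (hi _) (hi _)]
    _ ≤ (√(M n) + √(M n)) / (2 * √(M n)) := by
        gcongr
        · exact hle _ (Finset.card_range k)
        · exact hle _ (card_last hk)
    _ ≤ 1 := by
        rw [← two_mul]
        exact div_self_le_one _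

/-- The integral of the normalized fluctuations against `t ^ (-θ) dA(t)`. -/
noncomputable def linearPart (μ : Measure Ω) (X : ℕ → Ω → ℕ) (θ : ℝ) (m : Measure I) (h : I → ℝ)
    (n : ℕ) (ω : Ω) : ℝ :=
  ∫ t : I, fluctuation μ X n (timeIndex n t) ω * ((t : ℝ) ^ (-θ) * h t) ∂m

/-- The mean of the integrated logarithms of the two counts. -/
noncomputable def logMean (X : ℕ → Ω → ℕ) (m : Measure I) (h : I → ℝ) (n : ℕ) (ω : Ω) : ℝ :=
  (∫ t : I, Real.posLog (distinct X (Finset.range (timeIndex n t)) ω) * h t ∂m +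
    ∫ t : I, Real.posLog (distinct X (Finset.Ico (n - timeIndex n t) n) ω) * h t ∂m) / 2

/-- The remainder of the linearization splits into a deterministic bias, the error in linearizing
the logarithm, and the error in replacing the ratio of expected counts by a power. -/
lemma IsSample.linearization_eq (hθ : 0 < θ) (hδ : 0 < δ)
    (hh : Measurable h) (habs : ∀ t, |h t| = 1) (hm : ∀ᵐ t : I ∂m, δ ≤ (t : ℝ))
    (h0 : ∫ t, h t ∂m = 0) (hlog : ∫ t : I, Real.log t * h t ∂m = 1) {n : ℕ}
    (hM : 0 < meanFn (freq μ X) n)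
    (hratio : Integrable (fun t : I => (meanFn (freq μ X) n / meanFn (freq μ X) (timeIndex n t) -
      (t : ℝ) ^ (-θ)) * h t) m) (ω : Ω) :
    √(meanFn (freq μ X) n) * (logMean X m h n ω - θ) - linearPart μ X θ m h n ω =
      ∫ t : I, √(meanFn (freq μ X) n) * (Real.log (meanFn (freq μ X) (timeIndex n t)) -
          (Real.log C + θ * Real.log n + θ * Real.log t)) * h t ∂m +
      ∫ t : I, √(meanFn (freq μ X) n) / 2 * (logRem μ X (Finset.range (timeIndex n t)) ω +
          logRem μ X (Finset.Ico (n - timeIndex n t) n) ω) * h t ∂m +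
      ∫ t : I, fluctuation μ X n (timeIndex n t) ω *
        ((meanFn (freq μ X) n / meanFn (freq μ X) (timeIndex n t) - (t : ℝ) ^ (-θ)) * h t) ∂m := by
  set M := meanFn (freq μ X) with hMdef
  set s := √(M n) with hs
  have hs0 : 0 < s := Real.sqrt_pos.2 hM
  have hss : s * s = M n := Real.mul_self_sqrt hM.le
  have hi := integrable_sign (m := m) hh habs
  have hlogi : Integrable (fun t : I => Real.log t * h t) m := by
    by_contra hcon
    rw [integral_undef hcon] at hlog
    exact zero_ne_one hlog
  -- constants integrate to zero, so the leading term of the logarithm leaves `θ`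
  have hconst : ∀ a : ℝ, ∫ t : I, (a + θ * Real.log t) * h t ∂m = θ := by
    intro a
    have e1 := integral_add (hi.const_mul a) (hlogi.const_mul θ)
    rw [integral_const_mul, integral_const_mul, h0, hlog, mul_zero, mul_one, zero_add] at e1
    refine Eq.trans ?_ e1
    exact integral_congr_ae (Eventually.of_forall fun t => by dsimp only; ring)
  have hci : ∀ a : ℝ, Integrable (fun t : I => (a + θ * Real.log t) * h t) m := by
    intro a
    refine ((hi.const_mul a).add (hlogi.const_mul θ)).congr (Eventually.of_forall fun t => ?_)
    simp only [Pi.add_apply]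
    ring
  set a := Real.log C + θ * Real.log n with ha
  have iP := integrable_comp_timeIndex hi n fun k => Real.posLog (distinct X (Finset.range k) ω)
  have iP' := integrable_comp_timeIndex hi n fun k =>
    Real.posLog (distinct X (Finset.Ico (n - k) n) ω)
  have iL := integrable_comp_timeIndex (integrable_rpow_mul_sign hθ hδ hh habs hm) n fun k =>
    fluctuation μ X n k ω
  have iM := integrable_comp_timeIndex hi n fun k => Real.log (M k)
  have i1 : Integrable (fun t : I => s * (Real.log (M (timeIndex n t)) -
      (a + θ * Real.log t)) * h t) m := by
    refine ((iM.sub (hci a)).const_mul s).congr (Eventually.of_forall fun t => ?_)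
    simp only [Pi.sub_apply]
    ring
  have i2 := integrable_comp_timeIndex hi n fun k => s / 2 *
    (logRem μ X (Finset.range k) ω + logRem μ X (Finset.Ico (n - k) n) ω)
  have i3 := integrable_comp_timeIndex hratio n fun k => fluctuation μ X n k ω
  have eL : s * (logMean X m h n ω - θ) - linearPart μ X θ m h n ω =
      ∫ t : I, (s / 2 * (Real.posLog (distinct X (Finset.range (timeIndex n t)) ω) * h t +
          Real.posLog (distinct X (Finset.Ico (n - timeIndex n t) n) ω) * h t) -
        s * ((a + θ * Real.log t) * h t) -
        fluctuation μ X n (timeIndex n t) ω * ((t : ℝ) ^ (-θ) * h t)) ∂m := by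
    have e1 := integral_sub (((iP.add iP').const_mul (s / 2)).sub ((hci a).const_mul s)) iL
    have e2 := integral_sub ((iP.add iP').const_mul (s / 2)) ((hci a).const_mul s)
    have e3 := integral_add iP iP'
    simp only [Pi.add_apply, Pi.sub_apply, integral_const_mul] at e1 e2 e3
    rw [e1, e2, e3, hconst, logMean, linearPart]
    ring
  have e1 := integral_add (i1.add i2) i3
  have e2 := integral_add i1 i2
  simp only [Pi.add_apply] at e1 e2
  rw [eL, ← e2, ← e1]
  refine integral_congr_ae (Eventually.of_forall fun t => ?_)
  have hk := timeIndex_le n t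
  set k := timeIndex n t with hkdef
  dsimp only
  rw [logRem, logRem, Finset.card_range, card_last hk, ← hMdef, fluctuation, ← hMdef, ← hs, ← hss]
  field_simp
  ring

/-- The centered and scaled estimator is close in mean to the integral of the normalized
fluctuations. -/
lemma IsSample.tendsto_linearization (hX : IsSample μ X) (hp : PowerLaw (freq μ X) θ C)
    (hδ : 0 < δ) (hh : Measurable h) (habs : ∀ t, |h t| = 1) (hm : ∀ᵐ t : I ∂m, δ ≤ (t : ℝ))
    (h0 : ∫ t, h t ∂m = 0) (hlog : ∫ t : I, Real.log t * h t ∂m = 1) :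
    Tendsto (fun n => ∫ ω, |√(meanFn (freq μ X) n) * (logMean X m h n ω - θ) -
      linearPart μ X θ m h n ω| ∂μ) atTop (𝓝 0) := by
  set M := meanFn (freq μ X) with hMdef
  have hi := integrable_sign (m := m) hh habs
  have hmass : ∫ t, |h t| ∂m = m.real Set.univ := by simp [habs]
  -- the bound for the linearization error of the logarithms, at the scale `√(M n)`
  have hsmall : Tendsto (fun n => √(M n) * ((2 + 4 * Real.log (M n)) / (δ / 2 * M n))) atTop
      (𝓝 0) := by
    have h1 : Tendsto (fun x : ℝ => √x * ((2 + 4 * Real.log x) / (δ / 2 * x))) atTop (𝓝 0) := by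
      have h2 : Tendsto (fun x : ℝ => Real.log x / x ^ (1 / 2 : ℝ)) atTop (𝓝 0) :=
        (isLittleO_log_rpow_atTop (by norm_num : (0 : ℝ) < 1 / 2)).tendsto_div_nhds_zero
      have h3 := ((tendsto_rpow_neg_atTop (by norm_num : (0 : ℝ) < 1 / 2)).const_mul (4 / δ)).add
        (h2.const_mul (8 / δ))
      rw [mul_zero, mul_zero, add_zero] at h3
      refine h3.congr' ?_
      filter_upwards [eventually_gt_atTop 0] with x hx
      have hsx : 0 < √x := Real.sqrt_pos.2 hx
      rw [Real.rpow_neg hx.le, ← Real.sqrt_eq_rpow]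
      have hxx : √x ^ 2 = x := Real.sq_sqrt hx.le
      field_simp
      rw [hxx]
      ring
    exact h1.comp hp.tendsto_meanFn
  rw [tendsto_order]
  refine ⟨fun b hb => Eventually.of_forall fun n =>
    hb.trans_le (integral_nonneg fun ω => abs_nonneg _), fun η hη => ?_⟩
  set c := m.real Set.univ with hc
  have hc0 : 0 ≤ c := measureReal_nonneg
  have hlim := (hsmall.mul_const c).add (hp.tendsto_integral_ratio hδ hh habs hm)
  rw [zero_mul, add_zero] at hlim
  filter_upwards [hp.eventually_index hδ, hp.eventually_ratio_le hδ,
    hp.eventually_log_le hδ (show 0 < η / (2 * (c + 1)) by positivity), eventually_ge_atTop 1,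
    hlim.eventually (gt_mem_nhds (half_pos hη))] with n hidx hrat hlogn hn1 hsm
  have hM1 : 1 ≤ M n := hp.weight.one_le_meanFn hn1
  have hM0 : 0 < M n := by linarith
  have hs0 : 0 < √(M n) := Real.sqrt_pos.2 hM0
  have hratio : Integrable (fun t : I => (M n / M (timeIndex n t) - (t : ℝ) ^ (-θ)) * h t) m := by
    refine Integrable.of_bound (measurable_ratio hh n).aestronglyMeasurable (2 / δ + δ ^ (-θ)) ?_
    filter_upwards [hm] with t ht
    rw [Real.norm_eq_abs, abs_mul, habs, mul_one]
    exact hrat t ht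
  rw [integral_congr_ae (Eventually.of_forall fun ω => congrArg abs (IsSample.linearization_eq
    (C := C) (X := X) hp.exponent.1 hδ hh habs hm h0 hlog hM0 hratio ω))]
  set D₁ := ∫ t : I, √(M n) * (Real.log (M (timeIndex n t)) -
          (Real.log C + θ * Real.log n + θ * Real.log t)) * h t ∂m with hD₁
  set F : ℕ → Ω → ℝ := fun k ω => √(M n) / 2 * (logRem μ X (Finset.range k) ω +
          logRem μ X (Finset.Ico (n - k) n) ω) with hF
  have hFi : ∀ k, Integrable (F k) μ := fun k =>
    ((hX.integrable_logRem _).add (hX.integrable_logRem _)).const_mul _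
  have hFb : ∀ k ≤ n, n * δ < k + 1 → ∫ ω, |F k ω| ∂μ ≤
      √(M n) * ((2 + 4 * Real.log (M n)) / (δ / 2 * M n)) := by
    intro k hk hnk
    obtain ⟨hk1, -, hMk⟩ := hidx k hk hnk
    have hMk1 : 1 ≤ M k := hp.weight.one_le_meanFn hk1
    have hlogk : 0 ≤ Real.log (M k) := Real.log_nonneg hMk1
    have hJ : ∀ J : Finset ℕ, J.card = k → ∫ ω, |logRem μ X J ω| ∂μ ≤
        (2 + 4 * Real.log (M n)) / (δ / 2 * M n) := by
      intro J hJ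
      have h1 := hX.integral_abs_logRem_le (J := J) (Finset.card_pos.1 (by omega))
      rw [hJ, ← hMdef] at h1
      refine h1.trans ?_
      have : Real.log (M k) ≤ Real.log (M n) :=
        Real.log_le_log (by linarith) (hp.weight.meanFn_mono hk)
      gcongr
      linarith
    have e1 := hJ _ (Finset.card_range k)
    have e2 := hJ _ (card_last hk)
    calc ∫ ω, |F k ω| ∂μ
        ≤ ∫ ω, √(M n) / 2 * (|logRem μ X (Finset.range k) ω| +
          |logRem μ X (Finset.Ico (n - k) n) ω|) ∂μ := by
          refine integral_mono (hFi k).abs (((hX.integrable_logRem _).abs.add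
            (hX.integrable_logRem _).abs).const_mul _) fun ω => ?_
          simp only [hF]
          rw [abs_mul, abs_of_pos (half_pos hs0)]
          gcongr
          exact abs_add_le _ _
      _ = √(M n) / 2 * (∫ ω, |logRem μ X (Finset.range k) ω| ∂μ +
          ∫ ω, |logRem μ X (Finset.Ico (n - k) n) ω| ∂μ) := by
          rw [integral_const_mul, integral_add (hX.integrable_logRem _).abs
            (hX.integrable_logRem _).abs]
      _ ≤ √(M n) / 2 * ((2 + 4 * Real.log (M n)) / (δ / 2 * M n) +
          (2 + 4 * Real.log (M n)) / (δ / 2 * M n)) := by gcongr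
      _ = _ := by ring
  have hlogM : 0 ≤ Real.log (M n) := Real.log_nonneg hM1
  have b1 : |D₁| ≤ η / 2 := by
    calc |D₁| ≤ η / (2 * (c + 1)) * c := by
          rw [← Real.norm_eq_abs, hD₁]
          refine norm_integral_le_of_norm_le_const ?_
          filter_upwards [hm] with t ht
          rw [norm_mul, Real.norm_eq_abs, Real.norm_eq_abs, habs, mul_one, abs_mul,
            abs_of_pos hs0]
          exact hlogn t ht
      _ ≤ η / (2 * (c + 1)) * (c + 1) := by gcongr; linarith
      _ = η / 2 := by field_simp
  have b2 := integral_abs_integral_comp_timeIndex_le hi hm n hFi (by positivity) hFb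
  have b3 := integral_abs_integral_comp_timeIndex_le hratio hm n
    (hX.integrable_fluctuation n) zero_le_one fun k hk _ => hX.integral_abs_fluctuation_le hk
  have j2 := integrable_integral_comp_timeIndex hi n hFi
  have j3 := integrable_integral_comp_timeIndex hratio n (hX.integrable_fluctuation n)
  calc ∫ ω, |D₁ + ∫ t : I, F (timeIndex n t) ω * h t ∂m +
        ∫ t : I, fluctuation μ X n (timeIndex n t) ω *
          ((M n / M (timeIndex n t) - (t : ℝ) ^ (-θ)) * h t) ∂m| ∂μ
      ≤ ∫ ω, (|D₁| + |∫ t : I, F (timeIndex n t) ω * h t ∂m| +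
        |∫ t : I, fluctuation μ X n (timeIndex n t) ω *
          ((M n / M (timeIndex n t) - (t : ℝ) ^ (-θ)) * h t) ∂m|) ∂μ := by
        refine integral_mono (((integrable_const (μ := μ) D₁).add j2).add j3).abs
          (((integrable_const (μ := μ) |D₁|).add j2.abs).add j3.abs) fun ω => ?_
        exact (abs_add_le _ _).trans (add_le_add_left (abs_add_le _ _) _)
    _ = |D₁| + ∫ ω, |∫ t : I, F (timeIndex n t) ω * h t ∂m| ∂μ +
        ∫ ω, |∫ t : I, fluctuation μ X n (timeIndex n t) ω *
          ((M n / M (timeIndex n t) - (t : ℝ) ^ (-θ)) * h t) ∂m| ∂μ := by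
        have e1 := integral_add ((integrable_const (μ := μ) |D₁|).add j2.abs) j3.abs
        have e2 := integral_add (integrable_const (μ := μ) |D₁|) j2.abs
        simp only [Pi.add_apply] at e1 e2
        rw [e1, e2]
        simp
    _ < η := by
        rw [hmass] at b2
        linarith

end LinearPart

/-! ### The central limit theorem for the linear part -/

section Sample

variable {Ω : Type*} [MeasurableSpace Ω] {μ : Measure Ω} [IsProbabilityMeasure μ] {X : ℕ → Ω → ℕ}

/-- The centered indicator of the absence of the value `i` from the steps in `J`. -/
noncomputable def absence (μ : Measure Ω) (X : ℕ → Ω → ℕ) (i : ℕ) (J : Finset ℕ)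
    (z : Ω × (ℕ → ℕ)) : ℝ :=
  (miss X i J).indicator 1 z - Real.exp (-(J.card * freq μ X i))

lemma indicator_one_mem_Icc {α : Type*} (S : Set α) (z : α) :
    S.indicator (1 : α → ℝ) z ∈ Set.Icc (0 : ℝ) 1 := by
  simp only [Set.indicator, Pi.one_apply]
  split_ifs <;> simp

lemma abs_absence_le (i : ℕ) (J : Finset ℕ) (z : Ω × (ℕ → ℕ)) : |absence μ X i J z| ≤ 1 := by
  have h1 := indicator_one_mem_Icc (miss X i J) z
  have h2 := Real.exp_pos (-(J.card * freq μ X i))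
  have h3 : Real.exp (-(J.card * freq μ X i)) ≤ 1 :=
    Real.exp_le_one_iff.2 (neg_nonpos.2 (mul_nonneg (Nat.cast_nonneg _) (freq_nonneg i)))
  rw [absence, abs_le]
  constructor <;> linarith [h1.1, h1.2]

lemma measurable_absence_missField (i : ℕ) (J : Finset ℕ) :
    Measurable[missField X i] (absence μ X i J) := by
  have h1 : MeasurableSet[missField X i] (miss X i J) :=
    MeasurableSpace.measurableSet_generateFrom ⟨J, rfl⟩
  exact ((@measurable_const ℝ (Ω × (ℕ → ℕ)) _ (missField X i) 1).indicator h1).sub_const _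

lemma IsSample.measurable_absence (h : IsSample μ X) (i : ℕ) (J : Finset ℕ) :
    Measurable (absence μ X i J) :=
  (measurable_one.indicator (h.measurableSet_miss i J)).sub_const _

lemma IsSample.integrable_absence (h : IsSample μ X) (i : ℕ) (J : Finset ℕ) :
    Integrable (absence μ X i J) (μ.prod stepLaw) :=
  Integrable.of_bound (h.measurable_absence i J).aestronglyMeasurable 1
    (Eventually.of_forall fun z => abs_absence_le i J z)

lemma IsSample.integral_absence (h : IsSample μ X) (i : ℕ) (J : Finset ℕ) :
    ∫ z, absence μ X i J z ∂(μ.prod stepLaw) = 0 := by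
  simp only [absence]
  rw [integral_sub ((integrable_const 1).indicator (h.measurableSet_miss i J))
    (integrable_const _), integral_indicator_one (h.measurableSet_miss i J), h.measureReal_miss]
  simp

lemma IsSample.integral_absence_mul (h : IsSample μ X) (i : ℕ) (J J' : Finset ℕ) :
    ∫ z, absence μ X i J z * absence μ X i J' z ∂(μ.prod stepLaw) =
      Real.exp (-((J ∪ J').card * freq μ X i)) -
        Real.exp (-((J.card + J'.card : ℝ) * freq μ X i)) := by
  rw [← h.covariance_miss, covariance, integral_indicator_one (h.measurableSet_miss i J),
    integral_indicator_one (h.measurableSet_miss i J'), h.measureReal_miss, h.measureReal_miss]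
  rfl

/-- The sum of the centered absence indicators of `i` in the first and in the last `k` of `n`
steps. -/
noncomputable def absencePair (μ : Measure Ω) (X : ℕ → Ω → ℕ) (n k i : ℕ) (z : Ω × (ℕ → ℕ)) : ℝ :=
  absence μ X i (Finset.Ico 0 k) z + absence μ X i (Finset.Ico (n - k) n) z

/-- The partial sums of the expectations of a Poissonized count. -/
noncomputable def truncMean (p : ℕ → ℝ) (N : ℕ) (x : ℝ) : ℝ :=
  ∑ i ∈ Finset.range N, (1 - Real.exp (-(x * p i)))

lemma truncMean_mono {p : ℕ → ℝ} (hp : ∀ i, 0 ≤ p i) (N : ℕ) : Monotone (truncMean p N) := by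
  intro x y hxy
  refine Finset.sum_le_sum fun i _ => sub_le_sub_left (Real.exp_le_exp.2 (neg_le_neg ?_)) _
  exact mul_le_mul_of_nonneg_right hxy (hp i)

/-- Half the covariance, at the indices `k` and `l`, of the sum of the forward and the backward
Poissonized counts of the values below `N`. -/
noncomputable def truncCov (p : ℕ → ℝ) (N n k l : ℕ) : ℝ :=
  2 * truncMean p N (k + l) - truncMean p N (max k l) - truncMean p N (min ((k : ℝ) + l) n)

lemma IsSample.integral_absencePair_mul (h : IsSample μ X) {n k l : ℕ} (hk : k ≤ n) (hl : l ≤ n)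
    (i : ℕ) :
    ∫ z, absencePair μ X n k i z * absencePair μ X n l i z ∂(μ.prod stepLaw) =
      2 * (2 * (1 - Real.exp (-((k + l : ℝ) * freq μ X i))) -
        (1 - Real.exp (-((max k l : ℝ) * freq μ X i))) -
        (1 - Real.exp (-(min ((k : ℝ) + l) n * freq μ X i)))) := by
  have hint : ∀ J J', Integrable (fun z => absence μ X i J z * absence μ X i J' z)
      (μ.prod stepLaw) := fun J J' =>
    (h.integrable_absence i J').bdd_mul (h.measurable_absence i J).aestronglyMeasurable
      (Eventually.of_forall fun z => abs_absence_le i J z)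
  have hexp : ∀ z, absencePair μ X n k i z * absencePair μ X n l i z =
      absence μ X i (Finset.Ico 0 k) z * absence μ X i (Finset.Ico 0 l) z +
      absence μ X i (Finset.Ico 0 k) z * absence μ X i (Finset.Ico (n - l) n) z +
      absence μ X i (Finset.Ico (n - k) n) z * absence μ X i (Finset.Ico 0 l) z +
      absence μ X i (Finset.Ico (n - k) n) z * absence μ X i (Finset.Ico (n - l) n) z := by
    intro z
    simp only [absencePair]
    ring
  simp_rw [hexp]
  have s1 := integral_add (((hint (Finset.Ico 0 k) (Finset.Ico 0 l)).add
    (hint (Finset.Ico 0 k) (Finset.Ico (n - l) n))).add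
      (hint (Finset.Ico (n - k) n) (Finset.Ico 0 l)))
        (hint (Finset.Ico (n - k) n) (Finset.Ico (n - l) n))
  have s2 := integral_add ((hint (Finset.Ico 0 k) (Finset.Ico 0 l)).add
    (hint (Finset.Ico 0 k) (Finset.Ico (n - l) n)))
      (hint (Finset.Ico (n - k) n) (Finset.Ico 0 l))
  have s3 := integral_add (hint (Finset.Ico 0 k) (Finset.Ico 0 l))
    (hint (Finset.Ico 0 k) (Finset.Ico (n - l) n))
  simp only [Pi.add_apply] at s1 s2 s3
  have c1 : (Finset.Ico 0 k ∪ Finset.Ico 0 l).card = max k l := by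
    have : Finset.Ico 0 k ∪ Finset.Ico 0 l = Finset.Ico 0 (max k l) := by
      ext r; simp only [Finset.mem_union, Finset.mem_Ico]; omega
    rw [this, Nat.card_Ico, Nat.sub_zero]
  have c2 : (Finset.Ico (n - k) n ∪ Finset.Ico (n - l) n).card = max k l := by
    have : Finset.Ico (n - k) n ∪ Finset.Ico (n - l) n = Finset.Ico (n - max k l) n := by
      ext r; simp only [Finset.mem_union, Finset.mem_Ico]; omega
    rw [this, Nat.card_Ico]; omega
  have c3 : ∀ a b : ℕ, a ≤ n → b ≤ n → (Finset.Ico 0 a ∪ Finset.Ico (n - b) n).card =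
      min (a + b) n := by
    intro a b ha hb
    have hi : (Finset.Ico 0 a ∩ Finset.Ico (n - b) n).card = a + b - n := by
      have : Finset.Ico 0 a ∩ Finset.Ico (n - b) n = Finset.Ico (n - b) a := by
        ext r; simp only [Finset.mem_inter, Finset.mem_Ico]; omega
      rw [this, Nat.card_Ico]; omega
    -- the windows of the first `a` and the last `b` steps overlap when `a + b > n`
    rw [Finset.card_union, hi, Nat.card_Ico, Nat.card_Ico]
    omega
  rw [s1, s2, s3, h.integral_absence_mul, h.integral_absence_mul, h.integral_absence_mul,
    h.integral_absence_mul, c1, c2, c3 k l hk hl, Finset.union_comm (Finset.Ico (n - k) n),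
    c3 l k hl hk, card_last hk, card_last hl, Nat.card_Ico, Nat.card_Ico, Nat.sub_zero,
    Nat.sub_zero, add_comm l k]
  push_cast
  ring

/-- The contribution of the value `i` to the Poissonized linear part, up to normalization. -/
noncomputable def weightedAbsence (μ : Measure Ω) (X : ℕ → Ω → ℕ) (m : Measure I) (r : I → ℝ)
    (n i : ℕ) (z : Ω × (ℕ → ℕ)) : ℝ :=
  ∫ t : I, absencePair μ X n (timeIndex n t) i z * r t ∂m

variable {m : Measure I} [IsFiniteMeasure m] {r : I → ℝ}

lemma abs_weightedAbsence_le (hr : Integrable r m) (n i : ℕ) (z : Ω × (ℕ → ℕ)) :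
    |weightedAbsence μ X m r n i z| ≤ 2 * ∫ t, |r t| ∂m := by
  rw [← integral_const_mul]
  refine (abs_integral_le_integral_abs).trans (integral_mono_of_nonneg
    (Eventually.of_forall fun _ => abs_nonneg _) (hr.abs.const_mul 2)
    (Eventually.of_forall fun t => ?_))
  dsimp only
  rw [abs_mul, absencePair]
  refine mul_le_mul_of_nonneg_right ((abs_add_le _ _).trans ?_) (abs_nonneg _)
  linarith [abs_absence_le (μ := μ) (X := X) i (Finset.Ico 0 (timeIndex n t)) z,
    abs_absence_le (μ := μ) (X := X) i (Finset.Ico (n - timeIndex n t) n) z]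

lemma weightedAbsence_eq_sum (hr : Integrable r m) (n i : ℕ) (z : Ω × (ℕ → ℕ)) :
    weightedAbsence μ X m r n i z =
      ∑ k ∈ Finset.range (n + 1), absencePair μ X n k i z * stepWeight m r n k :=
  integral_comp_timeIndex hr n fun k => absencePair μ X n k i z

lemma measurable_weightedAbsence_missField (hr : Integrable r m) (n i : ℕ) :
    Measurable[missField X i] (weightedAbsence μ X m r n i) := by
  have : weightedAbsence μ X m r n i = fun z =>
      ∑ k ∈ Finset.range (n + 1), absencePair μ X n k i z * stepWeight m r n k :=
    funext fun z => weightedAbsence_eq_sum hr n i z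
  rw [this]
  refine Finset.measurable_fun_sum _ fun k _ => Measurable.mul_const ?_ _
  exact (measurable_absence_missField i _).add (measurable_absence_missField i _)

lemma IsSample.integrable_absencePair (h : IsSample μ X) (n k i : ℕ) :
    Integrable (absencePair μ X n k i) (μ.prod stepLaw) :=
  (h.integrable_absence i _).add (h.integrable_absence i _)

lemma IsSample.measurable_absencePair (h : IsSample μ X) (n k i : ℕ) :
    Measurable (absencePair μ X n k i) :=
  (h.measurable_absence i _).add (h.measurable_absence i _)

lemma abs_absencePair_le (n k i : ℕ) (z : Ω × (ℕ → ℕ)) : |absencePair μ X n k i z| ≤ 2 := by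
  refine (abs_add_le _ _).trans ?_
  linarith [abs_absence_le (μ := μ) (X := X) i (Finset.Ico 0 k) z,
    abs_absence_le (μ := μ) (X := X) i (Finset.Ico (n - k) n) z]

lemma IsSample.measurable_weightedAbsence (h : IsSample μ X) (hr : Integrable r m) (n i : ℕ) :
    Measurable (weightedAbsence μ X m r n i) := by
  have : weightedAbsence μ X m r n i = fun z =>
      ∑ k ∈ Finset.range (n + 1), absencePair μ X n k i z * stepWeight m r n k :=
    funext fun z => weightedAbsence_eq_sum hr n i z
  rw [this]
  exact Finset.measurable_fun_sum _ fun k _ => (h.measurable_absencePair n k i).mul_const _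

lemma IsSample.integral_weightedAbsence (h : IsSample μ X) (hr : Integrable r m) (n i : ℕ) :
    ∫ z, weightedAbsence μ X m r n i z ∂(μ.prod stepLaw) = 0 := by
  simp_rw [weightedAbsence_eq_sum hr n i]
  rw [integral_finsetSum _ fun k _ => (h.integrable_absencePair n k i).mul_const _]
  refine Finset.sum_eq_zero fun k _ => ?_
  rw [integral_mul_const]
  simp only [absencePair]
  rw [integral_add (h.integrable_absence i _) (h.integrable_absence i _), h.integral_absence,
    h.integral_absence]
  simp

/-- The variances of the weighted absences of the values below `N`, summed up. -/
lemma IsSample.sum_integral_sq_weightedAbsence (h : IsSample μ X) (hr : Integrable r m) (n N : ℕ) :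
    ∑ i ∈ Finset.range N, ∫ z, weightedAbsence μ X m r n i z ^ 2 ∂(μ.prod stepLaw) =
      ∫ q : I × I, 2 * truncCov (freq μ X) N n (timeIndex n q.1) (timeIndex n q.2) *
        (r q.1 * r q.2) ∂(m.prod m) := by
  rw [integral_prod_comp_timeIndex hr n fun k l => 2 * truncCov (freq μ X) N n k l]
  have hint : ∀ i k l, Integrable (fun z => absencePair μ X n k i z * absencePair μ X n l i z)
      (μ.prod stepLaw) := fun i k l =>
    (h.integrable_absencePair n l i).bdd_mul (h.measurable_absencePair n k i).aestronglyMeasurable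
      (Eventually.of_forall fun z => abs_absencePair_le n k i z)
  have h1 : ∀ i, ∫ z, weightedAbsence μ X m r n i z ^ 2 ∂(μ.prod stepLaw) =
      ∑ k ∈ Finset.range (n + 1), ∑ l ∈ Finset.range (n + 1),
        (∫ z, absencePair μ X n k i z * absencePair μ X n l i z ∂(μ.prod stepLaw)) *
          (stepWeight m r n k * stepWeight m r n l) := by
    intro i
    have h2 : ∀ z, weightedAbsence μ X m r n i z ^ 2 =
        ∑ k ∈ Finset.range (n + 1), ∑ l ∈ Finset.range (n + 1),
          (absencePair μ X n k i z * absencePair μ X n l i z) *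
            (stepWeight m r n k * stepWeight m r n l) := by
      intro z
      rw [weightedAbsence_eq_sum hr, sq, Finset.sum_mul_sum]
      refine Finset.sum_congr rfl fun k _ => Finset.sum_congr rfl fun l _ => ?_
      ring
    simp_rw [h2]
    rw [integral_finsetSum _ fun k _ => integrable_finsetSum _ fun l _ =>
      (hint i k l).mul_const _]
    refine Finset.sum_congr rfl fun k _ => ?_
    rw [integral_finsetSum _ fun l _ => (hint i k l).mul_const _]
    refine Finset.sum_congr rfl fun l _ => ?_
    rw [integral_mul_const]
  simp_rw [h1]
  rw [Finset.sum_comm]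
  refine Finset.sum_congr rfl fun k hk => ?_
  rw [Finset.sum_comm]
  refine Finset.sum_congr rfl fun l hl => ?_
  rw [← Finset.sum_mul]
  congr 1
  have hk' := Nat.lt_succ_iff.1 (Finset.mem_range.1 hk)
  have hl' := Nat.lt_succ_iff.1 (Finset.mem_range.1 hl)
  simp_rw [h.integral_absencePair_mul hk' hl']
  rw [← Finset.mul_sum, Finset.sum_sub_distrib, Finset.sum_sub_distrib, ← Finset.mul_sum]
  rfl

/-- Coupling of the count in a window of observations with the truncated Poissonized count. -/
lemma distinct_sub_add_sum_absence (a b N : ℕ) (z : Ω × (ℕ → ℕ)) :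
    (distinct X (Finset.Ico a b) z.1 : ℝ) - meanFn (freq μ X) (b - a) +
        ∑ i ∈ Finset.range N, absence μ X i (Finset.Ico a b) z =
      ((distinct X (Finset.Ico a b) z.1 : ℝ) -
        distinct X (Finset.Ico (cum z.2 a) (cum z.2 b)) z.1) +
      ((distinct X (Finset.Ico (cum z.2 a) (cum z.2 b)) z.1 : ℝ) -
        ∑ i ∈ Finset.range N, (1 - (miss X i (Finset.Ico a b)).indicator (1 : Ω × (ℕ → ℕ) → ℝ) z)) +
      (truncMean (freq μ X) N (b - a : ℕ) - meanFn (freq μ X) (b - a)) := by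
  simp only [absence, truncMean, Finset.sum_sub_distrib, Nat.card_Ico]
  ring

lemma tendsto_sum_one_sub_miss {a b : ℕ} (hab : a ≤ b) (z : Ω × (ℕ → ℕ)) :
    Tendsto (fun N => ∑ i ∈ Finset.range N,
      (1 - (miss X i (Finset.Ico a b)).indicator (1 : Ω × (ℕ → ℕ) → ℝ) z)) atTop
      (𝓝 (distinct X (Finset.Ico (cum z.2 a) (cum z.2 b)) z.1 : ℝ)) ∧
    ∀ N, |(distinct X (Finset.Ico (cum z.2 a) (cum z.2 b)) z.1 : ℝ) - ∑ i ∈ Finset.range N,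
      (1 - (miss X i (Finset.Ico a b)).indicator (1 : Ω × (ℕ → ℕ) → ℝ) z)| ≤ cum z.2 b := by
  have h1 : ∀ i, 1 - (miss X i (Finset.Ico a b)).indicator (1 : Ω × (ℕ → ℕ) → ℝ) z =
      (hit X (Finset.Ico (cum z.2 a) (cum z.2 b)) i).indicator (1 : Ω → ℝ) z.1 := by
    intro i
    have := notMem_miss_Ico_iff (X := X) i hab z
    simp only [Set.indicator, Pi.one_apply, this]
    split_ifs <;> simp_all
  simp_rw [h1]
  refine ⟨tendsto_sum_hit _ _, fun N => ?_⟩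
  have h2 := sum_hit_le (X := X) (Finset.Ico (cum z.2 a) (cum z.2 b)) z.1 N
  have h3 := sum_hit_nonneg (X := X) (Finset.Ico (cum z.2 a) (cum z.2 b)) z.1 N
  rw [abs_of_nonneg (sub_nonneg.2 h2)]
  linarith [distinct_cum_le (X := X) a b z]

lemma IsSample.integrable_sub_sum_miss (h : IsSample μ X) {a b : ℕ} (hab : a ≤ b) (N : ℕ) :
    Integrable (fun z : Ω × (ℕ → ℕ) =>
      (distinct X (Finset.Ico (cum z.2 a) (cum z.2 b)) z.1 : ℝ) - ∑ i ∈ Finset.range N,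
      (1 - (miss X i (Finset.Ico a b)).indicator (1 : Ω × (ℕ → ℕ) → ℝ) z)) (μ.prod stepLaw) := by
  refine (integrable_cum_snd b).mono' ?_ (Eventually.of_forall fun z =>
    (tendsto_sum_one_sub_miss hab z).2 N)
  exact ((h.measurable_distinct_cum a b).sub (Finset.measurable_fun_sum _ fun i _ =>
    measurable_const.sub (measurable_one.indicator (h.measurableSet_miss i _)))).aestronglyMeasurable

/-- Disregarding the values from `N` on changes the counts of the Poissonized scheme up to time `n`,
and the expected counts up to time `2 n`, by at most one in mean. -/
structure IsCut (μ : Measure Ω) (X : ℕ → Ω → ℕ) (n N : ℕ) : Prop where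
  mean : ∀ k ≤ 2 * n, |truncMean (freq μ X) N k - poissonMean (freq μ X) k| ≤ 1
  count : ∀ a b : ℕ, a ≤ b → b ≤ n → ∫ z : Ω × (ℕ → ℕ),
    |(distinct X (Finset.Ico (cum z.2 a) (cum z.2 b)) z.1 : ℝ) - ∑ i ∈ Finset.range N,
      (1 - (miss X i (Finset.Ico a b)).indicator (1 : Ω × (ℕ → ℕ) → ℝ) z)| ∂(μ.prod stepLaw) ≤ 1

lemma IsSample.exists_cut (h : IsSample μ X) (n : ℕ) : ∃ N : ℕ, IsCut μ X n N := by
  have h1 : ∀ k ∈ Finset.range (2 * n + 1), ∀ᶠ N in atTop,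
      |truncMean (freq μ X) N k - poissonMean (freq μ X) k| ≤ 1 := by
    intro k _
    have ht : Tendsto (fun N => truncMean (freq μ X) N k) atTop (𝓝 (poissonMean (freq μ X) k)) :=
      (h.isWeight.summable_one_sub_exp (Nat.cast_nonneg k)).hasSum.tendsto_sum_nat
    have := (ht.sub_const (poissonMean (freq μ X) k)).abs
    rw [sub_self, abs_zero] at this
    exact (this.eventually (gt_mem_nhds one_pos)).mono fun N hN => hN.le
  have h2 : ∀ a ∈ Finset.range (n + 1), ∀ b ∈ Finset.range (n + 1), ∀ᶠ N : ℕ in atTop, a ≤ b →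
      ∫ z : Ω × (ℕ → ℕ),
        |(distinct X (Finset.Ico (cum z.2 a) (cum z.2 b)) z.1 : ℝ) - ∑ i ∈ Finset.range N,
          (1 - (miss X i (Finset.Ico a b)).indicator (1 : Ω × (ℕ → ℕ) → ℝ) z)|
            ∂(μ.prod stepLaw) ≤ 1 := by
    intro a _ b _
    by_cases hab : a ≤ b
    · have := tendsto_integral_of_dominated_convergence (μ := μ.prod stepLaw)
        (F := fun N z => |(distinct X (Finset.Ico (cum z.2 a) (cum z.2 b)) z.1 : ℝ) -
          ∑ i ∈ Finset.range N,
            (1 - (miss X i (Finset.Ico a b)).indicator (1 : Ω × (ℕ → ℕ) → ℝ) z)|)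
        (f := fun _ => 0) (fun z => (cum z.2 b : ℝ))
        (fun N => (h.integrable_sub_sum_miss hab N).abs.aestronglyMeasurable)
        (integrable_cum_snd b)
        (fun N => Eventually.of_forall fun z => by
          rw [Real.norm_eq_abs, abs_abs]
          exact (tendsto_sum_one_sub_miss hab z).2 N)
        (Eventually.of_forall fun z => by
          have := ((tendsto_sum_one_sub_miss (X := X) hab z).1.const_sub
            (distinct X (Finset.Ico (cum z.2 a) (cum z.2 b)) z.1 : ℝ)).abs
          rwa [sub_self, abs_zero] at this)
      rw [integral_zero] at this
      exact (this.eventually (gt_mem_nhds one_pos)).mono fun N hN _ => hN.le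
    · exact Eventually.of_forall fun N hab' => absurd hab' hab
  obtain ⟨N, hN1, hN2⟩ := (((Finset.range (2 * n + 1)).eventually_all.2 h1).and
    ((Finset.range (n + 1)).eventually_all.2 fun a ha =>
      (Finset.range (n + 1)).eventually_all.2 (h2 a ha))).exists
  refine ⟨N, fun k hk => hN1 k (Finset.mem_range.2 (Nat.lt_succ_of_le hk)), fun a b hab hb => ?_⟩
  exact hN2 a (Finset.mem_range.2 (Nat.lt_succ_of_le (hab.trans hb))) b
    (Finset.mem_range.2 (Nat.lt_succ_of_le hb)) hab

end Sample

section Sample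

variable {Ω : Type*} [MeasurableSpace Ω] {μ : Measure Ω} [IsProbabilityMeasure μ] {X : ℕ → Ω → ℕ}

/-- The error of the coupling in a single window: Poissonization contributes the first term, the
cut and the two comparisons of expectations contribute one each. -/
lemma IsSample.integral_abs_window_le (h : IsSample μ X) {a b n N : ℕ} (hN : IsCut μ X n N)
    (hab : a < b) (hb : b ≤ n) :
    Integrable (fun z : Ω × (ℕ → ℕ) => (distinct X (Finset.Ico a b) z.1 : ℝ) -
      meanFn (freq μ X) (b - a) + ∑ i ∈ Finset.range N, absence μ X i (Finset.Ico a b) z)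
      (μ.prod stepLaw) ∧
    ∫ z : Ω × (ℕ → ℕ), |(distinct X (Finset.Ico a b) z.1 : ℝ) -
      meanFn (freq μ X) (b - a) + ∑ i ∈ Finset.range N, absence μ X i (Finset.Ico a b) z|
      ∂(μ.prod stepLaw) ≤
      3 * (√a + √b) * meanFn (freq μ X) (b - a) / ((b - a : ℕ) : ℝ) + 3 := by
  obtain ⟨i1, hb1⟩ := h.integral_abs_poissonization_le hab.le
  have i2 := h.integrable_sub_sum_miss hab.le N
  have hb2 := hN.count a b hab.le hb
  have hpos : (0 : ℝ) < ((b - a : ℕ) : ℝ) := Nat.cast_pos.2 (Nat.sub_pos_of_lt hab)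
  have hc : |truncMean (freq μ X) N (b - a : ℕ) - meanFn (freq μ X) (b - a)| ≤ 2 := by
    have e1 := hN.mean (b - a) (by omega)
    have e2 := h.isWeight.abs_meanFn_sub_poissonMean_le (b - a)
    rw [abs_sub_comm] at e2
    have e3 := abs_add_le (truncMean (freq μ X) N (b - a : ℕ) -
      poissonMean (freq μ X) (b - a : ℕ))
      (poissonMean (freq μ X) (b - a : ℕ) - meanFn (freq μ X) (b - a))
    rw [sub_add_sub_cancel] at e3
    linarith
  simp_rw [distinct_sub_add_sum_absence]
  set c := truncMean (freq μ X) N (b - a : ℕ) - meanFn (freq μ X) (b - a)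
  have i3 := (i1.add i2).add (integrable_const (μ := μ.prod stepLaw) c)
  refine ⟨i3, ?_⟩
  refine (integral_mono i3.abs ((i1.abs.add i2.abs).add
    (integrable_const (μ := μ.prod stepLaw) |c|)) fun z => ?_).trans ?_
  · exact (abs_add_le _ _).trans (add_le_add_left (abs_add_le _ _) _)
  · have e1 := integral_add (i1.abs.add i2.abs) (integrable_const (μ := μ.prod stepLaw) |c|)
    have e2 := integral_add i1.abs i2.abs
    simp only [Pi.add_apply] at e1 e2
    simp only [Pi.add_apply]
    rw [e1, e2, integral_const, probReal_univ, one_smul]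
    rw [← le_div_iff₀' hpos] at hb1
    linarith

variable {m : Measure I} [IsFiniteMeasure m] {r : I → ℝ} {θ C δ : ℝ}

lemma IsSample.integrable_sum_absencePair (h : IsSample μ X) (n k N : ℕ) :
    Integrable (fun z => ∑ i ∈ Finset.range N, absencePair μ X n k i z) (μ.prod stepLaw) :=
  integrable_finsetSum _ fun i _ => h.integrable_absencePair n k i

lemma fluctuation_add_sum_absencePair {n k : ℕ} (hk : k ≤ n) (N : ℕ) (z : Ω × (ℕ → ℕ)) :
    fluctuation μ X n k z.1 +
        (∑ i ∈ Finset.range N, absencePair μ X n k i z) / (2 * √(meanFn (freq μ X) n)) =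
      (((distinct X (Finset.Ico 0 k) z.1 : ℝ) - meanFn (freq μ X) (k - 0) +
          ∑ i ∈ Finset.range N, absence μ X i (Finset.Ico 0 k) z) +
        ((distinct X (Finset.Ico (n - k) n) z.1 : ℝ) - meanFn (freq μ X) (n - (n - k)) +
          ∑ i ∈ Finset.range N, absence μ X i (Finset.Ico (n - k) n) z)) /
        (2 * √(meanFn (freq μ X) n)) := by
  rw [fluctuation, show Finset.range k = Finset.Ico 0 k from Finset.range_eq_Ico k, Nat.sub_zero, Nat.sub_sub_self hk]
  simp only [absencePair, Finset.sum_add_distrib]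
  ring

/-- Up to an error that vanishes in mean, the integrated fluctuations are a sum of independent
contributions of the values. -/
lemma IsSample.tendsto_coupling (h : IsSample μ X) (hp : PowerLaw (freq μ X) θ C) (hδ : 0 < δ)
    (hr : Integrable r m) (hm : ∀ᵐ t : I ∂m, δ ≤ (t : ℝ)) {N : ℕ → ℕ}
    (hN : ∀ n, IsCut μ X n (N n)) :
    (∀ n, Integrable (fun z : Ω × (ℕ → ℕ) =>
      (∫ t : I, fluctuation μ X n (timeIndex n t) z.1 * r t ∂m) -
        ∑ i ∈ Finset.range (N n),
          -(weightedAbsence μ X m r n i z / (2 * √(meanFn (freq μ X) n)))) (μ.prod stepLaw)) ∧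
    Tendsto (fun n => ∫ z : Ω × (ℕ → ℕ),
      |(∫ t : I, fluctuation μ X n (timeIndex n t) z.1 * r t ∂m) -
        ∑ i ∈ Finset.range (N n),
          -(weightedAbsence μ X m r n i z / (2 * √(meanFn (freq μ X) n)))| ∂(μ.prod stepLaw))
      atTop (𝓝 0) := by
  set M := meanFn (freq μ X) with hMdef
  set F : ℕ → ℕ → Ω × (ℕ → ℕ) → ℝ := fun n k z => fluctuation μ X n k z.1 +
    (∑ i ∈ Finset.range (N n), absencePair μ X n k i z) / (2 * √(M n)) with hF
  have hFi : ∀ n k, Integrable (F n k) (μ.prod stepLaw) := fun n k =>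
    ((h.integrable_fluctuation n k).comp_fst stepLaw).add
      ((h.integrable_sum_absencePair n k (N n)).div_const _)
  have heq : ∀ n z, (∫ t : I, fluctuation μ X n (timeIndex n t) z.1 * r t ∂m) -
      ∑ i ∈ Finset.range (N n), -(weightedAbsence μ X m r n i z / (2 * √(M n))) =
      ∫ t : I, F n (timeIndex n t) z * r t ∂m := by
    intro n z
    have e1 := integral_comp_timeIndex hr n fun k => fluctuation μ X n k z.1
    have e2 := integral_comp_timeIndex hr n fun k => F n k z
    rw [e1, e2]
    simp only [hF, weightedAbsence_eq_sum hr, add_mul, Finset.sum_add_distrib,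
      Finset.sum_neg_distrib, sub_neg_eq_add, ← Finset.sum_div]
    rw [Finset.sum_comm (s := Finset.range (N n)), Finset.sum_div]
    congr 1
    refine Finset.sum_congr rfl fun k _ => ?_
    rw [← Finset.sum_mul]
    ring
  simp_rw [heq]
  refine ⟨fun n => integrable_integral_comp_timeIndex hr n (hFi n), ?_⟩
  have hlim : Tendsto (fun n : ℕ => (12 / δ * √(M n / n) + 3 / √(M n)) * ∫ t, |r t| ∂m) atTop
      (𝓝 0) := by
    have e1 := (Real.continuous_sqrt.tendsto 0).comp hp.tendsto_meanFn_div
    rw [Real.sqrt_zero] at e1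
    have e2 := (Real.tendsto_sqrt_atTop.comp hp.tendsto_meanFn).const_div_atTop 3
    simpa using ((e1.const_mul (12 / δ)).add e2).mul_const (∫ t, |r t| ∂m)
  refine squeeze_zero' (Eventually.of_forall fun n => integral_nonneg fun z => abs_nonneg _) ?_ hlim
  filter_upwards [hp.eventually_index hδ, eventually_ge_atTop 1] with n hidx hn1
  have hM0 : 0 < M n := zero_lt_one.trans_le (hp.weight.one_le_meanFn hn1)
  have hs0 : 0 < √(M n) := Real.sqrt_pos.2 hM0
  have hn0 : (0 : ℝ) < n := Nat.cast_pos.2 hn1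
  have hsn : 0 < √(n : ℝ) := Real.sqrt_pos.2 hn0
  refine integral_abs_integral_comp_timeIndex_le hr hm n (hFi n) (by positivity) fun k hk hnk => ?_
  obtain ⟨hk1, hk2, -⟩ := hidx k hk hnk
  obtain ⟨i1, b1⟩ := h.integral_abs_window_le (hN n) (show 0 < k by omega) hk
  obtain ⟨i2, b2⟩ := h.integral_abs_window_le (hN n) (show n - k < n by omega) le_rfl
  simp only [hF]
  rw [integral_congr_ae (Eventually.of_forall fun z => congrArg abs
    (fluctuation_add_sum_absencePair (μ := μ) (X := X) hk (N n) z))]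
  set T₁ : Ω × (ℕ → ℕ) → ℝ := fun z => (distinct X (Finset.Ico 0 k) z.1 : ℝ) -
    meanFn (freq μ X) (k - 0) + ∑ i ∈ Finset.range (N n), absence μ X i (Finset.Ico 0 k) z
  set T₂ : Ω × (ℕ → ℕ) → ℝ := fun z => (distinct X (Finset.Ico (n - k) n) z.1 : ℝ) -
    meanFn (freq μ X) (n - (n - k)) +
      ∑ i ∈ Finset.range (N n), absence μ X i (Finset.Ico (n - k) n) z
  have hkpos : (0 : ℝ) < n * (δ / 2) := by positivity
  have hbound : ∀ a b : ℝ, 0 ≤ a → a ≤ n → 0 ≤ b → b ≤ n →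
      3 * (√a + √b) * M k / (k : ℝ) + 3 ≤ 12 / δ * (√n * M n / n) + 3 := by
    intro a b ha han hb hbn
    have e1 : √a ≤ √n := Real.sqrt_le_sqrt han
    have e2 : √b ≤ √n := Real.sqrt_le_sqrt hbn
    have e3 : M k ≤ M n := hp.weight.meanFn_mono hk
    have e4 : 0 ≤ M k := hp.weight.meanFn_nonneg k
    have : 3 * (√a + √b) * M k / (k : ℝ) ≤ 3 * (√n + √n) * M n / (n * (δ / 2)) := by gcongr
    refine add_le_add_left (this.trans_eq ?_) 3
    field_simp
    ring
  have hkn : (k : ℝ) ≤ n := Nat.cast_le.2 hk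
  have B1 : ∫ z, |T₁ z| ∂(μ.prod stepLaw) ≤ 12 / δ * (√n * M n / n) + 3 := by
    refine b1.trans ?_
    have := hbound 0 k le_rfl hn0.le (Nat.cast_nonneg k) hkn
    simpa using this
  have B2 : ∫ z, |T₂ z| ∂(μ.prod stepLaw) ≤ 12 / δ * (√n * M n / n) + 3 := by
    refine b2.trans ?_
    rw [Nat.sub_sub_self hk]
    exact hbound (n - k : ℕ) n (Nat.cast_nonneg _) (Nat.cast_le.2 (Nat.sub_le n k)) hn0.le le_rfl
  calc ∫ z, |(T₁ z + T₂ z) / (2 * √(M n))| ∂(μ.prod stepLaw)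
      ≤ ∫ z, (|T₁ z| + |T₂ z|) / (2 * √(M n)) ∂(μ.prod stepLaw) := by
        refine integral_mono ((i1.add i2).div_const _).abs ((i1.abs.add i2.abs).div_const _)
          fun z => ?_
        dsimp only
        rw [abs_div, abs_of_pos (show 0 < 2 * √(M n) by positivity)]
        gcongr
        exact abs_add_le _ _
    _ = (∫ z, |T₁ z| ∂(μ.prod stepLaw) + ∫ z, |T₂ z| ∂(μ.prod stepLaw)) / (2 * √(M n)) := by
        rw [integral_div]
        congr 1
        exact integral_add i1.abs i2.abs
    _ ≤ ((12 / δ * (√n * M n / n) + 3) + (12 / δ * (√n * M n / n) + 3)) / (2 * √(M n)) := by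
        gcongr
    _ = 12 / δ * √(M n / n) + 3 / √(M n) := by
        rw [Real.sqrt_div hM0.le]
        have e1 : M n = √(M n) * √(M n) := (Real.mul_self_sqrt hM0.le).symm
        have e2 : (n : ℝ) = √n * √n := (Real.mul_self_sqrt hn0.le).symm
        have e3 : √(n : ℝ) * M n / n = √(M n) * (√(M n) / √n) := by
          rw [div_eq_iff hn0.ne']
          conv_lhs => rw [e1]
          conv_rhs => rw [e2, Real.sqrt_mul_self hsn.le]
          field_simp
        rw [e3]
        field_simp
        ring

end Sample

section Sample

variable {Ω : Type*} [MeasurableSpace Ω] {μ : Measure Ω} [IsProbabilityMeasure μ] {X : ℕ → Ω → ℕ}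
  {m : Measure I} [IsFiniteMeasure m] {r : I → ℝ} {θ C δ : ℝ} {N : ℕ → ℕ}

lemma PowerLaw.tendsto_truncMean (hp : PowerLaw (freq μ X) θ C) (hN : ∀ n, IsCut μ X n (N n))
    {x : ℕ → ℕ} (hx : ∀ n, x n ≤ 2 * n) {u : ℝ}
    (hxu : Tendsto (fun n => (x n : ℝ) / n) atTop (𝓝 u)) :
    Tendsto (fun n => truncMean (freq μ X) (N n) (x n) / meanFn (freq μ X) n) atTop
      (𝓝 (u ^ θ)) := by
  obtain ⟨K, -, hK⟩ := hp.poisson 1 one_pos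
  refine hp.tendsto_div_meanFn (K := K + 1) (fun n => Nat.cast_nonneg (x n)) hxu
    (Eventually.of_forall fun n => ?_)
  have h1 := (hN n).mean (x n) (hx n)
  have h2 := hK (x n) (Nat.cast_nonneg _)
  have h3 := abs_add_le (truncMean (freq μ X) (N n) (x n) - poissonMean (freq μ X) (x n))
    (poissonMean (freq μ X) (x n) - C * (x n : ℝ) ^ θ)
  rw [sub_add_sub_cancel] at h3
  linarith

lemma PowerLaw.tendsto_truncCov (hp : PowerLaw (freq μ X) θ C) (hN : ∀ n, IsCut μ X n (N n))
    (s t : I) :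
    Tendsto (fun n => truncCov (freq μ X) (N n) n (timeIndex n s) (timeIndex n t) /
      meanFn (freq μ X) n) atTop (𝓝 (totalCov θ s t)) := by
  have hs := tendsto_timeIndex_div s
  have ht := tendsto_timeIndex_div t
  have hle : ∀ n, timeIndex n s ≤ n ∧ timeIndex n t ≤ n := fun n =>
    ⟨timeIndex_le n s, timeIndex_le n t⟩
  have hsum : Tendsto (fun n : ℕ => ((timeIndex n s : ℝ) + timeIndex n t) / n) atTop
      (𝓝 ((s : ℝ) + t)) := by
    simpa only [add_div] using hs.add ht
  have e1 := hp.tendsto_truncMean hN (x := fun n => timeIndex n s + timeIndex n t)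
    (fun n => by have := hle n; omega) (by simpa only [Nat.cast_add] using hsum)
  have e2 := hp.tendsto_truncMean hN (x := fun n => max (timeIndex n s) (timeIndex n t))
    (fun n => by have := hle n; omega) (u := max (s : ℝ) t) (by
      refine (hs.max ht).congr fun n => ?_
      rw [Nat.cast_max, max_div_div_right (Nat.cast_nonneg n)])
  have e3 := hp.tendsto_truncMean hN (x := fun n => min (timeIndex n s + timeIndex n t) n)
    (fun n => by omega) (u := min ((s : ℝ) + t) 1) (by
      refine (hsum.min tendsto_const_nhds).congr' ?_
      filter_upwards [eventually_gt_atTop 0] with n hn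
      rw [Nat.cast_min, Nat.cast_add, ← min_div_div_right (Nat.cast_nonneg n),
        div_self (Nat.cast_ne_zero.2 hn.ne')])
  refine (((e1.const_mul 2).sub e2).sub e3).congr fun n => ?_
  rw [truncCov]
  push_cast
  ring

/-- The variances of the independent contributions add up to the variance of the limit. -/
lemma IsSample.tendsto_sum_variance (h : IsSample μ X) (hp : PowerLaw (freq μ X) θ C)
    (hr : Integrable r m) (hN : ∀ n, IsCut μ X n (N n)) :
    Tendsto (fun n => ∑ i ∈ Finset.range (N n), ∫ z : Ω × (ℕ → ℕ),
      (-(weightedAbsence μ X m r n i z / (2 * √(meanFn (freq μ X) n)))) ^ 2 ∂(μ.prod stepLaw))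
      atTop (𝓝 (1 / 2 * ∫ q : I × I, totalCov θ q.1 q.2 * (r q.1 * r q.2) ∂(m.prod m))) := by
  set M := meanFn (freq μ X) with hMdef
  have heq : ∀ n, ∑ i ∈ Finset.range (N n), ∫ z : Ω × (ℕ → ℕ),
      (-(weightedAbsence μ X m r n i z / (2 * √(M n)))) ^ 2 ∂(μ.prod stepLaw) =
      1 / 2 * ∫ q : I × I, truncCov (freq μ X) (N n) n (timeIndex n q.1) (timeIndex n q.2) / M n *
        (r q.1 * r q.2) ∂(m.prod m) := by
    intro n
    have hs : √(M n) ^ 2 = M n := Real.sq_sqrt (hp.weight.meanFn_nonneg n)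
    have e1 : ∀ (i : ℕ) (z : Ω × (ℕ → ℕ)), (-(weightedAbsence μ X m r n i z / (2 * √(M n)))) ^ 2 =
        weightedAbsence μ X m r n i z ^ 2 * (4 * M n)⁻¹ := by
      intro i z
      rw [neg_sq, div_pow, mul_pow, hs, div_eq_mul_inv]
      norm_num
    simp_rw [e1, integral_mul_const]
    rw [← Finset.sum_mul, h.sum_integral_sq_weightedAbsence hr, ← integral_mul_const,
      ← integral_const_mul]
    refine integral_congr_ae (Eventually.of_forall fun q => ?_)
    dsimp only
    rw [mul_inv]
    ring
  simp_rw [heq]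
  refine Tendsto.const_mul _ ?_
  have hbd : ∀ᶠ n in atTop, truncMean (freq μ X) (N n) ((2 * n : ℕ) : ℝ) / M n < 2 ^ θ + 1 := by
    have h2 : Tendsto (fun n : ℕ => ((2 * n : ℕ) : ℝ) / n) atTop (𝓝 2) := by
      refine tendsto_const_nhds.congr' ?_
      filter_upwards [eventually_gt_atTop 0] with n hn
      have : (n : ℝ) ≠ 0 := Nat.cast_ne_zero.2 hn.ne'
      push_cast
      field_simp
    exact (hp.tendsto_truncMean hN (fun n => le_rfl) h2).eventually (gt_mem_nhds (lt_add_one _))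
  refine tendsto_integral_filter_of_dominated_convergence
    (fun q => 2 * ((2 : ℝ) ^ θ + 1) * |r q.1 * r q.2|) (Eventually.of_forall fun n => ?_) ?_
    ((hr.mul_prod hr).abs.const_mul _) (Eventually.of_forall fun q => ?_)
  · refine AEStronglyMeasurable.mul ?_ (hr.mul_prod hr).aestronglyMeasurable
    exact ((Measurable.of_discrete (f := fun x : ℕ × ℕ =>
      truncCov (freq μ X) (N n) n x.1 x.2 / M n)).comp
        (((measurable_timeIndex n).comp measurable_fst).prodMk
          ((measurable_timeIndex n).comp measurable_snd))).aestronglyMeasurable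
  · filter_upwards [hbd, eventually_ge_atTop 1] with n hn hn1
    refine Eventually.of_forall fun q => ?_
    have hM0 : 0 < M n := zero_lt_one.trans_le (hp.weight.one_le_meanFn hn1)
    rw [norm_mul, Real.norm_eq_abs, Real.norm_eq_abs]
    refine mul_le_mul_of_nonneg_right ?_ (abs_nonneg _)
    have hmono := truncMean_mono (p := freq μ X) (fun i => freq_nonneg i) (N n)
    have hpos : ∀ x : ℝ, 0 ≤ x → 0 ≤ truncMean (freq μ X) (N n) x := fun x hx =>
      Finset.sum_nonneg fun i _ => one_sub_exp_nonneg (mul_nonneg hx (freq_nonneg i))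
    have k1 : (timeIndex n q.1 : ℝ) ≤ n := Nat.cast_le.2 (timeIndex_le n _)
    have k2 : (timeIndex n q.2 : ℝ) ≤ n := Nat.cast_le.2 (timeIndex_le n _)
    have k3 : (0 : ℝ) ≤ timeIndex n q.1 := Nat.cast_nonneg _
    have k4 : (0 : ℝ) ≤ timeIndex n q.2 := Nat.cast_nonneg _
    have hle : ∀ x : ℝ, x ≤ 2 * n →
        truncMean (freq μ X) (N n) x ≤ truncMean (freq μ X) (N n) ((2 * n : ℕ) : ℝ) := fun x hx =>
      hmono (by push_cast; exact hx)
    have a1 := hle (timeIndex n q.1 + timeIndex n q.2) (by linarith)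
    have a2 := hle (max (timeIndex n q.1) (timeIndex n q.2)) (max_le (by linarith) (by linarith))
    have a3 := hle (min ((timeIndex n q.1 : ℝ) + timeIndex n q.2) n)
      ((min_le_left _ _).trans (by linarith))
    have b1 := hpos (timeIndex n q.1 + timeIndex n q.2) (by linarith)
    have b2 := hpos (max (timeIndex n q.1) (timeIndex n q.2)) (k3.trans (le_max_left _ _))
    have b3 := hpos (min ((timeIndex n q.1 : ℝ) + timeIndex n q.2) n)
      (le_min (by linarith) (Nat.cast_nonneg n))
    rw [abs_div, abs_of_pos hM0, div_le_iff₀ hM0]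
    rw [div_lt_iff₀ hM0] at hn
    rw [truncCov, abs_le]
    constructor <;> linarith
  · exact (hp.tendsto_truncCov hN q.1 q.2).mul_const _

/-- Characteristic functions are Lipschitz for the distance in mean. -/
lemma norm_charFun_map_sub_le {Ω : Type*} [MeasurableSpace Ω] {P : Measure Ω}
    [IsProbabilityMeasure P] {A B : Ω → ℝ} (hA : AEMeasurable A P) (hB : AEMeasurable B P)
    (hAB : Integrable (fun ω => A ω - B ω) P) (s : ℝ) :
    ‖charFun (P.map A) s - charFun (P.map B) s‖ ≤ |s| * ∫ ω, |A ω - B ω| ∂P := by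
  have hcf : ∀ {F : Ω → ℝ}, AEMeasurable F P →
      charFun (P.map F) s = ∫ ω, Complex.exp (Complex.I * (s * F ω : ℝ)) ∂P ∧
      Integrable (fun ω => Complex.exp (Complex.I * (s * F ω : ℝ))) P := by
    intro F hF
    have hc : Continuous fun x : ℝ => Complex.exp (Complex.I * (s * x : ℝ)) := by fun_prop
    constructor
    · rw [charFun_apply_real, integral_map hF (by fun_prop)]
      refine integral_congr_ae (Eventually.of_forall fun ω => ?_)
      dsimp only
      push_cast
      ring_nf
    · refine Integrable.of_bound (hc.measurable.comp_aemeasurable hF).aestronglyMeasurable 1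
        (Eventually.of_forall fun ω => ?_)
      rw [mul_comm, Complex.norm_exp_ofReal_mul_I]
  rw [(hcf hA).1, (hcf hB).1, ← integral_sub (hcf hA).2 (hcf hB).2, ← integral_const_mul]
  refine norm_integral_le_of_norm_le (hAB.abs.const_mul _) (Eventually.of_forall fun ω => ?_)
  have e1 : Complex.exp (Complex.I * (s * A ω : ℝ)) - Complex.exp (Complex.I * (s * B ω : ℝ)) =
      Complex.exp (Complex.I * (s * B ω : ℝ)) *
        (Complex.exp (Complex.I * (s * (A ω - B ω) : ℝ)) - 1) := by
    rw [mul_sub, ← Complex.exp_add, mul_one]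
    congr 2
    push_cast
    ring
  rw [e1, norm_mul, mul_comm Complex.I, Complex.norm_exp_ofReal_mul_I, one_mul, ← abs_mul,
    ← Real.norm_eq_abs]
  exact Real.norm_exp_I_mul_ofReal_sub_one_le

/-- The characteristic functions of the integrated fluctuations converge to that of a centered
normal law. -/
lemma IsSample.tendsto_charFun_fluctuation (h : IsSample μ X) (hp : PowerLaw (freq μ X) θ C)
    (hδ : 0 < δ) (hr : Integrable r m) (hm : ∀ᵐ t : I ∂m, δ ≤ (t : ℝ)) (s : ℝ) :
    Tendsto (fun n => charFun (μ.map fun ω =>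
      ∫ t : I, fluctuation μ X n (timeIndex n t) ω * r t ∂m) s) atTop
      (𝓝 (Real.exp (-(s ^ 2 *
        (1 / 2 * ∫ q : I × I, totalCov θ q.1 q.2 * (r q.1 * r q.2) ∂(m.prod m)) / 2)) : ℂ)) := by
  choose N hN using h.exists_cut
  set M := meanFn (freq μ X) with hMdef
  set L : ℕ → Ω → ℝ := fun n ω => ∫ t : I, fluctuation μ X n (timeIndex n t) ω * r t ∂m with hL
  set U : ℕ → ℕ → Ω × (ℕ → ℕ) → ℝ := fun n i z =>
    -(weightedAbsence μ X m r n i z / (2 * √(M n))) with hU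
  obtain ⟨hi, hcoup⟩ := h.tendsto_coupling hp hδ hr hm hN
  have hvar := h.tendsto_sum_variance hp hr hN
  rw [← hMdef] at hcoup hvar
  have hLi : ∀ n, Integrable (L n) μ := fun n =>
    integrable_integral_comp_timeIndex hr n (h.integrable_fluctuation n)
  have hUm : ∀ n i, Measurable (U n i) := fun n i =>
    ((h.measurable_weightedAbsence hr n i).div_const _).neg
  have hmap : ∀ n, (μ.prod stepLaw).map (fun z => L n z.1) = μ.map (L n) := by
    intro n
    have h1 := AEMeasurable.map_map_of_aemeasurable (μ := μ.prod stepLaw) (f := Prod.fst) (g := L n)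
      (by rw [measurePreserving_fst.map_eq]; exact (hLi n).aemeasurable) measurable_fst.aemeasurable
    rw [measurePreserving_fst.map_eq] at h1
    exact h1.symm
  set v := ∫ t, |r t| ∂m with hv
  set b : ℕ → ℝ := fun n => v / √(M n) with hb
  have hb0 : Tendsto b atTop (𝓝 0) :=
    (Real.tendsto_sqrt_atTop.comp hp.tendsto_meanFn).const_div_atTop v
  -- passing to the sum of independent variables
  have d1 : Tendsto (fun n => charFun (μ.map (L n)) s -
      charFun ((μ.prod stepLaw).map fun z => ∑ i ∈ Finset.range (N n), U n i z) s) atTop (𝓝 0) := by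
    have e1 := hcoup.const_mul |s|
    rw [mul_zero] at e1
    refine squeeze_zero_norm (fun n => ?_) e1
    rw [← hmap n]
    exact norm_charFun_map_sub_le ((hLi n).comp_fst stepLaw).aemeasurable
      (Finset.aemeasurable_fun_sum _ fun i _ => (hUm n i).aemeasurable) (hi n) s
  -- passing to the Gaussian law with the same variance
  have d2 : Tendsto (fun n => charFun ((μ.prod stepLaw).map fun z =>
      ∑ i ∈ Finset.range (N n), U n i z) s - (Real.exp (-(s ^ 2 *
        (∑ i ∈ Finset.range (N n), ∫ z, U n i z ^ 2 ∂(μ.prod stepLaw)) / 2)) : ℂ)) atTop (𝓝 0) := by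
    have e1 : Tendsto (fun n => (|s| ^ 3 * b n + s ^ 4 * b n ^ 2) *
        ∑ i ∈ Finset.range (N n), ∫ z, U n i z ^ 2 ∂(μ.prod stepLaw)) atTop (𝓝 0) := by
      have e := ((hb0.const_mul (|s| ^ 3)).add ((hb0.pow 2).const_mul (s ^ 4))).mul hvar
      simp only [mul_zero, zero_pow two_ne_zero, add_zero, zero_mul] at e
      exact e
    refine squeeze_zero_norm' ?_ e1
    have e2 := hb0.const_mul |s|
    rw [mul_zero] at e2
    filter_upwards [e2.eventually (gt_mem_nhds one_pos), eventually_ge_atTop 1] with n hn hn1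
    have hs0 : 0 < √(M n) :=
      Real.sqrt_pos.2 (zero_lt_one.trans_le (hp.weight.one_le_meanFn hn1))
    refine norm_charFun_sum_sub_le (Finset.range (N n)) (fun i => (hUm n i).aemeasurable)
      (h.iIndepFun_of_missField fun i => ?_) (fun i z => ?_) (fun i => ?_) hn.le
    · exact ((measurable_weightedAbsence_missField hr n i).div_const _).neg
    · simp only [hU, hb]
      rw [abs_neg, abs_div, abs_of_pos (show 0 < 2 * √(M n) by positivity),
        div_le_div_iff₀ (by positivity) hs0]
      have := mul_le_mul_of_nonneg_right (abs_weightedAbsence_le (μ := μ) (X := X) hr n i z) hs0.le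
      linarith
    · simp only [hU]
      rw [integral_neg, integral_div, h.integral_weightedAbsence hr]
      simp
  have d3 : Tendsto (fun n => (Real.exp (-(s ^ 2 *
      (∑ i ∈ Finset.range (N n), ∫ z, U n i z ^ 2 ∂(μ.prod stepLaw)) / 2)) : ℂ)) atTop
      (𝓝 (Real.exp (-(s ^ 2 * (1 / 2 * ∫ q : I × I, totalCov θ q.1 q.2 * (r q.1 * r q.2)
        ∂(m.prod m)) / 2)) : ℂ)) :=
    (Complex.continuous_ofReal.tendsto _).comp
      ((Real.continuous_exp.tendsto _).comp ((hvar.const_mul (s ^ 2)).div_const 2).neg)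
  have := (d1.add d2).add d3
  simpa using this

end Sample

/-! ### Consistency and asymptotic normality -/

section Sample

variable {Ω : Type*} [MeasurableSpace Ω] {μ : Measure Ω} [IsProbabilityMeasure μ] {X : ℕ → Ω → ℕ}
  {m : Measure I} [IsFiniteMeasure m] {h r : I → ℝ} {θ C δ : ℝ}

lemma tendstoInMeasure_of_tendsto_integral_abs {Y : ℕ → Ω → ℝ} {a : ℝ}
    (hY : ∀ n, Integrable (Y n) μ)
    (hlim : Tendsto (fun n => ∫ ω, |Y n ω - a| ∂μ) atTop (𝓝 0)) :
    TendstoInMeasure μ Y atTop fun _ => a := by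
  refine tendstoInMeasure_of_tendsto_eLpNorm one_ne_zero (fun n => (hY n).aestronglyMeasurable)
    aestronglyMeasurable_const ?_
  have h1 : ∀ n, eLpNorm (Y n - fun _ => a) 1 μ = ENNReal.ofReal (∫ ω, |Y n ω - a| ∂μ) := fun n => by
    rw [eLpNorm_one_eq_lintegral_enorm]
    exact (ofReal_integral_norm_eq_lintegral_enorm ((hY n).sub (integrable_const a))).symm
  simp_rw [h1]
  simpa using ENNReal.tendsto_ofReal hlim

lemma IsSample.integrable_linearPart (hX : IsSample μ X)
    (hr : Integrable (fun t : I => (t : ℝ) ^ (-θ) * h t) m) (n : ℕ) :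
    Integrable (linearPart μ X θ m h n) μ :=
  integrable_integral_comp_timeIndex hr n (hX.integrable_fluctuation n)

lemma IsSample.integrable_logMean (hX : IsSample μ X) (hh : Integrable h m) (n : ℕ) :
    Integrable (logMean X m h n) μ :=
  ((integrable_integral_comp_timeIndex hh n fun k =>
      hX.integrable_comp_distinct (Finset.range k) fun j => Real.posLog j).add
    (integrable_integral_comp_timeIndex hh n fun k =>
      hX.integrable_comp_distinct (Finset.Ico (n - k) n) fun j => Real.posLog j)).div_const 2

/-- Consistency: the scaled error is bounded in mean, and the scale tends to infinity. -/
lemma IsSample.tendsto_integral_abs_logMean_sub (hX : IsSample μ X) (hp : PowerLaw (freq μ X) θ C)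
    (hδ : 0 < δ) (hh : Measurable h) (habs : ∀ t, |h t| = 1) (hm : ∀ᵐ t : I ∂m, δ ≤ (t : ℝ))
    (h0 : ∫ t, h t ∂m = 0) (hlog : ∫ t : I, Real.log t * h t ∂m = 1) :
    Tendsto (fun n => ∫ ω, |logMean X m h n ω - θ| ∂μ) atTop (𝓝 0) := by
  have hr := integrable_rpow_mul_sign hp.exponent.1 hδ hh habs hm
  have hi := integrable_sign (m := m) hh habs
  set v := ∫ t : I, |(t : ℝ) ^ (-θ) * h t| ∂m with hv
  have hlim := ((hX.tendsto_linearization hp hδ hh habs hm h0 hlog).add_const v).div_atTop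
    (Real.tendsto_sqrt_atTop.comp hp.tendsto_meanFn)
  refine squeeze_zero' (Eventually.of_forall fun n => integral_nonneg fun ω => abs_nonneg _) ?_ hlim
  filter_upwards [eventually_ge_atTop 1] with n hn1
  have hs0 : 0 < √(meanFn (freq μ X) n) :=
    Real.sqrt_pos.2 (zero_lt_one.trans_le (hp.weight.one_le_meanFn hn1))
  simp only [Function.comp]
  set s := √(meanFn (freq μ X) n) with hs
  have hE : Integrable (fun ω => logMean X m h n ω - θ) μ :=
    (hX.integrable_logMean hi n).sub (integrable_const θ)
  have hL := hX.integrable_linearPart hr n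
  have hD := (hE.const_mul s).sub hL
  have hLb : ∫ ω, |linearPart μ X θ m h n ω| ∂μ ≤ v := by
    have := integral_abs_integral_comp_timeIndex_le hr hm n (hX.integrable_fluctuation n)
      zero_le_one fun k hk _ => hX.integral_abs_fluctuation_le hk
    rwa [one_mul] at this
  have e1 := integral_add hD.abs hL.abs
  simp only [Pi.sub_apply] at e1
  rw [le_div_iff₀ hs0, ← integral_mul_const]
  calc ∫ ω, |logMean X m h n ω - θ| * s ∂μ
      ≤ ∫ ω, (|s * (logMean X m h n ω - θ) - linearPart μ X θ m h n ω| +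
          |linearPart μ X θ m h n ω|) ∂μ := by
        refine integral_mono (hE.abs.mul_const s) (hD.abs.add hL.abs) fun ω => ?_
        have := abs_add_le (s * (logMean X m h n ω - θ) - linearPart μ X θ m h n ω)
          (linearPart μ X θ m h n ω)
        rw [sub_add_cancel, abs_mul, abs_of_pos hs0, mul_comm] at this
        exact this
    _ ≤ _ := by
        rw [e1]
        exact add_le_add_right hLb _

lemma IsSample.tendstoInDistribution_linearPart (hX : IsSample μ X)
    (hp : PowerLaw (freq μ X) θ C) (hδ : 0 < δ)
    (hr : Integrable (fun t : I => (t : ℝ) ^ (-θ) * h t) m) (hm : ∀ᵐ t : I ∂m, δ ≤ (t : ℝ))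
    {v : ℝ} (hv0 : 0 ≤ v) (hv : v = 1 / 2 * ∫ q : I × I, totalCov θ q.1 q.2 *
      (((q.1 : ℝ) ^ (-θ) * h q.1) * ((q.2 : ℝ) ^ (-θ) * h q.2)) ∂(m.prod m)) :
    TendstoInDistribution (linearPart μ X θ m h) atTop (id : ℝ → ℝ) (fun _ => μ)
      (gaussianReal 0 v.toNNReal) where
  forall_aemeasurable n := (hX.integrable_linearPart hr n).aemeasurable
  aemeasurable_limit := aemeasurable_id
  tendsto := by
    refine ProbabilityMeasure.tendsto_iff_tendsto_charFun.2 fun s => ?_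
    have h1 := hX.tendsto_charFun_fluctuation hp hδ hr hm s
    rw [← hv] at h1
    have h2 : charFun ((gaussianReal 0 v.toNNReal).map id) s = (Real.exp (-(s ^ 2 * v / 2)) : ℂ) := by
      rw [Measure.map_id, charFun_gaussianReal, Real.coe_toNNReal v hv0]
      push_cast
      ring_nf
    rw [← h2] at h1
    exact h1

lemma meanCount_eq (hX : IsSample μ X) (k : ℕ) : meanCount μ X k = meanFn (freq μ X) k := by
  have := hX.integral_distinct (Finset.range k)
  rw [Finset.card_range] at this
  exact this

variable {A : I → ℝ} {hA : BoundedVariationOn A Set.univ}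

lemma estimator_eq_logMean (hrep : ∀ f : I → ℝ, stieltjesIntegral hA f = ∫ t, f t * h t ∂m) (n : ℕ)
    (ω : Ω) : estimator hA X n ω = logMean X m h n ω := by
  rw [estimator, forwardEstimator, backwardEstimator, hrep, hrep]
  rfl

lemma integral_processes_eq_linearPart (hX : IsSample μ X)
    (hrep : ∀ f : I → ℝ, stieltjesIntegral hA f = ∫ t, f t * h t ∂m) (n : ℕ) (ω : Ω) :
    1 / 2 * stieltjesIntegral hA (fun t => (t : ℝ) ^ (-θ) *
      (forwardProcess μ X n t ω + backwardProcess μ X n t ω)) = linearPart μ X θ m h n ω := by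
  rw [hrep, ← integral_const_mul, linearPart]
  refine integral_congr_ae (Eventually.of_forall fun t => ?_)
  simp only [forwardProcess, backwardProcess, meanCount_eq hX, fluctuation]
  rw [show forwardCount X (timeIndex n t) ω = distinct X (Finset.range (timeIndex n t)) ω from rfl,
    show backwardCount X n (timeIndex n t) ω =
      distinct X (Finset.Ico (n - timeIndex n t) n) ω from rfl, mul_comm 2, ← div_div]
  ring

lemma totalCov_comm (s t : I) : totalCov θ s t = totalCov θ t s := by
  rw [totalCov, totalCov, add_comm (s : ℝ), max_comm]

lemma limitVariance_eq (hθ : 0 < θ)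
    (hrep : ∀ f : I → ℝ, stieltjesIntegral hA f = ∫ t, f t * h t ∂m)
    (hint : Integrable (fun q : I × I => totalCov θ q.1 q.2 *
      (((q.1 : ℝ) ^ (-θ) * h q.1) * ((q.2 : ℝ) ^ (-θ) * h q.2))) (m.prod m)) :
    limitVariance hA θ = 1 / 2 * ∫ q : I × I, totalCov θ q.1 q.2 *
      (((q.1 : ℝ) ^ (-θ) * h q.1) * ((q.2 : ℝ) ^ (-θ) * h q.2)) ∂(m.prod m) := by
  rw [limitVariance, hrep, integral_prod _ hint]
  congr 1
  refine integral_congr_ae (Eventually.of_forall fun t => ?_)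
  dsimp only
  rw [hrep, ← integral_mul_const]
  refine integral_congr_ae (Eventually.of_forall fun s => ?_)
  dsimp only
  rw [covK_add_crossCovK hθ, totalCov_comm, Real.mul_rpow s.2.1 t.2.1]
  ring

end Sample

end UrnScheme

theorem theorem3 {Ω : Type*} [MeasurableSpace Ω] (μ : Measure Ω) [IsProbabilityMeasure μ]
    (X : ℕ → Ω → ℕ) (hXmeas : ∀ j, Measurable (X j)) (hXpos : ∀ j, ∀ᵐ ω ∂μ, 1 ≤ X j ω)
    (hXindep : iIndepFun X μ) (hXident : ∀ j, IdentDistrib (X j) (X 0) μ μ)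
    (θ : ℝ) (hθ : θ ∈ Set.Ioo (0 : ℝ) 1) (c : ℝ) (hc : 0 < c) (ε : ℕ → ℝ)
    (hε : ε =o[atTop] fun i : ℕ => (i : ℝ) ^ (-(1 / 2) : ℝ))
    (hp : ∀ i : ℕ, 1 ≤ i →
      μ.real {ω | X 0 ω = i} = c * (i : ℝ) ^ (-(1 / θ)) * (1 + ε i))
    (A : I → ℝ) (hA : BoundedVariationOn A Set.univ)
    (δ : ℝ) (hδ : δ ∈ Set.Ioo (0 : ℝ) 1) (hAδ : ∀ t : I, (t : ℝ) ≤ δ → A t = 0)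
    (hA1 : A 1 = 0)
    (hAlog : UrnScheme.stieltjesIntegral hA (fun t => Real.log (t : ℝ)) = 1) :
    TendstoInMeasure μ
      (fun (n : ℕ) ω =>
        √(UrnScheme.meanCount μ X n) * (UrnScheme.estimator hA X n ω - θ) -
          1 / 2 * UrnScheme.stieltjesIntegral hA (fun t =>
            (t : ℝ) ^ (-θ) *
              (UrnScheme.forwardProcess μ X n t ω + UrnScheme.backwardProcess μ X n t ω)))
      atTop (fun _ => (0 : ℝ)) ∧
    TendstoInMeasure μ (fun (n : ℕ) ω => UrnScheme.estimator hA X n ω) atTop (fun _ => θ) ∧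
    0 < UrnScheme.limitVariance hA θ ∧
    TendstoInDistribution
      (fun (n : ℕ) ω => √(UrnScheme.meanCount μ X n) * (UrnScheme.estimator hA X n ω - θ))
      atTop (id : ℝ → ℝ) (fun _ => μ)
      (gaussianReal 0 (UrnScheme.limitVariance hA θ).toNNReal) := by
  have hX : UrnScheme.IsSample μ X := ⟨hXmeas, hXindep, hXident⟩
  have hw := hX.isWeight
  have hPL : UrnScheme.PowerLaw (UrnScheme.freq μ X) θ (UrnScheme.meanConst θ c) :=
    ⟨hw, hθ, UrnScheme.meanConst_pos hθ hc,
      fun _ hη => UrnScheme.exists_abs_meanFn_sub_le hθ hc hw hε hp hη,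
      fun _ hη => UrnScheme.exists_abs_poissonMean_sub_le hθ hc hw hε hp hη⟩
  obtain ⟨m, h, _, hh, habs, hrep, hm, h0⟩ := UrnScheme.exists_representation hA hδ hAδ hA1
  have hi := UrnScheme.integrable_sign (m := m) hh habs
  have hr := UrnScheme.integrable_rpow_mul_sign hθ.1 hδ.1 hh habs hm
  have hlog : ∫ t : I, Real.log t * h t ∂m = 1 := (hrep _).symm.trans hAlog
  have hlog' : ∫ t : I, (t : ℝ) ^ θ * Real.log t * ((t : ℝ) ^ (-θ) * h t) ∂m ≠ 0 := by
    have : ∫ t : I, (t : ℝ) ^ θ * Real.log t * ((t : ℝ) ^ (-θ) * h t) ∂m =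
        ∫ t : I, Real.log t * h t ∂m := by
      refine integral_congr_ae ?_
      filter_upwards [hm] with t ht
      have ht0 : 0 < (t : ℝ) := hδ.1.trans_le ht
      have e1 : (t : ℝ) ^ θ * (t : ℝ) ^ (-θ) = 1 := by
        rw [← Real.rpow_add ht0, add_neg_cancel, Real.rpow_zero]
      linear_combination Real.log t * h t * e1
    rw [this, hlog]
    exact one_ne_zero
  have hpos := UrnScheme.integral_totalCov_pos hθ (by fun_prop) hr hδ hm hlog'
  have hvar := UrnScheme.limitVariance_eq hθ.1 hrep (Integrable.of_integral_ne_zero hpos.ne')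
  have hvar0 : 0 < UrnScheme.limitVariance hA θ := by
    rw [hvar]
    exact mul_pos one_half_pos hpos
  simp_rw [UrnScheme.integral_processes_eq_linearPart hX hrep, UrnScheme.meanCount_eq hX,
    UrnScheme.estimator_eq_logMean hrep]
  have hE : ∀ n, Integrable (fun ω => √(UrnScheme.meanFn (UrnScheme.freq μ X) n) *
      (UrnScheme.logMean X m h n ω - θ)) μ := fun n =>
    ((hX.integrable_logMean hi n).sub (integrable_const θ)).const_mul _
  have hlin : TendstoInMeasure μ (fun (n : ℕ) ω => √(UrnScheme.meanFn (UrnScheme.freq μ X) n) *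
      (UrnScheme.logMean X m h n ω - θ) - UrnScheme.linearPart μ X θ m h n ω) atTop
      fun _ => (0 : ℝ) := by
    refine UrnScheme.tendstoInMeasure_of_tendsto_integral_abs
      (fun n => (hE n).sub (hX.integrable_linearPart hr n)) ?_
    simpa only [sub_zero] using hX.tendsto_linearization hPL hδ.1 hh habs hm h0 hlog
  refine ⟨hlin, UrnScheme.tendstoInMeasure_of_tendsto_integral_abs (hX.integrable_logMean hi)
    (hX.tendsto_integral_abs_logMean_sub hPL hδ.1 hh habs hm h0 hlog), hvar0, ?_⟩
  exact tendstoInDistribution_of_tendstoInMeasure_sub _ _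
    (hX.tendstoInDistribution_linearPart hPL hδ.1 hr hm hvar0.le hvar) hlin
    fun n => (hE n).aemeasurable
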